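/- (Well-posedness.) Let $n\ge 1$, $0<p<1$, $J_n^+=\{s\ge 0: s(s+n-2)\ge 0\}$, $\sigma\in J_n^+$ and $a\ge \sigma_+/(1-p)$, where $\sigma_+=\max\{\sigma,0\}$. Let $BC_a$ be the space of all $\varphi\in C(\mathbb R^n)$ with $|\varphi(x)|\le \mathrm{const}\cdot|x|^a$ as $|x|\to\infty$, with the norm $\sup_x (1+|x|^2)^{-a/2}|\varphi(x)|$. Let $\mathcal B\varphi=(1-\Delta)^{-1}\varphi=B*\varphi$, where $B(x)=(2\pi)^{-n/2}|x|^{(2-n)/2}K_{(n-2)/2}(|x|)$ is the Bessel kernel ($K_\alpha$ being the modified Bessel function of the second kind). Let $u_0\in BC_a$, $u_0\ge0$, $u_0\not\equiv0$. Consider the Cauchy problem $$\partial_t u-\Delta\partial_t u=\Delta u+V(x,t)u^p\quad (x\in\mathbb R^n,\ t>0),\qquad u(\cdot,0)=u_0.$$ A nonnegative global s-solution in $C([0,\infty);BC_a)$ is a function $0\le u\in C([0,\infty);BC_a)$ such that $\mu=e^tu$ satisfies, on $\mathbb R^n\times[0,\infty)$, $$\mu(t)=u_0+\int_0^t\mathcal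 B\mu(\tau)\,d\tau+\int_0^te^{(1-p)\tau}\mathcal B\big[V(\cdot,\tau)\mu(\tau)^p\big]\,d\tau .$$ For $V\ge0$ continuous on $\mathbb R^n\times(0,\infty)$, a continuous $\Lambda:[0,\infty)\to(0,\infty)$ and constants $\underline\vartheta,\overline\vartheta>0$ consider the condition $$(\ast)\qquad V(x,t)\ge\underline\vartheta\,\Lambda(t)|x|^\sigma\ (|x|\ge1,\ t>0),\qquad V(x,t)\le\overline\vartheta\,\Lambda(t)|x|^\sigma\ (x\in\mathbb R^n,\ t>0),$$ and for $\varepsilon_0>0$ the estimate $$(\ast\ast)\qquad \mathcal B\big(V(\cdot,t)|\cdot|^d\big)(x)\ge\varepsilon_0\,\underline\vartheta\,\Lambda(t)|x|^{\sigma+d}\qquad\text{for all } x\in\mathbb R^n,\ t>0,\ 0\le d\le \tfrac{p\sigma}{1-p}.$$ (0) There is a constant $\varepsilon_0>0$, depending only on $n,\sigma,p$, such that $(\ast\ast)$ holds for all $V,\Lambda,\underline\vartheta,\overline\vartheta$ satisfying $(\ast)$. (1) If $V,\Lambda,\underline\vartheta,\overline\vartheta$ satisfy $(\ast)$, $\varepsilon_0>0$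 is any constant for which $(\ast\ast)$ holds for this $V$, and $p<\varepsilon_0\,\underline\vartheta/\overline\vartheta$, then the Cauchy problem has exactly one nonnegative global s-solution in $C([0,\infty);BC_a)$. (2) If $V(x,t)=\Lambda(t)|x|^\sigma$ for $t>0$, where $\Lambda:[0,\infty)\to(0,\infty)$ is continuous, then (for every $0<p<1$) the Cauchy problem has exactly one nonnegative global s-solution in $C([0,\infty);BC_a)$. -/

import Mathlib

open Set Filter Topology MeasureTheory Asymptotics

noncomputable section

namespace Pseudoparabolic

/-- The space `ℝⁿ` with its Euclidean norm. -/
abbrev Sp (n : ℕ) : Type := EuclideanSpace ℝ (Fin n)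

/-- The modified Bessel function of the second kind `K_α(r)`, for `r > 0`. -/
def besselK (α r : ℝ) : ℝ :=
  ∫ s in Ioi (0 : ℝ), Real.exp (-(r * Real.cosh s)) * Real.cosh (α * s)

/-- The Bessel kernel of order two on `ℝⁿ`, that is, the convolution kernel of `(1 - Δ)⁻¹`:
`B(x) = (2π)^{-n/2} |x|^{(2-n)/2} K_{(n-2)/2}(|x|)` (the value at the null set `{0}` is
irrelevant). The factor `(2π)^{-n/2}` normalizes it to total mass one; for `n = 1` it is
`e^{-|x|} / 2`, for `n = 3` it is `e^{-|x|} / (4π|x|)`. -/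
def besselKernel (n : ℕ) (x : Sp n) : ℝ :=
  (2 * Real.pi) ^ (-((n : ℝ) / 2)) *
    (‖x‖ ^ ((2 - (n : ℝ)) / 2) * besselK (((n : ℝ) - 2) / 2) ‖x‖)

/-- The Bessel potential operator `𝓑 = (1 - Δ)⁻¹`, `𝓑 φ = B ∗ φ`. -/
def besselOp (n : ℕ) (φ : Sp n → ℝ) (x : Sp n) : ℝ :=
  ∫ y, besselKernel n (x - y) * φ y

/-- `φ ∈ BC_a`: `φ` is continuous and `|φ(x)| ≤ const · |x|^a` as `|x| → ∞`. -/
def MemBC {n : ℕ} (a : ℝ) (φ : Sp n → ℝ) : Prop :=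
  Continuous φ ∧ φ =O[cocompact (Sp n)] fun x => ‖x‖ ^ a

/-- The weighted norm `‖φ‖_{R,a} = sup_x (R² + |x|²)^{-a/2} |φ(x)|` on `BC_a`. -/
def wNorm {n : ℕ} (R a : ℝ) (φ : Sp n → ℝ) : ℝ :=
  ⨆ x, (R ^ 2 + ‖x‖ ^ 2) ^ (-(a / 2)) * |φ x|

/-- `u ∈ C([0,∞); BC_a)`; only the times `t ≥ 0` matter. The norms `‖·‖_{R,a}`, `R > 0`, are
equivalent, so that the choice `R = 1` is harmless. -/
def MemZ {n : ℕ} (a : ℝ) (u : ℝ → Sp n → ℝ) : Prop :=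
  (∀ t, 0 ≤ t → MemBC a (u t)) ∧
    ∀ t₀, 0 ≤ t₀ →
      Tendsto (fun t => wNorm 1 a (fun x => u t x - u t₀ x)) (𝓝[Ici 0] t₀) (𝓝 0)

/-- The set `J_n⁺ = {s ≥ 0 : s (s + n - 2) ≥ 0}`. -/
def Jplus (n : ℕ) : Set ℝ := {s | 0 ≤ s ∧ 0 ≤ s * (s + (n : ℝ) - 2)}

/-- `u` is a nonnegative global s-solution in `C([0,∞); BC_a)` of
`∂ₜu - Δ∂ₜu = Δu + V u^p`, `u(0) = u₀`: the function `μ = eᵗ u` satisfies, for all `t ≥ 0`,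
`μ(t) = u₀ + ∫₀ᵗ 𝓑 μ(τ) dτ + ∫₀ᵗ e^{(1-p)τ} 𝓑[V(τ) μ(τ)^p] dτ`. -/
structure IsGlobalSSolution {n : ℕ} (p a : ℝ) (V : ℝ → Sp n → ℝ) (u₀ : Sp n → ℝ)
    (u : ℝ → Sp n → ℝ) : Prop where
  nonneg : ∀ t, 0 ≤ t → ∀ x, 0 ≤ u t x
  memZ : MemZ a u
  memZ_exp : MemZ a (fun t x => Real.exp t * u t x)
  eqn : ∀ t, 0 ≤ t → ∀ x,
    Real.exp t * u t x = u₀ x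
      + (∫ τ in (0 : ℝ)..t, besselOp n (fun y => Real.exp τ * u τ y) x)
      + ∫ τ in (0 : ℝ)..t, Real.exp ((1 - p) * τ) *
          besselOp n (fun y => V τ y * (Real.exp τ * u τ y) ^ p) x

/-- There is exactly one nonnegative global s-solution in `C([0,∞); BC_a)`, as a function on
`ℝⁿ × [0,∞)`. -/
def ExistsUniqueGlobalSSolution {n : ℕ} (p a : ℝ) (V : ℝ → Sp n → ℝ) (u₀ : Sp n → ℝ) : Prop :=
  ∃ u : ℝ → Sp n → ℝ, IsGlobalSSolution p a V u₀ u ∧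
    ∀ v : ℝ → Sp n → ℝ, IsGlobalSSolution p a V u₀ v → ∀ t, 0 ≤ t → ∀ x, v t x = u t x

/-- The two-sided condition on a nonnegative continuous potential `V` (written `V t x`):
`V ≥ ϑ₁ Λ(t) |x|^σ` for `|x| ≥ 1`, `t > 0`, and `V ≤ ϑ₂ Λ(t) |x|^σ` for all `x`, `t > 0`, with
`Λ > 0` continuous and constants `ϑ₁, ϑ₂ > 0`. -/
structure PotentialBounds {n : ℕ} (σ : ℝ) (Λ : ℝ → ℝ) (ϑ₁ ϑ₂ : ℝ) (V : ℝ → Sp n → ℝ) :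
    Prop where
  cont : ContinuousOn (fun q : ℝ × Sp n => V q.1 q.2) (Ioi 0 ×ˢ univ)
  nonneg : ∀ t, 0 < t → ∀ x, 0 ≤ V t x
  cont_rate : ContinuousOn Λ (Ici 0)
  pos_rate : ∀ t, 0 ≤ t → 0 < Λ t
  pos₁ : 0 < ϑ₁
  pos₂ : 0 < ϑ₂
  lower : ∀ t, 0 < t → ∀ x : Sp n, 1 ≤ ‖x‖ → ϑ₁ * Λ t * ‖x‖ ^ σ ≤ V t x
  upper : ∀ t, 0 < t → ∀ x : Sp n, V t x ≤ ϑ₂ * Λ t * ‖x‖ ^ σ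

/-- `ε₀ > 0` is an admissible constant in the lower estimate
`𝓑(V |x|^d) ≥ ε₀ (ϑ₁ Λ(t)) |x|^{σ+d}` for all `x`, `t > 0`, and all exponents
`0 ≤ d ≤ D`, where `ϑ₁ Λ(t)` is the coefficient in the lower bound for `V`. -/
def IsBesselLowerConstant {n : ℕ} (σ D : ℝ) (Λ : ℝ → ℝ) (ϑ₁ : ℝ) (V : ℝ → Sp n → ℝ)
    (ε₀ : ℝ) : Prop :=
  0 < ε₀ ∧ ∀ d, 0 ≤ d → d ≤ D → ∀ t, 0 < t → ∀ x : Sp n,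
    ε₀ * (ϑ₁ * Λ t) * ‖x‖ ^ (σ + d) ≤ besselOp n (fun y => V t y * ‖y‖ ^ d) x

end Pseudoparabolic

end

/-! For m = eᵗu the problem is an integral equation with source e^{(1-p)t} 𝓑[V m^p]. Existence is
soft: the equation is monotone, so the Picard iterates started at zero increase, and they stay below
an explicit supersolution of growth (1+|x|)^a (`picardLimit_fixed`, `picardIter_le`). The difficulty
is uniqueness, because s ↦ s^p is not Lipschitz at 0.

Put E(t) = ∫₀ᵗ e^{(1-p)τ} Λ(τ) dτ (`cumRate`) and β = 1/(1-p). Every solution with nontrivial data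
satisfies m ≥ (ε₀ ϑ₁ (1-p) E |x|^σ)^β (`IsMild.sharp_lower`). This is reached by bootstrapping.
First, m ≥ t 𝓑u₀ decays at most exponentially in x. Reinserting a lower bound into the source
multiplies the decay rate by p, so in the limit m ≥ A E^β (`IsMild.exists_const_lower`). Reinserting
further, now with (∗∗), raises the power of |x| towards σβ and drives the constant to the stated
one, whatever A was.

With this bound the mean value theorem gives e^{(1-p)t} V |m₁^p - m₂^p| ≤ θ β (E'/E) |m₁ - m₂|,
where θ = p ϑ₂/(ε₀ ϑ₁) < 1 (`IsMild.source_sub_le`). The coefficient E'/E is not integrable at t =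
0, but |m₁ - m₂| = O(E^β) by an iteration of the Hölder bound (`IsMild.exists_abs_sub_le`), and ∫ β
(E'/E) E^β = E^β. Hence the difference contracts in the weight e^{Kt} E^β (R+|x|)^a with factor
b(1/K + θ), where b bounds 𝓑 on the weight (R+|x|)^a. Since b → 1 as R → ∞ (`tendsto_growthConst`),
the factor is below one for large R and K (`IsMild.unique`).

All facts on 𝓑 come from writing B as a mixture of Gaussians: B is a radial probability density with
an exponential moment and an exponential lower bound. Estimate (∗∗) holds because at least half of
the mass of B outside the unit ball moves x to a point of norm at least max(|x|, 1). For V = Λ|x|^σ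
one may take ε₀ = 1, since 𝓑|x|^s ≥ |x|^s for s ∈ J_n⁺ (`norm_rpow_le_besselOp`): such powers are
subharmonic. Then θ = p < 1. -/

noncomputable section

namespace Pseudoparabolic

/-! ### The Bessel kernel as a mixture of Gaussians -/

/-- The heat kernel at time `t` and distance `r`, damped by `e^{-t}`. -/
def dampedHeat (n : ℕ) (t r : ℝ) : ℝ :=
  Real.exp (-t) * (4 * Real.pi * t) ^ (-((n : ℝ) / 2)) * Real.exp (-(r ^ 2 / (4 * t)))

lemma dampedHeat_nonneg (n : ℕ) {t : ℝ} (ht : 0 < t) (r : ℝ) : 0 ≤ dampedHeat n t r := by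
  unfold dampedHeat; positivity

lemma measurable_besselK (α : ℝ) : Measurable (besselK α) := by
  have h : StronglyMeasurable fun q : ℝ × ℝ =>
      Real.exp (-(q.1 * Real.cosh q.2)) * Real.cosh (α * q.2) := by
    apply Continuous.stronglyMeasurable; fun_prop
  exact (h.integral_prod_right' (ν := volume.restrict (Ioi 0))).measurable

lemma measurable_besselKernel (n : ℕ) : Measurable (besselKernel n) := by
  unfold besselKernel
  have := (measurable_besselK (((n : ℝ) - 2) / 2)).comp (measurable_norm (α := Sp n))
  simp only [Function.comp_def] at this
  fun_prop

lemma besselK_nonneg (α r : ℝ) : 0 ≤ besselK α r :=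
  integral_nonneg fun s => by positivity

lemma besselKernel_nonneg (n : ℕ) (x : Sp n) : 0 ≤ besselKernel n x := by
  have := besselK_nonneg (((n : ℝ) - 2) / 2) ‖x‖
  unfold besselKernel; positivity

lemma besselKernel_congr_norm (n : ℕ) {x y : Sp n} (h : ‖x‖ = ‖y‖) :
    besselKernel n x = besselKernel n y := by
  unfold besselKernel; rw [h]

/-- Reflecting the negative half-line pairs e^{-αs} with e^{αs}, and cosh is even. -/
lemma lintegral_besselK_fold (α r : ℝ) :
    ∫⁻ s, ENNReal.ofReal (Real.exp (-(r * Real.cosh s)) * Real.exp (-(α * s))) =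
      ∫⁻ s in Ioi (0 : ℝ),
        ENNReal.ofReal (2 * (Real.exp (-(r * Real.cosh s)) * Real.cosh (α * s))) := by
  set g : ℝ → ENNReal := fun s =>
    ENNReal.ofReal (Real.exp (-(r * Real.cosh s)) * Real.exp (-(α * s))) with hg
  have hgm : Measurable g := by rw [hg]; fun_prop
  rw [← lintegral_add_compl g (measurableSet_Ioi (a := (0 : ℝ)))]
  have h1 : ∫⁻ s in (Ioi (0 : ℝ))ᶜ, g s = ∫⁻ s in Ioi (0 : ℝ), g (-s) := by
    rw [compl_Ioi, ← restrict_Iio_eq_restrict_Iic]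
    have := (Measure.measurePreserving_neg (volume : Measure ℝ)).setLIntegral_comp_preimage
      (measurableSet_Iio (a := (0 : ℝ))) hgm
    rw [← this]
    simp
  rw [h1, ← lintegral_add_left hgm]
  refine lintegral_congr fun s => ?_
  rw [hg]
  simp only
  rw [← ENNReal.ofReal_add (by positivity) (by positivity), Real.cosh_neg, Real.cosh_eq (α * s)]
  congr 1
  rw [show -(α * -s) = α * s by ring]; ring

/-- The substitution t = (r/2) eˢ turns t + r²/(4t) into r cosh s. -/
lemma lintegral_dampedHeat_subst (n : ℕ) {r : ℝ} (hr : 0 < r) :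
    ∫⁻ t in Ioi (0 : ℝ), ENNReal.ofReal (dampedHeat n t r) =
      ∫⁻ s, ENNReal.ofReal ((4 * Real.pi) ^ (-((n : ℝ) / 2)) * (r / 2) ^ ((2 - (n : ℝ)) / 2) *
        (Real.exp (-(r * Real.cosh s)) * Real.exp (-(((n : ℝ) - 2) / 2 * s)))) := by
  have himg : (fun s : ℝ => r / 2 * Real.exp s) '' univ = Ioi 0 := by
    ext t
    simp only [image_univ, mem_range, mem_Ioi]
    constructor
    · rintro ⟨s, rfl⟩; positivity
    · intro ht
      refine ⟨Real.log (t / (r / 2)), ?_⟩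
      rw [Real.exp_log (by positivity)]; field_simp
  rw [← himg, lintegral_image_eq_lintegral_abs_deriv_mul MeasurableSet.univ
    (f' := fun s => r / 2 * Real.exp s)
    (fun s _ => ((Real.hasDerivAt_exp s).const_mul _).hasDerivWithinAt)
    (fun s _ s' _ h => by
      have : Real.exp s = Real.exp s' := by
        have h2 : r / 2 ≠ 0 := by positivity
        exact mul_left_cancel₀ h2 h
      exact Real.exp_injective this)]
  rw [Measure.restrict_univ]
  refine lintegral_congr fun s => ?_
  rw [← ENNReal.ofReal_mul (by positivity), abs_of_pos (by positivity)]
  congr 1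
  unfold dampedHeat
  have hc : Real.exp (-(r * Real.cosh s)) =
      Real.exp (-(r / 2 * Real.exp s)) * Real.exp (-(r ^ 2 / (4 * (r / 2 * Real.exp s)))) := by
    rw [← Real.exp_add, Real.cosh_eq, Real.exp_neg s]
    congr 1
    field_simp
    ring
  have hr2 : (r / 2 : ℝ) ^ ((2 - (n : ℝ)) / 2) = (r / 2) * (r / 2) ^ (-((n : ℝ) / 2)) := by
    rw [show (2 - (n : ℝ)) / 2 = 1 + (-((n : ℝ) / 2)) by ring, Real.rpow_add (by positivity),
      Real.rpow_one]
  have he : Real.exp (-(((n : ℝ) - 2) / 2 * s)) =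
      Real.exp s * (Real.exp s) ^ (-((n : ℝ) / 2)) := by
    rw [← Real.exp_mul, ← Real.exp_add]; congr 1; ring
  rw [hc, hr2, he, Real.mul_rpow (x := 4 * Real.pi) (by positivity) (by positivity),
    Real.mul_rpow (x := r / 2) (by positivity) (by positivity)]
  ring

lemma lintegral_dampedHeat_eq (n : ℕ) {r : ℝ} (hr : 0 < r) :
    ∫⁻ t in Ioi (0 : ℝ), ENNReal.ofReal (dampedHeat n t r) =
      ∫⁻ s in Ioi (0 : ℝ), ENNReal.ofReal ((2 * Real.pi) ^ (-((n : ℝ) / 2)) *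
        (r ^ ((2 - (n : ℝ)) / 2) *
          (Real.exp (-(r * Real.cosh s)) * Real.cosh (((n : ℝ) - 2) / 2 * s)))) := by
  rw [lintegral_dampedHeat_subst n hr]
  simp_rw [ENNReal.ofReal_mul (show 0 ≤ (4 * Real.pi) ^ (-((n : ℝ) / 2)) *
    (r / 2) ^ ((2 - (n : ℝ)) / 2) by positivity)]
  rw [lintegral_const_mul _ (by fun_prop), lintegral_besselK_fold, ← lintegral_const_mul _
    (by fun_prop)]
  refine lintegral_congr fun s => ?_
  rw [← ENNReal.ofReal_mul (by positivity)]
  congr 1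
  have h4 : (4 * Real.pi) ^ (-((n : ℝ) / 2)) =
      (2 * Real.pi) ^ (-((n : ℝ) / 2)) * 2 ^ (-((n : ℝ) / 2)) := by
    rw [← Real.mul_rpow (by positivity) (by positivity)]; congr 1; ring
  have h5 : (2 : ℝ) ^ (-((n : ℝ) / 2)) * 2 = 2 ^ ((2 - (n : ℝ)) / 2) := by
    rw [show (2 - (n : ℝ)) / 2 = (-((n : ℝ) / 2)) + 1 by ring, Real.rpow_add (by positivity),
      Real.rpow_one]
  have h6 : (2 : ℝ) ^ ((2 - (n : ℝ)) / 2) ≠ 0 := by positivity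
  rw [h4, Real.div_rpow hr.le (by norm_num), ← h5]
  field_simp

/-- Finiteness is not needed yet: a divergent integral would give zero on both sides. Finiteness
almost everywhere follows later from the total mass. -/
lemma besselKernel_eq_toReal (n : ℕ) {x : Sp n} (hx : x ≠ 0) :
    besselKernel n x =
      (∫⁻ t in Ioi (0 : ℝ), ENNReal.ofReal (dampedHeat n t ‖x‖)).toReal := by
  rw [lintegral_dampedHeat_eq n (norm_pos_iff.mpr hx),
    ← integral_eq_lintegral_of_nonneg_ae (ae_of_all _ fun s => by positivity)
      (by fun_prop), integral_const_mul, integral_const_mul]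
  rfl

/-- Tonelli for the Gaussian mixture with damping `e^{-ct}` and spatial spread `q`. -/
lemma lintegral_gaussian_mixture (n : ℕ) {c q : ℝ} (hc : 0 < c) (hq : 0 < q) :
    ∫⁻ x : Sp n, ∫⁻ t in Ioi (0 : ℝ), ENNReal.ofReal (Real.exp (-(c * t)) *
      (4 * Real.pi * t) ^ (-((n : ℝ) / 2)) * Real.exp (-(‖x‖ ^ 2 / (q * t)))) =
      ENNReal.ofReal ((q / 4) ^ ((n : ℝ) / 2) * c⁻¹) := by
  rw [lintegral_lintegral_swap (by
    apply Measurable.aemeasurable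
    simp only [Function.uncurry_def]
    fun_prop)]
  have h : ∀ t ∈ Ioi (0 : ℝ), ∫⁻ x : Sp n, ENNReal.ofReal (Real.exp (-(c * t)) *
      (4 * Real.pi * t) ^ (-((n : ℝ) / 2)) * Real.exp (-(‖x‖ ^ 2 / (q * t)))) =
      ENNReal.ofReal ((q / 4) ^ ((n : ℝ) / 2)) * ENNReal.ofReal (Real.exp (-c * t)) := by
    intro t ht
    have ht : 0 < t := ht
    have hb : 0 < 1 / (q * t) := by positivity
    have hI := GaussianFourier.integral_rexp_neg_mul_sq_norm (V := Sp n) hb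
    have hpos : 0 < ∫ v : Sp n, Real.exp (-(1 / (q * t)) * ‖v‖ ^ 2) := by
      rw [hI]; positivity
    -- Integrability is read off from the nonzero value of the integral, since a non-integrable
    -- function has integral zero by convention.
    have hint : Integrable fun v : Sp n => Real.exp (-(1 / (q * t)) * ‖v‖ ^ 2) := by
      by_contra hcon
      rw [integral_undef hcon] at hpos
      exact lt_irrefl _ hpos
    simp_rw [ENNReal.ofReal_mul (show 0 ≤ Real.exp (-(c * t)) *
      (4 * Real.pi * t) ^ (-((n : ℝ) / 2)) by positivity)]
    rw [lintegral_const_mul _ (by fun_prop)]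
    have : ∀ x : Sp n, -(‖x‖ ^ 2 / (q * t)) = -(1 / (q * t)) * ‖x‖ ^ 2 := fun x => by ring
    simp_rw [this]
    rw [← ofReal_integral_eq_lintegral_ofReal hint (ae_of_all _ fun _ => by positivity), hI,
      ← ENNReal.ofReal_mul (by positivity), ← ENNReal.ofReal_mul (by positivity)]
    congr 1
    rw [finrank_euclideanSpace_fin, show Real.pi / (1 / (q * t)) = (q / 4) * (4 * Real.pi * t) by
      field_simp, Real.mul_rpow (x := q / 4) (by positivity) (by positivity), Real.rpow_neg (by positivity)]
    have : (4 * Real.pi * t) ^ ((n : ℝ) / 2) ≠ 0 := by positivity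
    rw [show -(c * t) = -c * t by ring]
    field_simp
  rw [setLIntegral_congr_fun measurableSet_Ioi h, lintegral_const_mul _ (by fun_prop),
    ← ofReal_integral_eq_lintegral_ofReal (integrableOn_exp_mul_Ioi (by linarith) 0)
      (ae_of_all _ fun _ => by positivity), integral_exp_mul_Ioi (by linarith),
    ← ENNReal.ofReal_mul (by positivity)]
  congr 1
  simp [neg_div_neg_eq]

lemma lintegral_mixture_eq_one (n : ℕ) :
    ∫⁻ x : Sp n, ∫⁻ t in Ioi (0 : ℝ), ENNReal.ofReal (dampedHeat n t ‖x‖) = 1 := by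
  have := lintegral_gaussian_mixture n (c := 1) (q := 4) one_pos (by norm_num)
  simpa [dampedHeat] using this

instance nullSingletonClass_volume (n : ℕ) [NeZero n] : NullSingletonClass (volume : Measure (Sp n)) := by
  have : Nontrivial (Sp n) := by
    apply Module.nontrivial_of_finrank_pos (R := ℝ)
    rw [finrank_euclideanSpace_fin]
    exact Nat.pos_of_ne_zero (NeZero.ne n)
  infer_instance

lemma measurable_mixture (n : ℕ) :
    Measurable fun x : Sp n => ∫⁻ t in Ioi (0 : ℝ), ENNReal.ofReal (dampedHeat n t ‖x‖) := by
  apply Measurable.lintegral_prod_right' (f := fun q : Sp n × ℝ =>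
    ENNReal.ofReal (dampedHeat n q.2 ‖q.1‖))
  unfold dampedHeat
  fun_prop

lemma ofReal_besselKernel_ae (n : ℕ) [NeZero n] : ∀ᵐ x : Sp n,
    ENNReal.ofReal (besselKernel n x) =
      ∫⁻ t in Ioi (0 : ℝ), ENNReal.ofReal (dampedHeat n t ‖x‖) := by
  have h1 : ∀ᵐ x : Sp n, ∫⁻ t in Ioi (0 : ℝ), ENNReal.ofReal (dampedHeat n t ‖x‖) < ⊤ :=
    ae_lt_top (measurable_mixture n) (by rw [lintegral_mixture_eq_one]; exact ENNReal.one_ne_top)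
  have h2 : ∀ᵐ x : Sp n, x ≠ 0 := by
    have : volume ({0} : Set (Sp n)) = 0 := measure_singleton 0
    exact measure_eq_zero_iff_ae_notMem.mp this
  filter_upwards [h1, h2] with x hx hx0
  rw [besselKernel_eq_toReal n hx0, ENNReal.ofReal_toReal hx.ne]

/-- The probability measure with density the Bessel kernel. -/
def bessMeas (n : ℕ) : Measure (Sp n) :=
  volume.withDensity fun z => ENNReal.ofReal (besselKernel n z)

instance isProbabilityMeasure_bessMeas (n : ℕ) [NeZero n] : IsProbabilityMeasure (bessMeas n) := by
  constructor
  rw [bessMeas, withDensity_apply _ MeasurableSet.univ, Measure.restrict_univ,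
    lintegral_congr_ae (ofReal_besselKernel_ae n), lintegral_mixture_eq_one]

lemma integral_bessMeas (n : ℕ) (g : Sp n → ℝ) :
    ∫ z, g z ∂bessMeas n = ∫ z, besselKernel n z * g z := by
  rw [bessMeas, integral_withDensity_eq_integral_toReal_smul
    (measurable_besselKernel n).ennreal_ofReal (ae_of_all _ fun _ => ENNReal.ofReal_lt_top)]
  refine integral_congr_ae (ae_of_all _ fun z => ?_)
  simp [ENNReal.toReal_ofReal (besselKernel_nonneg n z)]

lemma besselOp_eq_integral (n : ℕ) (φ : Sp n → ℝ) (x : Sp n) :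
    besselOp n φ x = ∫ z, φ (x - z) ∂bessMeas n := by
  rw [integral_bessMeas, besselOp,
    ← integral_sub_left_eq_self (fun y => besselKernel n (x - y) * φ y) volume x]
  simp

lemma lintegral_exp_norm_bessMeas_lt_top (n : ℕ) [NeZero n] :
    ∫⁻ z, ENNReal.ofReal (Real.exp (‖z‖ / 2)) ∂bessMeas n < ⊤ := by
  rw [bessMeas, lintegral_withDensity_eq_lintegral_mul _
    (measurable_besselKernel n).ennreal_ofReal (by fun_prop)]
  refine lt_of_le_of_lt ?_ ((lintegral_gaussian_mixture n (c := 1 / 2) (q := 8) (by norm_num)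
    (by norm_num)).trans_lt ENNReal.ofReal_lt_top)
  refine lintegral_mono_ae ?_
  filter_upwards [ofReal_besselKernel_ae n] with x hx
  simp only [Pi.mul_apply]
  rw [hx, ← lintegral_mul_const _ (by unfold dampedHeat; fun_prop)]
  refine setLIntegral_mono' measurableSet_Ioi fun t ht => ?_
  have ht : 0 < t := ht
  rw [← ENNReal.ofReal_mul (dampedHeat_nonneg n ht _)]
  apply ENNReal.ofReal_le_ofReal
  unfold dampedHeat
  -- Completing the square gives |x|/2 ≤ t/2 + |x|²/(8t): half of the damping and half of the
  -- Gaussian exponent pay for the exponential moment.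
  have key : Real.exp (-t) * Real.exp (-(‖x‖ ^ 2 / (4 * t))) * Real.exp (‖x‖ / 2) ≤
      Real.exp (-(1 / 2 * t)) * Real.exp (-(‖x‖ ^ 2 / (8 * t))) := by
    rw [← Real.exp_add, ← Real.exp_add, ← Real.exp_add, Real.exp_le_exp]
    have h : 0 ≤ (2 * t - ‖x‖) ^ 2 / (8 * t) := by positivity
    have h2 : (2 * t - ‖x‖) ^ 2 / (8 * t) = t / 2 - ‖x‖ / 2 + ‖x‖ ^ 2 / (8 * t) := by
      field_simp; ring
    have h3 : ‖x‖ ^ 2 / (4 * t) = ‖x‖ ^ 2 / (8 * t) + ‖x‖ ^ 2 / (8 * t) := by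
      field_simp; ring
    linarith
  calc _ = (4 * Real.pi * t) ^ (-((n : ℝ) / 2)) *
        (Real.exp (-t) * Real.exp (-(‖x‖ ^ 2 / (4 * t))) * Real.exp (‖x‖ / 2)) := by ring
    _ ≤ (4 * Real.pi * t) ^ (-((n : ℝ) / 2)) *
        (Real.exp (-(1 / 2 * t)) * Real.exp (-(‖x‖ ^ 2 / (8 * t)))) := by gcongr
    _ = _ := by ring

lemma integrable_exp_norm_bessMeas (n : ℕ) [NeZero n] :
    Integrable (fun z => Real.exp (‖z‖ / 2)) (bessMeas n) := by
  refine ⟨(by fun_prop : Continuous fun z : Sp n => Real.exp (‖z‖ / 2)).aestronglyMeasurable, ?_⟩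
  rw [hasFiniteIntegral_iff_ofReal (ae_of_all _ fun _ => by positivity)]
  exact lintegral_exp_norm_bessMeas_lt_top n

/-- Only the times t between |x| + 1 and |x| + 2 are kept. There t + |x|²/(4t) ≤ 2 + 5|x|/4, and t ≤
e^{2+|x|} controls the factor t^{-n/2}; this explains the value of κ. -/
lemma exists_exp_le_besselKernel (n : ℕ) [NeZero n] : ∃ c κ : ℝ, 0 < c ∧ 0 < κ ∧
    ∀ᵐ x : Sp n, c * Real.exp (-(κ * ‖x‖)) ≤ besselKernel n x := by
  refine ⟨Real.exp (-2) * (4 * Real.pi * Real.exp 2) ^ (-((n : ℝ) / 2)), 5 / 4 + n / 2,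
    by positivity, by positivity, ?_⟩
  filter_upwards [ofReal_besselKernel_ae n] with x hx
  rw [← ENNReal.ofReal_le_ofReal_iff (besselKernel_nonneg n x), hx]
  set r := ‖x‖ with hr
  have hr0 : 0 ≤ r := norm_nonneg _
  calc _ = ∫⁻ t in Ioc (r + 1) (r + 2), ENNReal.ofReal
        (Real.exp (-2) * (4 * Real.pi * Real.exp 2) ^ (-((n : ℝ) / 2)) *
          Real.exp (-((5 / 4 + n / 2) * r))) := by
        rw [setLIntegral_const, Real.volume_Ioc]; norm_num
    _ ≤ ∫⁻ t in Ioc (r + 1) (r + 2), ENNReal.ofReal (dampedHeat n t r) := by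
        refine setLIntegral_mono' measurableSet_Ioc fun t ht => ENNReal.ofReal_le_ofReal ?_
        have ht0 : 0 < t := by linarith [ht.1]
        have h1 : (4 * Real.pi * (Real.exp 2 * Real.exp r)) ^ (-((n : ℝ) / 2)) ≤
            (4 * Real.pi * t) ^ (-((n : ℝ) / 2)) := by
          apply Real.rpow_le_rpow_of_nonpos (by positivity)
          · have : t ≤ Real.exp 2 * Real.exp r := by
              rw [← Real.exp_add]
              linarith [Real.add_one_le_exp (2 + r), ht.2]
            gcongr
          · have : (0 : ℝ) ≤ n := Nat.cast_nonneg n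
            linarith
        rw [← mul_assoc, Real.mul_rpow (by positivity) (by positivity), ← Real.exp_mul] at h1
        have h2 : Real.exp (-2 - 5 / 4 * r) ≤
            Real.exp (-t) * Real.exp (-(r ^ 2 / (4 * t))) := by
          rw [← Real.exp_add, Real.exp_le_exp]
          have : r ^ 2 / (4 * t) ≤ r / 4 := by
            rw [div_le_div_iff₀ (by positivity) (by norm_num)]
            nlinarith [ht.1]
          linarith [ht.2]
        unfold dampedHeat
        calc _ = (4 * Real.pi * Real.exp 2) ^ (-((n : ℝ) / 2)) *
              Real.exp (r * -((n : ℝ) / 2)) * Real.exp (-2 - 5 / 4 * r) := by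
              rw [show -((5 / 4 + (n : ℝ) / 2) * r) = r * -((n : ℝ) / 2) + (- 5 / 4 * r) by ring,
                Real.exp_add, show -2 - 5 / 4 * r = -2 + (- 5 / 4 * r) by ring, Real.exp_add]
              ring
          _ ≤ (4 * Real.pi * t) ^ (-((n : ℝ) / 2)) *
              (Real.exp (-t) * Real.exp (-(r ^ 2 / (4 * t)))) := by gcongr
          _ = _ := by ring
    _ ≤ _ := lintegral_mono_set fun t ht => by
        have := ht.1
        simp only [mem_Ioi]; linarith

lemma map_bessMeas (n : ℕ) (e : Sp n ≃ₗᵢ[ℝ] Sp n) :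
    MeasurePreserving e (bessMeas n) (bessMeas n) := by
  refine ⟨e.continuous.measurable, ?_⟩
  ext s hs
  have hsm := e.continuous.measurable hs
  rw [Measure.map_apply e.continuous.measurable hs, bessMeas, withDensity_apply _ hs,
    withDensity_apply _ hsm,
    ← e.measurePreserving.setLIntegral_comp_preimage hs
      (measurable_besselKernel n).ennreal_ofReal]
  refine setLIntegral_congr_fun hsm fun z _ => ?_
  rw [besselKernel_congr_norm n (e.norm_map z)]

/-! ### The Bessel potential operator on functions of polynomial growth -/

lemma one_add_rpow_le_exp {a r : ℝ} (ha : 0 ≤ a) (hr : 0 ≤ r) :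
    (1 + r) ^ a ≤ (2 * (a + 1)) ^ a * Real.exp (1 / 2) * Real.exp (r / 2) := by
  have h1 : 1 + r ≤ 2 * (a + 1) * Real.exp ((1 + r) / (2 * (a + 1))) := by
    have := Real.add_one_le_exp ((1 + r) / (2 * (a + 1)))
    have h2 : 1 + r = 2 * (a + 1) * ((1 + r) / (2 * (a + 1))) := by field_simp
    calc 1 + r = 2 * (a + 1) * ((1 + r) / (2 * (a + 1))) := h2
      _ ≤ _ := by gcongr; linarith
  calc (1 + r) ^ a ≤ (2 * (a + 1) * Real.exp ((1 + r) / (2 * (a + 1)))) ^ a := by gcongr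
    _ = (2 * (a + 1)) ^ a * Real.exp ((1 + r) / (2 * (a + 1)) * a) := by
        rw [Real.mul_rpow (by positivity) (by positivity), ← Real.exp_mul]
    _ ≤ (2 * (a + 1)) ^ a * Real.exp (1 / 2 + r / 2) := by
        gcongr
        rw [div_mul_eq_mul_div, div_le_iff₀ (by positivity)]
        nlinarith
    _ = _ := by rw [Real.exp_add]; ring

/-- The cost of a translation by z depends on |z|/R only, so it disappears as R → ∞. -/
lemma growth_sub_le {n : ℕ} {R a : ℝ} (hR : 0 < R) (ha : 0 ≤ a) (x z : Sp n) :
    (R + ‖x - z‖) ^ a ≤ (R + ‖x‖) ^ a * (1 + ‖z‖ / R) ^ a := by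
  rw [← Real.mul_rpow (by positivity) (by positivity)]
  apply Real.rpow_le_rpow (by positivity) _ ha
  have h := norm_sub_le x z
  have h2 : (R + ‖x‖) * (1 + ‖z‖ / R) = R + ‖x‖ + ‖z‖ + ‖x‖ * ‖z‖ / R := by
    field_simp; ring
  have h3 : 0 ≤ ‖x‖ * ‖z‖ / R := by positivity
  linarith

lemma integrable_growth (n : ℕ) [NeZero n] {R a : ℝ} (hR : 1 ≤ R) (ha : 0 ≤ a) :
    Integrable (fun z => (1 + ‖z‖ / R) ^ a) (bessMeas n) := by
  refine Integrable.mono' ((integrable_exp_norm_bessMeas n).const_mul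
    ((2 * (a + 1)) ^ a * Real.exp (1 / 2))) (by fun_prop) (ae_of_all _ fun z => ?_)
  rw [Real.norm_of_nonneg (by positivity)]
  refine le_trans ?_ (one_add_rpow_le_exp ha (norm_nonneg z))
  apply Real.rpow_le_rpow (by positivity) _ ha
  have := div_le_self (norm_nonneg z) hR
  linarith

/-- The operator norm bound of `𝓑` on the space weighted by `(R + |x|)^a`. -/
def growthConst (n : ℕ) (a R : ℝ) : ℝ := ∫ z, (1 + ‖z‖ / R) ^ a ∂bessMeas n

lemma growthConst_pos (n : ℕ) [NeZero n] {R a : ℝ} (hR : 1 ≤ R) (ha : 0 ≤ a) :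
    0 < growthConst n a R := by
  have h : ∫ _z, (1 : ℝ) ∂bessMeas n ≤ growthConst n a R :=
    integral_mono (integrable_const _) (integrable_growth n hR ha)
      fun z => Real.one_le_rpow (by have : 0 ≤ ‖z‖ / R := by positivity
                                    linarith) ha
  simp at h
  linarith

/-- Dominated convergence, B having mass one. In the uniqueness proof this makes the loss caused by
the spatial weight arbitrarily small, so that the strict inequality on p survives. -/
lemma tendsto_growthConst (n : ℕ) [NeZero n] {a : ℝ} (ha : 0 ≤ a) :
    Tendsto (growthConst n a) atTop (𝓝 1) := by
  have h1 : (1 : ℝ) = ∫ _z, (1 : ℝ) ∂bessMeas n := by simp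
  rw [h1]
  refine tendsto_integral_filter_of_dominated_convergence (fun z => (1 + ‖z‖ / 1) ^ a)
    (Eventually.of_forall fun R => by fun_prop) ?_ (integrable_growth n le_rfl ha)
    (ae_of_all _ fun z => ?_)
  · filter_upwards [eventually_ge_atTop 1] with R hR
    refine ae_of_all _ fun z => ?_
    rw [Real.norm_of_nonneg (by positivity)]
    gcongr
  · have h : Tendsto (fun R : ℝ => 1 + ‖z‖ / R) atTop (𝓝 (1 + 0)) :=
      tendsto_const_nhds.add (tendsto_const_nhds.div_atTop tendsto_id)
    have := h.rpow_const (p := a) (Or.inl (by norm_num))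
    simpa using this

lemma integrable_comp_sub {n : ℕ} [NeZero n] {R a C : ℝ} (hR : 1 ≤ R) (ha : 0 ≤ a)
    {φ : Sp n → ℝ} (hφ : Measurable φ) (hb : ∀ y, |φ y| ≤ C * (R + ‖y‖) ^ a) (x : Sp n) :
    Integrable (fun z => φ (x - z)) (bessMeas n) := by
  have hC : 0 ≤ C := by
    have := (abs_nonneg _).trans (hb 0)
    by_contra h
    have h2 : 0 < (R + ‖(0 : Sp n)‖) ^ a := by positivity
    nlinarith
  refine Integrable.mono' (((integrable_growth n hR ha).const_mul (C * (R + ‖x‖) ^ a)))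
    (hφ.comp (measurable_const.sub measurable_id)).aestronglyMeasurable (ae_of_all _ fun z => ?_)
  rw [Real.norm_eq_abs]
  calc _ ≤ C * (R + ‖x - z‖) ^ a := hb _
    _ ≤ C * ((R + ‖x‖) ^ a * (1 + ‖z‖ / R) ^ a) := by
      gcongr; exact growth_sub_le (by linarith) ha x z
    _ = _ := by ring

lemma abs_besselOp_le {n : ℕ} [NeZero n] {R a C : ℝ} (hR : 1 ≤ R) (ha : 0 ≤ a)
    {φ : Sp n → ℝ} (hφ : Measurable φ) (hb : ∀ y, |φ y| ≤ C * (R + ‖y‖) ^ a) (x : Sp n) :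
    |besselOp n φ x| ≤ growthConst n a R * C * (R + ‖x‖) ^ a := by
  have hC : 0 ≤ C := by
    have := (abs_nonneg _).trans (hb 0)
    by_contra h
    have h2 : 0 < (R + ‖(0 : Sp n)‖) ^ a := by positivity
    nlinarith
  rw [besselOp_eq_integral, growthConst, mul_assoc, mul_comm, ← integral_const_mul]
  refine (abs_integral_le_integral_abs).trans ?_
  refine integral_mono (integrable_comp_sub hR ha hφ hb x).abs
    ((integrable_growth n hR ha).const_mul _) fun z => ?_
  calc _ ≤ C * (R + ‖x - z‖) ^ a := hb _
    _ ≤ C * ((R + ‖x‖) ^ a * (1 + ‖z‖ / R) ^ a) := by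
      gcongr; exact growth_sub_le (by linarith) ha x z
    _ = _ := by ring

lemma besselOp_mono {n : ℕ} {φ ψ : Sp n → ℝ} {x : Sp n}
    (hφ : Integrable (fun z => φ (x - z)) (bessMeas n))
    (hψ : Integrable (fun z => ψ (x - z)) (bessMeas n)) (h : ∀ y, φ y ≤ ψ y) :
    besselOp n φ x ≤ besselOp n ψ x := by
  rw [besselOp_eq_integral, besselOp_eq_integral]
  exact integral_mono hφ hψ fun z => h _

lemma besselOp_nonneg {n : ℕ} {φ : Sp n → ℝ} (h : ∀ y, 0 ≤ φ y) (x : Sp n) :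
    0 ≤ besselOp n φ x := by
  rw [besselOp_eq_integral]
  exact integral_nonneg fun z => h _

lemma besselOp_add {n : ℕ} {φ ψ : Sp n → ℝ} {x : Sp n}
    (hφ : Integrable (fun z => φ (x - z)) (bessMeas n))
    (hψ : Integrable (fun z => ψ (x - z)) (bessMeas n)) :
    besselOp n (fun y => φ y + ψ y) x = besselOp n φ x + besselOp n ψ x := by
  rw [besselOp_eq_integral, besselOp_eq_integral, besselOp_eq_integral]
  exact integral_add hφ hψ

lemma besselOp_sub {n : ℕ} {φ ψ : Sp n → ℝ} {x : Sp n}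
    (hφ : Integrable (fun z => φ (x - z)) (bessMeas n))
    (hψ : Integrable (fun z => ψ (x - z)) (bessMeas n)) :
    besselOp n (fun y => φ y - ψ y) x = besselOp n φ x - besselOp n ψ x := by
  rw [besselOp_eq_integral, besselOp_eq_integral, besselOp_eq_integral]
  exact integral_sub hφ hψ

lemma besselOp_const_mul {n : ℕ} (c : ℝ) (φ : Sp n → ℝ) (x : Sp n) :
    besselOp n (fun y => c * φ y) x = c * besselOp n φ x := by
  rw [besselOp_eq_integral, besselOp_eq_integral]
  exact integral_const_mul _ _

/-! ### Lower bounds -/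

lemma volume_absolutelyContinuous_bessMeas (n : ℕ) [NeZero n] : volume ≪ bessMeas n := by
  obtain ⟨c, κ, hc, -, h⟩ := exists_exp_le_besselKernel n
  refine withDensity_absolutelyContinuous' (measurable_besselKernel n).ennreal_ofReal.aemeasurable ?_
  filter_upwards [h] with x hx
  have : 0 < besselKernel n x := lt_of_lt_of_le (by positivity) hx
  simpa using this

lemma bessMeas_neg (n : ℕ) : MeasurePreserving (fun z : Sp n => -z) (bessMeas n) (bessMeas n) :=
  map_bessMeas n (LinearIsometryEquiv.neg ℝ)

/-- Half of the `e^{-κ|z|}`-weighted mass of the Bessel kernel outside the unit ball. -/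
def halfMass (n : ℕ) (κ : ℝ) : ℝ :=
  (1 / 2) * ∫ z in {z : Sp n | 1 ≤ ‖z‖}, Real.exp (-(κ * ‖z‖)) ∂bessMeas n

lemma integrable_exp_neg_norm (n : ℕ) [NeZero n] {κ : ℝ} (hκ : 0 ≤ κ) :
    Integrable (fun z => Real.exp (-(κ * ‖z‖))) (bessMeas n) := by
  refine Integrable.mono' (integrable_const 1)
    (by fun_prop : Continuous fun z : Sp n => Real.exp (-(κ * ‖z‖))).aestronglyMeasurable
    (ae_of_all _ fun z => ?_)
  rw [Real.norm_of_nonneg (by positivity), Real.exp_le_one_iff]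
  have : 0 ≤ κ * ‖z‖ := by positivity
  linarith

lemma halfMass_pos (n : ℕ) [NeZero n] {κ : ℝ} (hκ : 0 ≤ κ) : 0 < halfMass n κ := by
  have h : 0 < ∫ z in {z : Sp n | 1 ≤ ‖z‖}, Real.exp (-(κ * ‖z‖)) ∂bessMeas n := by
    rw [setIntegral_pos_iff_support_of_nonneg_ae (ae_of_all _ fun _ => by positivity)
      (integrable_exp_neg_norm n hκ).integrableOn]
    have hs : Function.support (fun z : Sp n => Real.exp (-(κ * ‖z‖))) = univ := by
      ext z; simp [(Real.exp_pos _).ne']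
    rw [hs, univ_inter, pos_iff_ne_zero]
    intro h0
    have h1 := volume_absolutelyContinuous_bessMeas n h0
    have h2 : volume {z : Sp n | 1 < ‖z‖} = 0 :=
      measure_mono_null (fun z (hz : 1 < ‖z‖) => (show 1 ≤ ‖z‖ from hz.le)) h1
    have ho : IsOpen {z : Sp n | 1 < ‖z‖} := isOpen_lt continuous_const continuous_norm
    have hne : ({z : Sp n | 1 < ‖z‖}).Nonempty := by
      refine ⟨EuclideanSpace.single 0 2, ?_⟩
      simp
    exact (ho.measure_pos volume hne).ne' h2
  unfold halfMass
  positivity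

/-- The part outside the unit ball of the half space opposite to `x`. -/
def oppositeCap {n : ℕ} (x : Sp n) : Set (Sp n) := {z | inner ℝ x z ≤ 0 ∧ 1 ≤ ‖z‖}

lemma measurableSet_oppositeCap {n : ℕ} (x : Sp n) : MeasurableSet (oppositeCap x) := by
  have h1 : IsClosed {z : Sp n | inner ℝ x z ≤ 0} := isClosed_le (by fun_prop) continuous_const
  have h2 : IsClosed {z : Sp n | 1 ≤ ‖z‖} := isClosed_le continuous_const continuous_norm
  exact (h1.inter h2).measurableSet

/-- On the cap, |x - z|² = |x|² - 2⟨x, z⟩ + |z|² ≥ |x|² + 1. -/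
lemma norm_le_norm_sub_of_mem_oppositeCap {n : ℕ} {x z : Sp n} (hz : z ∈ oppositeCap x) :
    ‖x‖ ≤ ‖x - z‖ ∧ 1 ≤ ‖x - z‖ := by
  have h := norm_sub_sq_real x z
  have h1 := hz.1
  have h2 := hz.2
  have h3 := norm_nonneg x
  have h4 := norm_nonneg (x - z)
  constructor <;> nlinarith

/-- The caps of x and -x cover the exterior of the unit ball and are exchanged by z ↦ -z, which
preserves the measure; so each carries at least half. -/
lemma halfMass_le (n : ℕ) [NeZero n] {κ : ℝ} (hκ : 0 ≤ κ) (x : Sp n) :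
    halfMass n κ ≤ ∫ z in oppositeCap x, Real.exp (-(κ * ‖z‖)) ∂bessMeas n := by
  set f : Sp n → ℝ := fun z => Real.exp (-(κ * ‖z‖)) with hf
  have hfi : Integrable f (bessMeas n) := integrable_exp_neg_norm n hκ
  have hneg : ∫ z in oppositeCap (-x), f z ∂bessMeas n = ∫ z in oppositeCap x, f z ∂bessMeas n := by
    have := (bessMeas_neg n).setIntegral_preimage_emb
      (Homeomorph.neg (Sp n)).measurableEmbedding f (oppositeCap x)
    rw [← this]
    have hset : (fun z : Sp n => -z) ⁻¹' oppositeCap x = oppositeCap (-x) := by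
      ext z; simp [oppositeCap]
    rw [hset]
    refine setIntegral_congr_fun (measurableSet_oppositeCap _) fun z _ => ?_
    simp [hf]
  have hsub : {z : Sp n | 1 ≤ ‖z‖} ⊆ oppositeCap x ∪ oppositeCap (-x) := by
    intro z hz
    rcases le_total (inner ℝ x z) 0 with h | h
    · exact Or.inl ⟨h, hz⟩
    · exact Or.inr ⟨by simpa using h, hz⟩
  have h1 : ∫ z in {z : Sp n | 1 ≤ ‖z‖}, f z ∂bessMeas n ≤
      ∫ z in oppositeCap x ∪ oppositeCap (-x), f z ∂bessMeas n :=
    setIntegral_mono_set hfi.integrableOn (ae_of_all _ fun _ => by positivity)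
      (Eventually.of_forall hsub)
  have h2 : ∫ z in oppositeCap x ∪ oppositeCap (-x), f z ∂bessMeas n ≤
      ∫ z in oppositeCap x, f z ∂bessMeas n + ∫ z in oppositeCap (-x), f z ∂bessMeas n := by
    have h := integral_mono_measure (μ := (bessMeas n).restrict (oppositeCap x ∪ oppositeCap (-x)))
      (ν := (bessMeas n).restrict (oppositeCap x) + (bessMeas n).restrict (oppositeCap (-x)))
      (f := f) (Measure.restrict_union_le _ _) (ae_of_all _ fun _ => by positivity)
      (Integrable.add_measure hfi.integrableOn hfi.integrableOn)
    rwa [integral_add_measure hfi.integrableOn hfi.integrableOn] at h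
  unfold halfMass
  rw [hneg] at h2
  linarith

/-- Used in two ways: with κ = 0 it yields the constant in (∗∗), and with κ > 0 it flattens
exponentially decaying lower bounds of solutions. -/
lemma halfMass_mul_le_besselOp {n : ℕ} [NeZero n] {κ L : ℝ} (hκ : 0 ≤ κ) {φ : Sp n → ℝ}
    {x : Sp n} (hφ : Integrable (fun z => φ (x - z)) (bessMeas n)) (h0 : ∀ y, 0 ≤ φ y)
    (hL : 0 ≤ L) (h : ∀ z ∈ oppositeCap x, L * Real.exp (-(κ * ‖z‖)) ≤ φ (x - z)) :
    halfMass n κ * L ≤ besselOp n φ x := by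
  rw [besselOp_eq_integral]
  calc _ ≤ (∫ z in oppositeCap x, Real.exp (-(κ * ‖z‖)) ∂bessMeas n) * L := by
        gcongr; exact halfMass_le n hκ x
    _ = ∫ z in oppositeCap x, L * Real.exp (-(κ * ‖z‖)) ∂bessMeas n := by
        rw [integral_const_mul, mul_comm]
    _ ≤ ∫ z in oppositeCap x, φ (x - z) ∂bessMeas n :=
        setIntegral_mono_on ((integrable_exp_neg_norm n hκ).const_mul L).integrableOn
          hφ.integrableOn (measurableSet_oppositeCap x) h
    _ ≤ _ := setIntegral_le_integral hφ (ae_of_all _ fun z => h0 _)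

/-- By continuity φ exceeds φ(y₀)/2 on a ball about some y₀. In the variable z = x - y this ball is
centred at x - y₀, where the kernel is at least c e^{-κ(|x| + |y₀| + ρ)}. -/
lemma exists_exp_le_besselOp {n : ℕ} [NeZero n] {R a C : ℝ} (hR : 1 ≤ R) (ha : 0 ≤ a)
    {φ : Sp n → ℝ} (hφ : Continuous φ) (hb : ∀ y, |φ y| ≤ C * (R + ‖y‖) ^ a)
    (h0 : ∀ y, 0 ≤ φ y) (hne : ∃ y, φ y ≠ 0) :
    ∃ c κ : ℝ, 0 < c ∧ 0 < κ ∧ ∀ x, c * Real.exp (-(κ * ‖x‖)) ≤ besselOp n φ x := by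
  obtain ⟨c, κ, hc, hκ, hB⟩ := exists_exp_le_besselKernel n
  obtain ⟨y₀, hy₀⟩ := hne
  have hpos : 0 < φ y₀ := lt_of_le_of_ne (h0 _) (Ne.symm hy₀)
  obtain ⟨ρ, hρ, hball⟩ := Metric.eventually_nhds_iff_ball.mp
    (hφ.continuousAt.eventually (lt_mem_nhds (half_lt_self hpos)))
  have hvol : 0 < volume.real (Metric.ball y₀ ρ) :=
    ENNReal.toReal_pos (Metric.measure_ball_pos volume y₀ hρ).ne' measure_ball_lt_top.ne
  refine ⟨φ y₀ / 2 * (c * Real.exp (-(κ * (‖y₀‖ + ρ))) * volume.real (Metric.ball y₀ ρ)), κ,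
    by positivity, hκ, fun x => ?_⟩
  have hS : MeasurableSet (Metric.ball (x - y₀) ρ) := measurableSet_ball
  have hmeas : c * Real.exp (-(κ * (‖y₀‖ + ρ))) * Real.exp (-(κ * ‖x‖)) *
      volume.real (Metric.ball y₀ ρ) ≤ (bessMeas n).real (Metric.ball (x - y₀) ρ) := by
    rw [Measure.real, Measure.real, bessMeas, withDensity_apply _ hS]
    rw [← ENNReal.toReal_ofReal (show 0 ≤ c * Real.exp (-(κ * (‖y₀‖ + ρ))) *
      Real.exp (-(κ * ‖x‖)) by positivity), ← ENNReal.toReal_mul]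
    apply ENNReal.toReal_mono
    · have := measure_lt_top (bessMeas n) (Metric.ball (x - y₀) ρ)
      rw [bessMeas, withDensity_apply _ hS] at this
      exact this.ne
    · rw [Measure.addHaar_ball_center volume y₀ ρ, ← Measure.addHaar_ball_center volume (x - y₀) ρ,
        ← setLIntegral_const]
      refine lintegral_mono_ae ?_
      filter_upwards [ae_restrict_of_ae hB, ae_restrict_mem hS] with z hz hzS
      apply ENNReal.ofReal_le_ofReal
      refine le_trans ?_ hz
      rw [mul_assoc, ← Real.exp_add]
      gcongr
      have h1 : ‖z‖ ≤ ‖x‖ + (‖y₀‖ + ρ) := by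
        have h2 : ‖z - (x - y₀)‖ < ρ := by simpa [dist_eq_norm] using hzS
        have h3 : ‖z‖ ≤ ‖z - (x - y₀)‖ + ‖x - y₀‖ := by
          simpa using norm_add_le (z - (x - y₀)) (x - y₀)
        have h4 := norm_sub_le x y₀
        linarith
      nlinarith
  have hint := integrable_comp_sub hR ha hφ.measurable hb x
  rw [besselOp_eq_integral]
  calc _ = φ y₀ / 2 * (c * Real.exp (-(κ * (‖y₀‖ + ρ))) * Real.exp (-(κ * ‖x‖)) *
      volume.real (Metric.ball y₀ ρ)) := by ring
    _ ≤ φ y₀ / 2 * (bessMeas n).real (Metric.ball (x - y₀) ρ) := by gcongr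
    _ = ∫ z in Metric.ball (x - y₀) ρ, φ y₀ / 2 ∂bessMeas n := by
        rw [setIntegral_const, smul_eq_mul, mul_comm]
    _ ≤ ∫ z in Metric.ball (x - y₀) ρ, φ (x - z) ∂bessMeas n := by
        refine setIntegral_mono_on (integrable_const _).integrableOn hint.integrableOn hS ?_
        intro z hz
        refine (hball (x - z) ?_).le
        rw [Metric.mem_ball, dist_eq_norm] at hz ⊢
        rw [← norm_neg]
        rwa [show -(x - z - y₀) = z - (x - y₀) by abel]
    _ ≤ _ := setIntegral_le_integral hint (ae_of_all _ fun z => h0 _)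

/-- Potentials bounded below by `θ |x|^σ` off the unit ball. -/
lemma bessel_lower_estimate {n : ℕ} [NeZero n] {σ d θ Θ : ℝ} (hσ : 0 ≤ σ) (hd : 0 ≤ d)
    (hθ : 0 ≤ θ) {W : Sp n → ℝ} (hW : Measurable W) (hW0 : ∀ y, 0 ≤ W y)
    (hlow : ∀ y, 1 ≤ ‖y‖ → θ * ‖y‖ ^ σ ≤ W y) (hup : ∀ y, W y ≤ Θ * ‖y‖ ^ σ) (x : Sp n) :
    halfMass n 0 * θ * ‖x‖ ^ (σ + d) ≤ besselOp n (fun y => W y * ‖y‖ ^ d) x := by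
  have hΘ : 0 ≤ Θ := by
    have h1 := (hW0 (EuclideanSpace.single 0 1)).trans (hup (EuclideanSpace.single 0 1))
    rwa [PiLp.norm_single, norm_one, Real.one_rpow, mul_one] at h1
  have hint : Integrable (fun z => (fun y => W y * ‖y‖ ^ d) (x - z)) (bessMeas n) := by
    refine integrable_comp_sub (φ := fun y => W y * ‖y‖ ^ d) (R := 1) (a := σ + d) (C := Θ) le_rfl
      (by positivity) (by fun_prop) (fun y => ?_) x
    rw [abs_of_nonneg (by have := hW0 y; positivity), Real.rpow_add (by positivity), ← mul_assoc]
    have h1 : ‖y‖ ≤ 1 + ‖y‖ := by linarith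
    calc W y * ‖y‖ ^ d ≤ Θ * ‖y‖ ^ σ * ‖y‖ ^ d := by gcongr; exact hup y
      _ ≤ _ := by gcongr
  rw [mul_assoc]
  refine halfMass_mul_le_besselOp le_rfl hint (fun y => by have := hW0 y; positivity)
    (by positivity) fun z hz => ?_
  obtain ⟨h1, h2⟩ := norm_le_norm_sub_of_mem_oppositeCap hz
  have h3 : ‖x - z‖ ^ (σ + d) = ‖x - z‖ ^ σ * ‖x - z‖ ^ d := Real.rpow_add (by linarith) _ _
  calc θ * ‖x‖ ^ (σ + d) * Real.exp (-(0 * ‖z‖)) = θ * ‖x‖ ^ (σ + d) := by simp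
    _ ≤ θ * ‖x - z‖ ^ (σ + d) := by gcongr
    _ = θ * ‖x - z‖ ^ σ * ‖x - z‖ ^ d := by rw [h3]; ring
    _ ≤ W (x - z) * ‖x - z‖ ^ d := by gcongr; exact hlow _ h2

/-! ### Continuity -/

/-- The weighted kernel B(z)(1+|z|)^a is integrable, hence an L¹ limit of continuous functions with
compact support. Their convolutions with φ, after removal of the weight, are continuous and
approximate 𝓑φ uniformly near each point. -/
lemma continuous_besselOp {n : ℕ} [NeZero n] {a C : ℝ} (ha : 0 ≤ a)
    {φ : Sp n → ℝ} (hφ : Measurable φ) (hb : ∀ y, |φ y| ≤ C * (1 + ‖y‖) ^ a) :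
    Continuous (besselOp n φ) := by
  have hC : 0 ≤ C := by simpa using (abs_nonneg _).trans (hb 0)
  set h : Sp n → ℝ := fun z => besselKernel n z * (1 + ‖z‖) ^ a with hh
  have hhi : Integrable h := by
    have h1 := integrable_growth n (R := 1) le_rfl ha
    rw [bessMeas, integrable_withDensity_iff_integrable_smul'
      (measurable_besselKernel n).ennreal_ofReal (ae_of_all _ fun _ => ENNReal.ofReal_lt_top)] at h1
    refine h1.congr (ae_of_all _ fun z => ?_)
    simp [hh, ENNReal.toReal_ofReal (besselKernel_nonneg n z)]
  have hloc : LocallyIntegrable φ (volume : Measure (Sp n)) := by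
    refine LocallyIntegrable.mono (g := φ)
      (f := fun y : Sp n => C * (1 + ‖y‖) ^ a) ?_ hφ.aestronglyMeasurable (ae_of_all _ fun y => ?_)
    · apply Continuous.locallyIntegrable
      have : ∀ y : Sp n, 1 + ‖y‖ ≠ 0 := fun y => by positivity
      exact continuous_const.mul ((by fun_prop : Continuous fun y : Sp n => 1 + ‖y‖).rpow_const
        fun y => Or.inl (this y))
    · rw [Real.norm_eq_abs]; exact (hb y).trans (le_abs_self _)
  have hwc : Continuous fun z : Sp n => ((1 + ‖z‖) ^ a)⁻¹ := by
    refine Continuous.inv₀ ((by fun_prop : Continuous fun y : Sp n => 1 + ‖y‖).rpow_const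
        fun y => Or.inl (by positivity)) fun y => by positivity
  refine continuous_of_locally_uniform_approx_of_continuousAt fun x₀ u hu => ?_
  obtain ⟨ε, hε, hεu⟩ := Metric.mem_uniformity_dist.mp hu
  have hK : 0 < C * (2 + ‖x₀‖) ^ a + 1 := by positivity
  obtain ⟨g, hgs, hgint, hgc, hgi⟩ := hhi.exists_hasCompactSupport_integral_sub_le
    (ε := ε / 2 / (C * (2 + ‖x₀‖) ^ a + 1)) (by positivity)
  set k : Sp n → ℝ := fun z => g z * ((1 + ‖z‖) ^ a)⁻¹ with hk
  have hkc : Continuous k := hgc.mul hwc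
  have hks : HasCompactSupport k := hgs.mul_right
  refine ⟨Metric.ball x₀ 1, Metric.ball_mem_nhds _ one_pos,
    convolution k φ (ContinuousLinearMap.mul ℝ ℝ) volume,
    (hks.continuous_convolution_left _ hkc hloc).continuousAt, fun x hx => ?_⟩
  apply hεu
  rw [Real.dist_eq]
  have hi1 : Integrable fun z => besselKernel n z * φ (x - z) := by
    have h1 := integrable_comp_sub (R := 1) le_rfl ha hφ hb x
    rw [bessMeas, integrable_withDensity_iff_integrable_smul'
      (measurable_besselKernel n).ennreal_ofReal (ae_of_all _ fun _ => ENNReal.ofReal_lt_top)] at h1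
    refine h1.congr (ae_of_all _ fun z => ?_)
    simp [ENNReal.toReal_ofReal (besselKernel_nonneg n z)]
  have hi2 : Integrable fun z => k z * φ (x - z) :=
    hks.convolutionExists_left (ContinuousLinearMap.mul ℝ ℝ) hkc hloc x
  rw [besselOp_eq_integral, integral_bessMeas, convolution]
  simp only [ContinuousLinearMap.mul_apply']
  rw [← integral_sub hi1 hi2]
  have hx1 : ‖x‖ ≤ 1 + ‖x₀‖ := by
    have h1 : ‖x - x₀‖ < 1 := by simpa [dist_eq_norm] using hx
    have := norm_add_le (x - x₀) x₀
    simp only [sub_add_cancel] at this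
    linarith
  have hpt : ∀ z, |besselKernel n z * φ (x - z) - k z * φ (x - z)| ≤
      C * (2 + ‖x₀‖) ^ a * ‖h z - g z‖ := by
    intro z
    have hw : 0 < (1 + ‖z‖) ^ a := by positivity
    have e1 : h z - g z = (besselKernel n z - k z) * (1 + ‖z‖) ^ a := by
      simp only [hh, hk]; field_simp
    have h3 := growth_sub_le (R := 1) one_pos ha x z
    have h4 : (1 + ‖x‖) ^ a ≤ (2 + ‖x₀‖) ^ a := by
      apply Real.rpow_le_rpow (by positivity) _ ha; linarith
    rw [← sub_mul, abs_mul, e1, norm_mul, Real.norm_eq_abs, Real.norm_of_nonneg hw.le]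
    calc _ ≤ |besselKernel n z - k z| * (C * (1 + ‖x - z‖) ^ a) := by gcongr; exact hb _
      _ ≤ |besselKernel n z - k z| * (C * ((2 + ‖x₀‖) ^ a * (1 + ‖z‖) ^ a)) := by
          gcongr
          refine h3.trans ?_
          rw [div_one]
          gcongr
      _ = _ := by ring
  calc _ ≤ ∫ z, C * (2 + ‖x₀‖) ^ a * ‖h z - g z‖ :=
        (abs_integral_le_integral_abs).trans (integral_mono (hi1.sub hi2).abs
          ((hhi.sub hgi).norm.const_mul _) hpt)
    _ = C * (2 + ‖x₀‖) ^ a * ∫ z, ‖h z - g z‖ := integral_const_mul _ _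
    _ ≤ C * (2 + ‖x₀‖) ^ a * (ε / 2 / (C * (2 + ‖x₀‖) ^ a + 1)) := by gcongr
    _ ≤ ε / 2 := by
        rw [mul_div_assoc', div_le_iff₀ hK]
        nlinarith
    _ < ε := half_lt_self hε

/-! ### The sub-mean-value property of powers of the norm -/

/-- The tangent line to exp at s log X. It converts a mean value inequality for log|·| into one for
|·|^s. -/
lemma rpow_mul_one_add_log_le {X w s : ℝ} (hX : 0 < X) (hw : 0 < w) :
    X ^ s * (1 + s * (Real.log w - Real.log X)) ≤ w ^ s := by
  have h := Real.add_one_le_exp (s * (Real.log w - Real.log X))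
  have h2 : w ^ s = X ^ s * Real.exp (s * (Real.log w - Real.log X)) := by
    rw [Real.rpow_def_of_pos hw, Real.rpow_def_of_pos hX, ← Real.exp_add]
    congr 1; ring
  rw [h2]
  gcongr
  linarith

/-- The function `|·|^s` is subharmonic on the plane. -/
lemma two_pi_mul_rpow_le_integral_circle {X s : ℝ} (hX : 0 < X) (hs : 0 < s) (ζ : ℂ) :
    2 * Real.pi * X ^ s ≤ ∫ θ in (0 : ℝ)..2 * Real.pi, ‖(X : ℂ) - circleMap 0 1 θ * ζ‖ ^ s := by
  rcases eq_or_ne ζ 0 with rfl | hζ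
  · simp [abs_of_pos hX]
  set a : ℂ := X / ζ with ha
  have hnorm : ∀ θ, ‖(X : ℂ) - circleMap 0 1 θ * ζ‖ = ‖ζ‖ * ‖circleMap 0 1 θ - a‖ := by
    intro θ
    rw [← norm_mul, ← norm_neg]
    congr 1
    rw [ha]; field_simp; ring
  have hζ0 : 0 < ‖ζ‖ := norm_pos_iff.mpr hζ
  have hpi := Real.pi_pos
  have hlogint : IntervalIntegrable (fun θ => Real.log ‖circleMap 0 1 θ - a‖) volume 0
      (2 * Real.pi) := circleIntegrable_log_norm_sub_const (a := a) (c := 0) 1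
  -- Jensen's formula: the mean of log|e^{iθ} - a| over the circle is log⁺|a|, which is at least
  -- log|a|.
  have hlog : 2 * Real.pi * Real.log ‖a‖ ≤
      ∫ θ in (0 : ℝ)..2 * Real.pi, Real.log ‖circleMap 0 1 θ - a‖ := by
    have h := circleAverage_log_norm_sub_const_eq_posLog (a := a)
    rw [Real.circleAverage_def, smul_eq_mul] at h
    have h2 : ∫ θ in (0 : ℝ)..2 * Real.pi, Real.log ‖circleMap 0 1 θ - a‖ =
        2 * Real.pi * Real.posLog ‖a‖ := by
      rw [← h]; field_simp
    rw [h2]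
    gcongr
    rw [Real.posLog_def]; exact le_max_right _ _
  have hXlog : Real.log X = Real.log ‖ζ‖ + Real.log ‖a‖ := by
    have : X = ‖ζ‖ * ‖a‖ := by
      rw [← norm_mul, ha, mul_div_cancel₀ _ hζ]; simp [abs_of_pos hX]
    conv_lhs => rw [this]
    rw [Real.log_mul hζ0.ne']
    rw [ha]; simp [hζ, hX.ne']
  have hae : ∀ᵐ θ : ℝ, circleMap 0 1 θ ≠ a := by
    have := ((countable_singleton a).preimage_circleMap 0 one_ne_zero).measure_zero volume
    exact measure_eq_zero_iff_ae_notMem.mp this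
  calc 2 * Real.pi * X ^ s
      ≤ ∫ θ in (0 : ℝ)..2 * Real.pi, X ^ s * ((1 - s * Real.log ‖a‖) +
          s * Real.log ‖circleMap 0 1 θ - a‖) := by
        rw [intervalIntegral.integral_const_mul, intervalIntegral.integral_add (by simp)
          (hlogint.const_mul s), intervalIntegral.integral_const_mul,
          intervalIntegral.integral_const, smul_eq_mul]
        rw [mul_comm]
        gcongr
        nlinarith
    _ ≤ _ := by
        refine intervalIntegral.integral_mono_ae (by positivity)
          (((by simp : IntervalIntegrable (fun _ : ℝ => 1 - s * Real.log ‖a‖) volume 0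
            (2 * Real.pi)).add (hlogint.const_mul s)).const_mul _) ?_ ?_
        · apply Continuous.intervalIntegrable
          exact (by fun_prop : Continuous fun θ => ‖(X : ℂ) - circleMap 0 1 θ * ζ‖).rpow_const
            fun _ => Or.inr hs.le
        · filter_upwards [hae] with θ hθ
          have hd : 0 < ‖circleMap 0 1 θ - a‖ := norm_pos_iff.mpr (sub_ne_zero.mpr hθ)
          have h := rpow_mul_one_add_log_le (s := s) hX (mul_pos hζ0 hd)
          rw [← hnorm θ] at h
          refine le_trans (le_of_eq ?_) h
          rw [hnorm θ, Real.log_mul hζ0.ne' hd.ne', hXlog]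
          ring

/-- The rotation by the angle `θ` in the plane spanned by two orthonormal vectors. -/
def planeRot {n : ℕ} (e₁ e₂ : Sp n) (θ : ℝ) : Sp n →ₗ[ℝ] Sp n where
  toFun y := y + ((Real.cos θ - 1) * inner ℝ e₁ y - Real.sin θ * inner ℝ e₂ y) • e₁ +
    (Real.sin θ * inner ℝ e₁ y + (Real.cos θ - 1) * inner ℝ e₂ y) • e₂
  map_add' y z := by simp only [inner_add_right]; module
  map_smul' c y := by simp only [inner_smul_right, RingHom.id_apply]; module

lemma planeRot_apply {n : ℕ} (e₁ e₂ : Sp n) (θ : ℝ) (y : Sp n) : planeRot e₁ e₂ θ y =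
    y + ((Real.cos θ - 1) * inner ℝ e₁ y - Real.sin θ * inner ℝ e₂ y) • e₁ +
    (Real.sin θ * inner ℝ e₁ y + (Real.cos θ - 1) * inner ℝ e₂ y) • e₂ := rfl

variable {n : ℕ} {e₁ e₂ : Sp n}

lemma inner_planeRot_fst (h₁ : ‖e₁‖ = 1) (h₁₂ : inner ℝ e₁ e₂ = 0) (θ : ℝ)
    (y : Sp n) : inner ℝ e₁ (planeRot e₁ e₂ θ y) =
      Real.cos θ * inner ℝ e₁ y - Real.sin θ * inner ℝ e₂ y := by
  rw [planeRot_apply]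
  simp only [inner_add_right, inner_smul_right, real_inner_self_eq_norm_sq, h₁, h₁₂]
  ring

lemma inner_planeRot_snd (h₂ : ‖e₂‖ = 1) (h₁₂ : inner ℝ e₁ e₂ = 0) (θ : ℝ)
    (y : Sp n) : inner ℝ e₂ (planeRot e₁ e₂ θ y) =
      Real.sin θ * inner ℝ e₁ y + Real.cos θ * inner ℝ e₂ y := by
  rw [planeRot_apply]
  have h₂₁ : inner ℝ e₂ e₁ = 0 := by rw [real_inner_comm]; exact h₁₂
  simp only [inner_add_right, inner_smul_right, real_inner_self_eq_norm_sq, h₂, h₂₁]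
  ring

lemma norm_planeRot (h₁ : ‖e₁‖ = 1) (h₂ : ‖e₂‖ = 1) (h₁₂ : inner ℝ e₁ e₂ = 0) (θ : ℝ)
    (y : Sp n) : ‖planeRot e₁ e₂ θ y‖ = ‖y‖ := by
  have h₂₁ : inner ℝ e₂ e₁ = 0 := by rw [real_inner_comm]; exact h₁₂
  have h : ‖planeRot e₁ e₂ θ y‖ ^ 2 = ‖y‖ ^ 2 := by
    rw [← real_inner_self_eq_norm_sq, planeRot_apply]
    simp only [inner_add_right, inner_add_left, inner_smul_right, inner_smul_left,
      real_inner_self_eq_norm_sq, h₁, h₂, h₂₁, h₁₂, real_inner_comm e₁ y, real_inner_comm e₂ y]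
    simp only [conj_trivial]
    have hcs := Real.sin_sq_add_cos_sq θ
    linear_combination ((inner ℝ e₁ y) ^ 2 + (inner ℝ e₂ y) ^ 2) * hcs
  exact (sq_eq_sq₀ (norm_nonneg _) (norm_nonneg _)).mp h

lemma measurePreserving_planeRot (h₁ : ‖e₁‖ = 1) (h₂ : ‖e₂‖ = 1) (h₁₂ : inner ℝ e₁ e₂ = 0)
    (θ : ℝ) : MeasurePreserving (planeRot e₁ e₂ θ) (bessMeas n) (bessMeas n) :=
  map_bessMeas n ((⟨planeRot e₁ e₂ θ, norm_planeRot h₁ h₂ h₁₂ θ⟩ :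
    Sp n →ₗᵢ[ℝ] Sp n).toLinearIsometryEquiv rfl)

lemma continuous_planeRot : Continuous fun q : ℝ × Sp n => planeRot e₁ e₂ q.1 q.2 := by
  simp only [planeRot_apply]
  fun_prop

/-- The left side is the length of the orthogonal projection of X e₁ minus the rotated y to the
plane of e₁ and e₂, and projecting shortens. This reduces the mean value inequality in dimension n ≥
2 to the planar one. -/
lemma norm_circle_sub_le (h₁ : ‖e₁‖ = 1) (h₂ : ‖e₂‖ = 1) (h₁₂ : inner ℝ e₁ e₂ = 0)
    (X θ : ℝ) (y : Sp n) :
    ‖(X : ℂ) - circleMap 0 1 θ * ⟨inner ℝ e₁ y, inner ℝ e₂ y⟩‖ ≤ ‖X • e₁ - planeRot e₁ e₂ θ y‖ := by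
  set v := X • e₁ - planeRot e₁ e₂ θ y with hv
  have hb : (inner ℝ e₁ v) ^ 2 + (inner ℝ e₂ v) ^ 2 ≤ ‖v‖ ^ 2 := by
    have h₂₁ : inner ℝ e₂ e₁ = 0 := by rw [real_inner_comm]; exact h₁₂
    have h := sq_nonneg ‖v - (inner ℝ e₁ v) • e₁ - (inner ℝ e₂ v) • e₂‖
    rw [← real_inner_self_eq_norm_sq] at h
    simp only [inner_sub_right, inner_sub_left, inner_smul_right, inner_smul_left,
      real_inner_self_eq_norm_sq, h₁, h₂, h₂₁, h₁₂, real_inner_comm e₁ v,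
      real_inner_comm e₂ v, conj_trivial] at h
    linarith
  have h1 : inner ℝ e₁ v = X - (Real.cos θ * inner ℝ e₁ y - Real.sin θ * inner ℝ e₂ y) := by
    rw [hv, inner_sub_right, inner_smul_right, inner_planeRot_fst h₁ h₁₂,
      real_inner_self_eq_norm_sq, h₁]
    ring
  have h2 : inner ℝ e₂ v = -(Real.sin θ * inner ℝ e₁ y + Real.cos θ * inner ℝ e₂ y) := by
    rw [hv, inner_sub_right, inner_smul_right, inner_planeRot_snd h₂ h₁₂,
      real_inner_comm, h₁₂]
    ring
  rw [← sq_le_sq₀ (norm_nonneg _) (norm_nonneg _)]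
  refine le_trans (le_of_eq ?_) hb
  rw [Complex.sq_norm, Complex.normSq_apply, h1, h2]
  have hc : circleMap 0 1 θ = ⟨Real.cos θ, Real.sin θ⟩ := by
    apply Complex.ext
    · simp [circleMap, Complex.exp_ofReal_mul_I_re]
    · simp [circleMap, Complex.exp_ofReal_mul_I_im]
  rw [hc]
  simp only [Complex.sub_re, Complex.mul_re, Complex.sub_im, Complex.mul_im, Complex.ofReal_re,
    Complex.ofReal_im]
  ring

lemma exists_orthonormal_pair {n : ℕ} (hn : 2 ≤ n) {x : Sp n} (hx : x ≠ 0) :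
    ∃ e₁ e₂ : Sp n, ‖e₁‖ = 1 ∧ ‖e₂‖ = 1 ∧ inner ℝ e₁ e₂ = 0 ∧ x = ‖x‖ • e₁ := by
  set e₁ : Sp n := ‖x‖⁻¹ • x with he
  have hx0 : ‖x‖ ≠ 0 := norm_ne_zero_iff.mpr hx
  have h1 : ‖e₁‖ = 1 := by rw [he, norm_smul]; simp [hx0]
  have hrank : 0 < Module.finrank ℝ (ℝ ∙ e₁)ᗮ := by
    have h := Submodule.finrank_add_finrank_orthogonal (ℝ ∙ e₁)
    rw [finrank_euclideanSpace_fin, finrank_span_singleton (by rw [← norm_ne_zero_iff, h1]; simp)]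
      at h
    omega
  have : Nontrivial (ℝ ∙ e₁)ᗮ := Module.nontrivial_of_finrank_pos (R := ℝ) hrank
  obtain ⟨⟨v, hv⟩, hv0⟩ := exists_ne (0 : (ℝ ∙ e₁)ᗮ)
  have hv0 : v ≠ 0 := fun h => hv0 (by ext1; exact h)
  have hvn : ‖v‖ ≠ 0 := norm_ne_zero_iff.mpr hv0
  refine ⟨e₁, ‖v‖⁻¹ • v, h1, by rw [norm_smul]; simp [hvn], ?_, ?_⟩
  · rw [inner_smul_right, Submodule.mem_orthogonal_singleton_iff_inner_right.mp hv, mul_zero]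
  · rw [he, smul_smul, mul_inv_cancel₀ hx0, one_smul]

lemma integrable_norm_sub_rpow (n : ℕ) [NeZero n] {s : ℝ} (hs : 0 ≤ s) (x : Sp n) :
    Integrable (fun z => ‖x - z‖ ^ s) (bessMeas n) := by
  refine integrable_comp_sub (φ := fun y => ‖y‖ ^ s) (C := 1) le_rfl hs (by fun_prop)
    (fun y => ?_) x
  rw [abs_of_nonneg (by positivity), one_mul]
  gcongr
  linarith

/-- The measure is invariant under rotations of a plane through x, so by Fubini the integral equals
its average over all angles; for each fixed z that average is at least |x|^s. -/
lemma norm_rpow_le_integral_of_two_le {n : ℕ} [NeZero n] (hn : 2 ≤ n) {s : ℝ} (hs : 0 < s)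
    (x : Sp n) : ‖x‖ ^ s ≤ ∫ z, ‖x - z‖ ^ s ∂bessMeas n := by
  rcases eq_or_ne x 0 with rfl | hx
  · rw [norm_zero, Real.zero_rpow hs.ne']
    exact integral_nonneg fun z => by positivity
  obtain ⟨e₁, e₂, h₁, h₂, h₁₂, hxe⟩ := exists_orthonormal_pair hn hx
  have hpi := Real.pi_pos
  have hX : 0 < ‖x‖ := norm_pos_iff.mpr hx
  have hrot : ∀ θ : ℝ, ∫ z, ‖x - planeRot e₁ e₂ θ z‖ ^ s ∂bessMeas n =
      ∫ z, ‖x - z‖ ^ s ∂bessMeas n := by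
    intro θ
    have h := measurePreserving_planeRot h₁ h₂ h₁₂ θ
    conv_rhs => rw [← h.map_eq]
    rw [integral_map h.measurable.aemeasurable]
    exact (by fun_prop : Measurable fun z : Sp n => ‖x - z‖ ^ s).aestronglyMeasurable
  have hint : Integrable (Function.uncurry fun (θ : ℝ) (z : Sp n) =>
      ‖x - planeRot e₁ e₂ θ z‖ ^ s)
      ((volume.restrict (Ioc 0 (2 * Real.pi))).prod (bessMeas n)) := by
    have hg : Integrable (fun z => (1 + ‖x‖) ^ s * (1 + ‖z‖ / 1) ^ s) (bessMeas n) :=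
      (integrable_growth n le_rfl hs.le).const_mul _
    refine Integrable.mono' (hg.comp_snd (volume.restrict (Ioc 0 (2 * Real.pi)))) ?_
      (ae_of_all _ fun q => ?_)
    · apply Measurable.aestronglyMeasurable
      have := (continuous_planeRot (e₁ := e₁) (e₂ := e₂)).measurable
      simp only [Function.uncurry_def]
      fun_prop
    · simp only [Function.uncurry_def]
      rw [Real.norm_of_nonneg (by positivity)]
      refine le_trans ?_ (le_trans (growth_sub_le one_pos hs.le x (planeRot e₁ e₂ q.1 q.2)) ?_)
      · gcongr; linarith
      · rw [norm_planeRot h₁ h₂ h₁₂]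
  have hswap := integral_integral_swap hint
  simp only [hrot] at hswap
  rw [setIntegral_const, smul_eq_mul] at hswap
  have hvol : volume.real (Ioc 0 (2 * Real.pi)) = 2 * Real.pi := by
    rw [Real.volume_real_Ioc_of_le (by positivity)]; ring
  rw [hvol] at hswap
  have hlow : 2 * Real.pi * ‖x‖ ^ s ≤
      ∫ z, (∫ θ in Ioc 0 (2 * Real.pi), ‖x - planeRot e₁ e₂ θ z‖ ^ s) ∂bessMeas n := by
    have hc : ∫ _z, 2 * Real.pi * ‖x‖ ^ s ∂bessMeas n = 2 * Real.pi * ‖x‖ ^ s := by simp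
    rw [← hc]
    refine integral_mono (integrable_const _) hint.integral_prod_right fun z => ?_
    refine (two_pi_mul_rpow_le_integral_circle hX hs ⟨inner ℝ e₁ z, inner ℝ e₂ z⟩).trans ?_
    rw [← intervalIntegral.integral_of_le (by positivity)]
    refine intervalIntegral.integral_mono (by positivity) ?_ ?_ fun θ => ?_
    · apply Continuous.intervalIntegrable
      exact (by fun_prop : Continuous fun θ =>
        ‖(‖x‖ : ℂ) - circleMap 0 1 θ * ⟨inner ℝ e₁ z, inner ℝ e₂ z⟩‖).rpow_const
          fun _ => Or.inr hs.le
    · apply Continuous.intervalIntegrable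
      have := (continuous_planeRot (e₁ := e₁) (e₂ := e₂)).comp
        (by fun_prop : Continuous fun θ : ℝ => (θ, z))
      simp only [Function.comp_def] at this
      exact (continuous_const.sub this).norm.rpow_const fun _ => Or.inr hs.le
    · have := norm_circle_sub_le h₁ h₂ h₁₂ ‖x‖ θ z
      rw [← hxe] at this
      simp only
      gcongr
  rw [← hswap] at hlow
  exact le_of_mul_le_mul_left hlow (by positivity)

lemma norm_rpow_le_symm_average {n : ℕ} {s : ℝ} (hs : 1 ≤ s) (x z : Sp n) :
    ‖x‖ ^ s ≤ 1 / 2 * ‖x - z‖ ^ s + 1 / 2 * ‖x + z‖ ^ s := by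
  have hc := (convexOn_rpow hs).2 (mem_Ici.mpr (norm_nonneg (x - z)))
    (mem_Ici.mpr (norm_nonneg (x + z))) (show (0 : ℝ) ≤ 1 / 2 by norm_num)
    (show (0 : ℝ) ≤ 1 / 2 by norm_num) (by norm_num)
  simp only [smul_eq_mul] at hc
  refine le_trans ?_ hc
  have h := norm_add_le (x - z) (x + z)
  rw [show x - z + (x + z) = (2 : ℝ) • x by module, norm_smul, Real.norm_of_nonneg zero_le_two]
    at h
  exact Real.rpow_le_rpow (norm_nonneg _) (by linarith) (by linarith)

/-- Here |·|^s is convex and the measure is even. This case also covers dimension one, where J_n⁺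
contains no exponent strictly between 0 and 1. -/
lemma norm_rpow_le_integral_of_one_le {n : ℕ} [NeZero n] {s : ℝ} (hs : 1 ≤ s)
    (x : Sp n) : ‖x‖ ^ s ≤ ∫ z, ‖x - z‖ ^ s ∂bessMeas n := by
  have hi := integrable_norm_sub_rpow n (by linarith : 0 ≤ s) x
  have heq : ∫ z, ‖x + z‖ ^ s ∂bessMeas n = ∫ z, ‖x - z‖ ^ s ∂bessMeas n := by
    have := (bessMeas_neg n).integral_comp (Homeomorph.neg (Sp n)).measurableEmbedding
      fun z => ‖x - z‖ ^ s
    simpa only [sub_neg_eq_add] using this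
  have hi' : Integrable (fun z => ‖x + z‖ ^ s) (bessMeas n) := by
    have := (bessMeas_neg n).integrable_comp_of_integrable hi
    simpa only [Function.comp_def, sub_neg_eq_add] using this
  have h := integral_mono (integrable_const (‖x‖ ^ s))
    ((hi.const_mul (1 / 2)).add (hi'.const_mul (1 / 2))) fun z => norm_rpow_le_symm_average hs x z
  rw [integral_add' (hi.const_mul _) (hi'.const_mul _), integral_const_mul, integral_const_mul,
    heq, integral_const, probReal_univ, one_smul] at h
  linarith

/-- `𝓑 |x|^s ≥ |x|^s` for `s ∈ J_n⁺`. -/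
lemma norm_rpow_le_besselOp {n : ℕ} [NeZero n] {s : ℝ} (hs : s ∈ Jplus n) (x : Sp n) :
    ‖x‖ ^ s ≤ besselOp n (fun y => ‖y‖ ^ s) x := by
  rw [besselOp_eq_integral]
  rcases hs.1.eq_or_lt with h0 | h0
  · simp [← h0]
  rcases le_or_gt 1 s with h1 | h1
  · exact norm_rpow_le_integral_of_one_le h1 x
  · refine norm_rpow_le_integral_of_two_le ?_ h0 x
    have h2 : 0 ≤ s + (n : ℝ) - 2 := nonneg_of_mul_nonneg_right hs.2 h0
    have h3 : (1 : ℝ) < n := by linarith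
    exact_mod_cast h3

lemma Jplus_add {n : ℕ} {σ p d : ℝ} (hσ : σ ∈ Jplus n)
    (hd₀ : 0 ≤ d) (hd : d ≤ p * σ / (1 - p)) : σ + d ∈ Jplus n := by
  obtain ⟨h1, h2⟩ := hσ
  refine ⟨by linarith, ?_⟩
  rcases h1.eq_or_lt with h0 | h0
  · have : d = 0 := by
      rw [← h0] at hd; simp at hd; linarith
    rw [← h0, this]; simp
  · have h3 : 0 ≤ σ + (n : ℝ) - 2 := nonneg_of_mul_nonneg_right h2 h0
    exact mul_nonneg (by linarith) (by linarith)

/-! ### The spaces `BC_a` and `C([0,∞); BC_a)` -/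

lemma MemBC.exists_bound {n : ℕ} {a : ℝ} (ha : 0 ≤ a) {φ : Sp n → ℝ} (h : MemBC a φ) :
    ∃ C, 0 ≤ C ∧ ∀ y, |φ y| ≤ C * (1 + ‖y‖) ^ a := by
  obtain ⟨hc, hO⟩ := h
  obtain ⟨c, hc0, hcb⟩ := hO.exists_nonneg
  rw [isBigOWith_iff] at hcb
  obtain ⟨K, hK, hKs⟩ := mem_cocompact.mp hcb
  obtain ⟨M, hM⟩ := hK.exists_bound_of_continuousOn hc.continuousOn
  refine ⟨max c (max M 0), le_max_of_le_left hc0, fun y => ?_⟩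
  by_cases hy : y ∈ K
  · have h1 : 1 ≤ (1 + ‖y‖) ^ a := Real.one_le_rpow (by linarith [norm_nonneg y]) ha
    calc |φ y| ≤ M := hM y hy
      _ ≤ max c (max M 0) := (le_max_left _ _).trans (le_max_right _ _)
      _ ≤ _ := le_mul_of_one_le_right (le_max_of_le_left hc0) h1
  · have h1 : ‖φ y‖ ≤ c * ‖‖y‖ ^ a‖ := hKs hy
    rw [Real.norm_eq_abs, Real.norm_of_nonneg (by positivity)] at h1
    refine h1.trans ?_
    gcongr
    · exact le_max_left _ _
    · linarith

lemma memBC_of_bound {n : ℕ} {a C : ℝ} (ha : 0 ≤ a) {φ : Sp n → ℝ} (hc : Continuous φ)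
    (hb : ∀ y, |φ y| ≤ C * (1 + ‖y‖) ^ a) : MemBC a φ := by
  have hC : 0 ≤ C := by simpa using (abs_nonneg _).trans (hb 0)
  refine ⟨hc, IsBigO.of_bound (C * 2 ^ a) ?_⟩
  have h1 : ∀ᶠ y : Sp n in cocompact (Sp n), 1 ≤ ‖y‖ :=
    (tendsto_norm_cocompact_atTop (E := Sp n)).eventually (eventually_ge_atTop 1)
  filter_upwards [h1] with y hy
  rw [Real.norm_eq_abs, Real.norm_of_nonneg (by positivity)]
  calc |φ y| ≤ C * (1 + ‖y‖) ^ a := hb y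
    _ ≤ C * (2 * ‖y‖) ^ a := by gcongr; linarith
    _ = _ := by rw [Real.mul_rpow (by norm_num) (by positivity)]; ring

lemma weight_mul_le {n : ℕ} {a C : ℝ} (ha : 0 ≤ a) {φ : Sp n → ℝ}
    (hb : ∀ y, |φ y| ≤ C * (1 + ‖y‖) ^ a) (x : Sp n) :
    ((1 : ℝ) ^ 2 + ‖x‖ ^ 2) ^ (-(a / 2)) * |φ x| ≤ C * 2 ^ (a / 2) := by
  have hC : 0 ≤ C := by simpa using (abs_nonneg _).trans (hb 0)
  have hpos : (0 : ℝ) < 1 ^ 2 + ‖x‖ ^ 2 := by positivity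
  have h1 : (1 + ‖x‖) ^ a ≤ 2 ^ (a / 2) * ((1 : ℝ) ^ 2 + ‖x‖ ^ 2) ^ (a / 2) := by
    rw [← Real.mul_rpow (by norm_num) hpos.le]
    have h2 : (1 + ‖x‖) ^ a = ((1 + ‖x‖) ^ 2) ^ (a / 2) := by
      rw [← Real.rpow_natCast, ← Real.rpow_mul (by positivity)]
      congr 1; push_cast; ring
    rw [h2]
    apply Real.rpow_le_rpow (by positivity) _ (by positivity)
    nlinarith [sq_nonneg (1 - ‖x‖)]
  have hne : ((1 : ℝ) ^ 2 + ‖x‖ ^ 2) ^ (a / 2) ≠ 0 := by positivity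
  calc _ ≤ ((1 : ℝ) ^ 2 + ‖x‖ ^ 2) ^ (-(a / 2)) *
        (C * (2 ^ (a / 2) * ((1 : ℝ) ^ 2 + ‖x‖ ^ 2) ^ (a / 2))) := by
        gcongr
        exact (hb x).trans (by gcongr)
    _ = _ := by rw [Real.rpow_neg hpos.le]; field_simp

lemma wNorm_le {n : ℕ} {a C : ℝ} (ha : 0 ≤ a) {φ : Sp n → ℝ}
    (hb : ∀ y, |φ y| ≤ C * (1 + ‖y‖) ^ a) : wNorm 1 a φ ≤ C * 2 ^ (a / 2) :=
  ciSup_le (weight_mul_le ha hb)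

lemma wNorm_nonneg {n : ℕ} (a : ℝ) (φ : Sp n → ℝ) : 0 ≤ wNorm 1 a φ :=
  Real.iSup_nonneg fun x => by positivity

/-- The growth bound is needed only to make the supremum finite: an unbounded real supremum is zero
by convention. -/
lemma abs_le_wNorm_mul {n : ℕ} {a C : ℝ} (ha : 0 ≤ a) {φ : Sp n → ℝ}
    (hb : ∀ y, |φ y| ≤ C * (1 + ‖y‖) ^ a) (x : Sp n) :
    |φ x| ≤ wNorm 1 a φ * (1 + ‖x‖) ^ a := by
  have hpos : (0 : ℝ) < 1 ^ 2 + ‖x‖ ^ 2 := by positivity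
  have h1 : ((1 : ℝ) ^ 2 + ‖x‖ ^ 2) ^ (-(a / 2)) * |φ x| ≤ wNorm 1 a φ :=
    le_ciSup (f := fun x => ((1 : ℝ) ^ 2 + ‖x‖ ^ 2) ^ (-(a / 2)) * |φ x|)
      ⟨_, by rintro _ ⟨y, rfl⟩; exact weight_mul_le ha hb y⟩ x
  have h2 : ((1 : ℝ) ^ 2 + ‖x‖ ^ 2) ^ (a / 2) ≤ (1 + ‖x‖) ^ a := by
    have h3 : (1 + ‖x‖) ^ a = ((1 + ‖x‖) ^ 2) ^ (a / 2) := by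
      rw [← Real.rpow_natCast, ← Real.rpow_mul (by positivity)]
      congr 1; push_cast; ring
    rw [h3]
    apply Real.rpow_le_rpow (by positivity) _ (by positivity)
    nlinarith [norm_nonneg x]
  have hne : ((1 : ℝ) ^ 2 + ‖x‖ ^ 2) ^ (a / 2) ≠ 0 := by positivity
  calc |φ x| = ((1 : ℝ) ^ 2 + ‖x‖ ^ 2) ^ (-(a / 2)) * |φ x| *
        ((1 : ℝ) ^ 2 + ‖x‖ ^ 2) ^ (a / 2) := by rw [Real.rpow_neg hpos.le]; field_simp
    _ ≤ _ := by gcongr; exact wNorm_nonneg a φ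

lemma MemZ.exists_bound_sub {n : ℕ} {a : ℝ} (ha : 0 ≤ a) {u : ℝ → Sp n → ℝ} (hu : MemZ a u)
    {t t₀ : ℝ} (ht : 0 ≤ t) (ht₀ : 0 ≤ t₀) (x : Sp n) :
    |u t x - u t₀ x| ≤ wNorm 1 a (fun x => u t x - u t₀ x) * (1 + ‖x‖) ^ a := by
  obtain ⟨C₁, -, h₁⟩ := (hu.1 t ht).exists_bound ha
  obtain ⟨C₂, -, h₂⟩ := (hu.1 t₀ ht₀).exists_bound ha
  refine abs_le_wNorm_mul (φ := fun x => u t x - u t₀ x) (C := C₁ + C₂) ha (fun y => ?_) x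
  calc _ ≤ |u t y| + |u t₀ y| := abs_sub _ _
    _ ≤ _ := by rw [add_mul]; exact add_le_add (h₁ y) (h₂ y)

lemma MemZ.continuousOn {n : ℕ} {a : ℝ} (ha : 0 ≤ a) {u : ℝ → Sp n → ℝ} (hu : MemZ a u)
    (x : Sp n) : ContinuousOn (fun t => u t x) (Ici 0) := by
  intro t₀ ht₀
  rw [ContinuousWithinAt, tendsto_iff_norm_sub_tendsto_zero]
  have h := (hu.2 t₀ ht₀).mul_const ((1 + ‖x‖) ^ a)
  rw [zero_mul] at h
  refine squeeze_zero' (Eventually.of_forall fun _ => norm_nonneg _) ?_ h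
  filter_upwards [self_mem_nhdsWithin] with t ht
  exact hu.exists_bound_sub ha ht ht₀ x

/-- Norm continuity gives a bound near each time, and compactness of [0,T] makes it uniform. -/
lemma MemZ.exists_bound {n : ℕ} {a : ℝ} (ha : 0 ≤ a) {u : ℝ → Sp n → ℝ} (hu : MemZ a u) (T : ℝ) :
    ∃ M, 0 ≤ M ∧ ∀ t ∈ Icc 0 T, ∀ x, |u t x| ≤ M * (1 + ‖x‖) ^ a := by
  refine (isCompact_Icc (a := (0 : ℝ)) (b := T)).induction_on
    (p := fun s => ∃ M, 0 ≤ M ∧ ∀ t ∈ s, ∀ x, |u t x| ≤ M * (1 + ‖x‖) ^ a)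
    ⟨0, le_rfl, by simp⟩ ?_ ?_ ?_
  · rintro s s' hs ⟨M, hM, h⟩
    exact ⟨M, hM, fun t ht => h t (hs ht)⟩
  · rintro s s' ⟨M, hM, h⟩ ⟨M', hM', h'⟩
    refine ⟨max M M', le_max_of_le_left hM, ?_⟩
    rintro t (ht | ht) x
    · exact (h t ht x).trans (by gcongr; exact le_max_left _ _)
    · exact (h' t ht x).trans (by gcongr; exact le_max_right _ _)
  · intro t₀ ht₀
    obtain ⟨C, hC, hb⟩ := (hu.1 t₀ ht₀.1).exists_bound ha
    have h1 : ∀ᶠ t in 𝓝[Icc 0 T] t₀, wNorm 1 a (fun x => u t x - u t₀ x) < 1 :=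
      ((hu.2 t₀ ht₀.1).mono_left (nhdsWithin_mono _ Icc_subset_Ici_self)).eventually
        (gt_mem_nhds one_pos)
    refine ⟨{t | t ∈ Icc 0 T ∧ wNorm 1 a (fun x => u t x - u t₀ x) < 1}, ?_, C + 1, by positivity,
      ?_⟩
    · filter_upwards [self_mem_nhdsWithin, h1] with t ht ht1 using ⟨ht, ht1⟩
    · rintro t ⟨ht, ht1⟩ x
      have h2 := hu.exists_bound_sub ha ht.1 ht₀.1 x
      have h3 : |u t x| ≤ |u t₀ x| + |u t x - u t₀ x| := by
        have := abs_add_le (u t₀ x) (u t x - u t₀ x)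
        simpa using this
      have h4 : wNorm 1 a (fun x => u t x - u t₀ x) * (1 + ‖x‖) ^ a ≤ 1 * (1 + ‖x‖) ^ a := by
        gcongr
      linarith [hb x]

lemma memZ_of_bound {n : ℕ} {a : ℝ} (ha : 0 ≤ a) {m : ℝ → Sp n → ℝ}
    (hm : ∀ t, 0 ≤ t → MemBC a (m t)) (g : ℝ → ℝ → ℝ)
    (hg : ∀ t₀, 0 ≤ t₀ → Tendsto (g t₀) (𝓝[Ici 0] t₀) (𝓝 0))
    (hb : ∀ t₀ t, 0 ≤ t₀ → 0 ≤ t → ∀ x, |m t x - m t₀ x| ≤ g t₀ t * (1 + ‖x‖) ^ a) :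
    MemZ a m := by
  refine ⟨hm, fun t₀ ht₀ => ?_⟩
  have h := (hg t₀ ht₀).mul_const (2 ^ (a / 2))
  rw [zero_mul] at h
  refine squeeze_zero' (Eventually.of_forall fun _ => wNorm_nonneg _ _) ?_ h
  filter_upwards [self_mem_nhdsWithin] with t ht
  exact wNorm_le ha (hb t₀ t ht₀ ht)

lemma MemZ.mul_left {n : ℕ} {a : ℝ} (ha : 0 ≤ a) {m : ℝ → Sp n → ℝ} (hm : MemZ a m) {c : ℝ → ℝ}
    (hc : Continuous c) : MemZ a (fun t x => c t * m t x) := by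
  have hC : ∀ t, ∃ C, 0 ≤ C ∧ (0 ≤ t → ∀ y, |m t y| ≤ C * (1 + ‖y‖) ^ a) := by
    intro t
    by_cases ht : 0 ≤ t
    · obtain ⟨C, hC, h⟩ := (hm.1 t ht).exists_bound ha
      exact ⟨C, hC, fun _ => h⟩
    · exact ⟨0, le_rfl, fun h => absurd h ht⟩
  choose C hC0 hC using hC
  refine memZ_of_bound ha (fun t ht => memBC_of_bound (C := |c t| * C t) ha
    (continuous_const.mul (hm.1 t ht).1) fun y => ?_)
    (fun t₀ t => |c t| * wNorm 1 a (fun x => m t x - m t₀ x) + |c t - c t₀| * C t₀) ?_ ?_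
  · rw [abs_mul, mul_assoc]
    gcongr
    exact hC t ht y
  · intro t₀ ht₀
    have h1 : Tendsto (fun t => |c t|) (𝓝[Ici 0] t₀) (𝓝 |c t₀|) :=
      (hc.abs.tendsto t₀).mono_left nhdsWithin_le_nhds
    have h2 : Tendsto (fun t => |c t - c t₀|) (𝓝[Ici 0] t₀) (𝓝 0) := by
      have := ((hc.sub (continuous_const (y := c t₀))).abs.tendsto t₀).mono_left
        (nhdsWithin_le_nhds (s := Ici 0))
      simpa using this
    have := (h1.mul (hm.2 t₀ ht₀)).add (h2.mul_const (C t₀))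
    simpa using this
  · intro t₀ t ht₀ ht x
    have h1 := hm.exists_bound_sub ha ht ht₀ x
    have e : c t * m t x - c t₀ * m t₀ x = c t * (m t x - m t₀ x) + (c t - c t₀) * m t₀ x := by ring
    rw [e, add_mul]
    refine (abs_add_le _ _).trans (add_le_add ?_ ?_)
    · rw [abs_mul, mul_assoc]; gcongr
    · rw [abs_mul, mul_assoc]; gcongr; exact hC t₀ ht₀ x

/-! ### The rate `e^{(1-p)t} Λ(t)` and its primitive -/

/-- The rate `e^{(1-p)t} Λ(t)`, with `Λ` extended by the constant `Λ(0)` to negative times. -/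
def rate (p : ℝ) (Λ : ℝ → ℝ) (t : ℝ) : ℝ := Real.exp ((1 - p) * t) * Λ (max t 0)

/-- The primitive of `rate` vanishing at time zero. -/
def cumRate (p : ℝ) (Λ : ℝ → ℝ) (t : ℝ) : ℝ := ∫ τ in (0 : ℝ)..t, rate p Λ τ

section Rate

variable {p : ℝ} {Λ : ℝ → ℝ}

lemma rate_of_nonneg (p : ℝ) (Λ : ℝ → ℝ) {t : ℝ} (ht : 0 ≤ t) :
    rate p Λ t = Real.exp ((1 - p) * t) * Λ t := by
  rw [rate, max_eq_left ht]

lemma continuous_rate (hΛ : ContinuousOn Λ (Ici 0)) : Continuous (rate p Λ) := by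
  have h : Continuous fun t : ℝ => Λ (max t 0) :=
    hΛ.comp_continuous (by fun_prop) fun t => mem_Ici.mpr (le_max_right _ _)
  exact (by fun_prop : Continuous fun t : ℝ => Real.exp ((1 - p) * t)).mul h

lemma rate_pos (hΛ : ∀ t, 0 ≤ t → 0 < Λ t) (t : ℝ) : 0 < rate p Λ t :=
  mul_pos (Real.exp_pos _) (hΛ _ (le_max_right _ _))

lemma hasDerivAt_cumRate (hΛ : ContinuousOn Λ (Ici 0)) (t : ℝ) :
    HasDerivAt (cumRate p Λ) (rate p Λ t) t :=
  (continuous_rate hΛ).integral_hasStrictDerivAt 0 t |>.hasDerivAt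

lemma continuous_cumRate (hΛ : ContinuousOn Λ (Ici 0)) : Continuous (cumRate p Λ) :=
  continuous_iff_continuousAt.mpr fun t => (hasDerivAt_cumRate hΛ t).continuousAt

@[simp] lemma cumRate_zero : cumRate p Λ 0 = 0 := by simp [cumRate]

lemma strictMono_cumRate (hΛ : ContinuousOn Λ (Ici 0)) (hpos : ∀ t, 0 ≤ t → 0 < Λ t) :
    StrictMono (cumRate p Λ) :=
  strictMono_of_deriv_pos fun t => by
    rw [(hasDerivAt_cumRate hΛ t).deriv]; exact rate_pos hpos t

lemma cumRate_pos (hΛ : ContinuousOn Λ (Ici 0)) (hpos : ∀ t, 0 ≤ t → 0 < Λ t) {t : ℝ}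
    (ht : 0 < t) : 0 < cumRate p Λ t := by
  simpa using strictMono_cumRate (p := p) hΛ hpos ht

lemma cumRate_nonneg (hΛ : ContinuousOn Λ (Ici 0)) (hpos : ∀ t, 0 ≤ t → 0 < Λ t) {t : ℝ}
    (ht : 0 ≤ t) : 0 ≤ cumRate p Λ t := by
  simpa using (strictMono_cumRate (p := p) hΛ hpos).monotone ht

lemma continuous_cumRate_rpow (hΛ : ContinuousOn Λ (Ici 0)) {γ : ℝ} (hγ : 0 ≤ γ) :
    Continuous fun t => cumRate p Λ t ^ γ :=
  (continuous_cumRate hΛ).rpow_const fun _ => Or.inr hγ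

/-- This drives every iteration in time: inserting E^γ into the source produces E^{pγ+1}, and γ =
1/(1-p) is the fixed point of γ ↦ pγ + 1. -/
lemma integral_rate_mul_rpow (hΛ : ContinuousOn Λ (Ici 0)) {γ : ℝ} (hγ : 0 ≤ γ) (t : ℝ) :
    ∫ τ in (0 : ℝ)..t, rate p Λ τ * cumRate p Λ τ ^ γ = cumRate p Λ t ^ (γ + 1) / (γ + 1) := by
  have hγ1 : γ + 1 ≠ 0 := by positivity
  have h : ∀ τ ∈ uIcc 0 t, HasDerivAt (fun τ => cumRate p Λ τ ^ (γ + 1) / (γ + 1))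
      (rate p Λ τ * cumRate p Λ τ ^ γ) τ := by
    intro τ _
    have h1 := ((hasDerivAt_cumRate (p := p) hΛ τ).rpow_const (p := γ + 1)
      (Or.inr (by linarith))).div_const (γ + 1)
    refine h1.congr_deriv ?_
    rw [add_sub_cancel_right]
    field_simp
  rw [intervalIntegral.integral_eq_sub_of_hasDerivAt h
    (((continuous_rate hΛ).mul (continuous_cumRate_rpow hΛ hγ)).intervalIntegrable _ _)]
  simp [Real.zero_rpow hγ1]

lemma exists_rate_bounds (hΛ : ContinuousOn Λ (Ici 0)) (hpos : ∀ t, 0 ≤ t → 0 < Λ t) {T : ℝ}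
    (hT : 0 < T) : ∃ δ D : ℝ, 0 < δ ∧ 0 < D ∧
      ∀ t ∈ Icc 0 T, δ ≤ rate p Λ t ∧ rate p Λ t ≤ D ∧ cumRate p Λ t ≤ D * t := by
  have hc := (continuous_rate (p := p) hΛ).continuousOn (s := Icc 0 T)
  have hne : (Icc 0 T).Nonempty := nonempty_Icc.mpr hT.le
  obtain ⟨t₁, -, h₁⟩ := isCompact_Icc.exists_isMinOn hne hc
  obtain ⟨t₂, -, h₂⟩ := isCompact_Icc.exists_isMaxOn hne hc
  refine ⟨rate p Λ t₁, rate p Λ t₂, rate_pos hpos _, rate_pos hpos _, fun t ht =>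
    ⟨h₁ ht, h₂ ht, ?_⟩⟩
  have h3 : cumRate p Λ t ≤ ∫ _τ in (0 : ℝ)..t, rate p Λ t₂ :=
    intervalIntegral.integral_mono_on ht.1 ((continuous_rate hΛ).intervalIntegrable _ _)
      (by simp) fun τ hτ => h₂ ⟨hτ.1, hτ.2.trans ht.2⟩
  rw [intervalIntegral.integral_const, smul_eq_mul, sub_zero] at h3
  linarith

end Rate

/-! ### Time integrability -/

lemma continuousOn_besselOp_time {n : ℕ} [NeZero n] {a C : ℝ} (ha : 0 ≤ a) {s : Set ℝ}
    {F : ℝ → Sp n → ℝ} (hF : ∀ τ ∈ s, Measurable (F τ)) (hFt : ∀ y, ContinuousOn (fun τ => F τ y) s)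
    (hb : ∀ τ ∈ s, ∀ y, |F τ y| ≤ C * (1 + ‖y‖) ^ a) (x : Sp n) :
    ContinuousOn (fun τ => besselOp n (F τ) x) s := by
  rcases s.eq_empty_or_nonempty with rfl | ⟨τ₀, hτ₀⟩
  · exact continuousOn_empty _
  have hC : 0 ≤ C := by simpa using (abs_nonneg _).trans (hb τ₀ hτ₀ 0)
  simp only [besselOp_eq_integral]
  refine continuousOn_of_dominated (bound := fun z => C * ((1 + ‖x‖) ^ a * (1 + ‖z‖ / 1) ^ a))
    (fun τ hτ => ((hF τ hτ).comp (measurable_const.sub measurable_id)).aestronglyMeasurable)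
    (fun τ hτ => ae_of_all _ fun z => ?_)
    (((integrable_growth n le_rfl ha).const_mul _).const_mul _) (ae_of_all _ fun z => hFt _)
  rw [Real.norm_eq_abs]
  exact (hb τ hτ _).trans (by gcongr; exact growth_sub_le one_pos ha x z)

lemma intervalIntegrable_besselOp {n : ℕ} [NeZero n] {a C t : ℝ} (ha : 0 ≤ a) (ht : 0 ≤ t)
    {F : ℝ → Sp n → ℝ} (hF : ∀ τ ∈ Ioc 0 t, Measurable (F τ))
    (hFt : ∀ y, ContinuousOn (fun τ => F τ y) (Ioc 0 t))
    (hb : ∀ τ ∈ Ioc 0 t, ∀ y, |F τ y| ≤ C * (1 + ‖y‖) ^ a) (x : Sp n) :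
    IntervalIntegrable (fun τ => besselOp n (F τ) x) volume 0 t := by
  rw [intervalIntegrable_iff_integrableOn_Ioc_of_le ht]
  refine Integrable.mono' (integrable_const (growthConst n a 1 * C * (1 + ‖x‖) ^ a))
    ((continuousOn_besselOp_time ha hF hFt hb x).aestronglyMeasurable measurableSet_Ioc) ?_
  filter_upwards [ae_restrict_mem measurableSet_Ioc] with τ hτ
  exact abs_besselOp_le le_rfl ha (hF τ hτ) (hb τ hτ) x

/-! ### Mild solutions and their lower bounds -/

/-- The standing assumptions on the exponents `p`, `σ`, `a`. -/
structure Exponents (p σ a : ℝ) : Prop where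
  p_pos : 0 < p
  p_lt_one : p < 1
  σ_nonneg : 0 ≤ σ
  growth : σ ≤ a * (1 - p)

namespace Exponents

variable {p σ a : ℝ}

lemma a_nonneg (E : Exponents p σ a) : 0 ≤ a := by
  have h1 := E.p_lt_one
  exact nonneg_of_mul_nonneg_left (E.σ_nonneg.trans E.growth) (by linarith)

lemma one_sub_pos (E : Exponents p σ a) : 0 < 1 - p := by linarith [E.p_lt_one]

lemma one_le_inv (E : Exponents p σ a) : 1 ≤ (1 - p)⁻¹ :=
  (one_le_inv₀ E.one_sub_pos).mpr (by linarith [E.p_pos])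

lemma inv_mul_add_one (E : Exponents p σ a) : (1 - p)⁻¹ * p + 1 = (1 - p)⁻¹ := by
  have := E.one_sub_pos
  field_simp
  ring

/-- The condition a ≥ σ/(1-p) enters here: it keeps V m^p in the growth class of m. -/
lemma rpow_mul_weight_le (E : Exponents p σ a) {R r : ℝ} (hR : 1 ≤ R) (hr : 0 ≤ r) :
    r ^ σ * ((R + r) ^ a) ^ p ≤ (R + r) ^ a := by
  have h1 : r ^ σ ≤ (R + r) ^ (a * (1 - p)) :=
    (Real.rpow_le_rpow hr (by linarith) E.σ_nonneg).trans
      (Real.rpow_le_rpow_of_exponent_le (by linarith) E.growth)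
  calc _ ≤ (R + r) ^ (a * (1 - p)) * ((R + r) ^ a) ^ p := by gcongr
    _ = _ := by
      rw [← Real.rpow_mul (by linarith), ← Real.rpow_add (by linarith)]
      congr 1; ring

end Exponents

/-! ### Bounds on the potential and the source at a fixed time -/

section Slices

variable {n : ℕ} {σ ϑ₁ ϑ₂ : ℝ} {Λ : ℝ → ℝ} {V : ℝ → Sp n → ℝ}

lemma PotentialBounds.continuous_space (hV : PotentialBounds σ Λ ϑ₁ ϑ₂ V) {τ : ℝ} (hτ : 0 < τ) :
    Continuous (V τ) :=
  hV.cont.comp_continuous (f := fun y => (τ, y)) (by fun_prop) fun _ => ⟨hτ, mem_univ _⟩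

lemma PotentialBounds.continuousOn_time (hV : PotentialBounds σ Λ ϑ₁ ϑ₂ V) (y : Sp n) :
    ContinuousOn (fun τ => V τ y) (Ioi 0) :=
  hV.cont.comp (f := fun τ => (τ, y)) (by fun_prop) fun _ hτ => ⟨hτ, mem_univ _⟩

lemma PotentialBounds.exp_mul_le (hV : PotentialBounds σ Λ ϑ₁ ϑ₂ V) (p : ℝ) {τ : ℝ} (hτ : 0 < τ)
    (y : Sp n) : Real.exp ((1 - p) * τ) * V τ y ≤ ϑ₂ * rate p Λ τ * ‖y‖ ^ σ := by
  rw [rate_of_nonneg p Λ hτ.le]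
  calc _ ≤ Real.exp ((1 - p) * τ) * (ϑ₂ * Λ τ * ‖y‖ ^ σ) := by gcongr; exact hV.upper τ hτ y
    _ = _ := by ring

lemma PotentialBounds.source_le {p a : ℝ} (hV : PotentialBounds σ Λ ϑ₁ ϑ₂ V)
    (E : Exponents p σ a) {R N τ v : ℝ} (hR : 1 ≤ R) (hN : 0 ≤ N) (hτ : 0 < τ) (y : Sp n)
    (hv : 0 ≤ v) (hvN : v ≤ N * (R + ‖y‖) ^ a) :
    Real.exp ((1 - p) * τ) * V τ y * v ^ p ≤ ϑ₂ * rate p Λ τ * N ^ p * (R + ‖y‖) ^ a := by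
  have hr := (rate_pos (p := p) hV.pos_rate τ).le
  have h2 := hV.pos₂.le
  calc _ ≤ ϑ₂ * rate p Λ τ * ‖y‖ ^ σ * (N * (R + ‖y‖) ^ a) ^ p := by
        exact mul_le_mul (hV.exp_mul_le p hτ y) (Real.rpow_le_rpow hv hvN E.p_pos.le)
          (by positivity) (by positivity)
    _ = ϑ₂ * rate p Λ τ * N ^ p * (‖y‖ ^ σ * ((R + ‖y‖) ^ a) ^ p) := by
        rw [Real.mul_rpow hN (by positivity)]; ring
    _ ≤ _ := by
        gcongr
        exact E.rpow_mul_weight_le hR (norm_nonneg y)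

end Slices

section Integrability

variable {n : ℕ} {p σ a ϑ₁ ϑ₂ : ℝ} {Λ : ℝ → ℝ} {V m : ℝ → Sp n → ℝ}

lemma measurable_source (hV : PotentialBounds σ Λ ϑ₁ ϑ₂ V) (hm : MemZ a m) {τ : ℝ} (hτ : 0 < τ) :
    Measurable fun y => V τ y * m τ y ^ p := by
  have h1 := (hV.continuous_space hτ).measurable
  have h2 := (hm.1 τ hτ.le).1.measurable
  fun_prop

lemma abs_source_le (hV : PotentialBounds σ Λ ϑ₁ ϑ₂ V) (E : Exponents p σ a)
    (h0 : ∀ t, 0 ≤ t → ∀ x, 0 ≤ m t x) {R N τ : ℝ} (hR : 1 ≤ R) (hN : 0 ≤ N) (hτ : 0 < τ)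
    (hb : ∀ y, m τ y ≤ N * (R + ‖y‖) ^ a) (y : Sp n) :
    |Real.exp ((1 - p) * τ) * (V τ y * m τ y ^ p)| ≤
      ϑ₂ * rate p Λ τ * N ^ p * (R + ‖y‖) ^ a := by
  have h1 := hV.nonneg τ hτ y
  have h2 := h0 τ hτ.le y
  rw [abs_of_nonneg (by positivity), ← mul_assoc]
  exact hV.source_le E hR hN hτ y h2 (hb y)

variable [NeZero n]

lemma intervalIntegrable_linear (ha : 0 ≤ a) (hm : MemZ a m) {t : ℝ} (ht : 0 ≤ t) (x : Sp n) :
    IntervalIntegrable (fun τ => besselOp n (m τ) x) volume 0 t := by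
  obtain ⟨M, -, hM⟩ := hm.exists_bound ha t
  exact intervalIntegrable_besselOp ha ht (fun τ hτ => (hm.1 τ hτ.1.le).1.measurable)
    (fun y => (hm.continuousOn ha y).mono fun τ hτ => hτ.1.le)
    (fun τ hτ => hM τ ⟨hτ.1.le, hτ.2⟩) x

lemma intervalIntegrable_source (hV : PotentialBounds σ Λ ϑ₁ ϑ₂ V) (E : Exponents p σ a)
    (h0 : ∀ t, 0 ≤ t → ∀ x, 0 ≤ m t x) (hm : MemZ a m) {t : ℝ} (ht : 0 ≤ t) (x : Sp n) :
    IntervalIntegrable (fun τ => Real.exp ((1 - p) * τ) *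
      besselOp n (fun y => V τ y * m τ y ^ p) x) volume 0 t := by
  rcases ht.eq_or_lt with rfl | ht'
  · simp
  obtain ⟨M, hM0, hM⟩ := hm.exists_bound E.a_nonneg t
  obtain ⟨δ, D, hδ, hD, hrate⟩ := exists_rate_bounds (p := p) hV.cont_rate hV.pos_rate ht'
  have h2 := hV.pos₂.le
  simp_rw [← besselOp_const_mul]
  refine intervalIntegrable_besselOp (C := ϑ₂ * D * M ^ p) E.a_nonneg ht
    (fun τ hτ => (measurable_source hV hm hτ.1).const_mul _) (fun y => ?_) (fun τ hτ y => ?_) x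
  · have h3 : ContinuousOn (fun τ => m τ y ^ p) (Ioc 0 t) :=
      ((hm.continuousOn E.a_nonneg y).mono fun τ hτ => hτ.1.le).rpow_const
        fun _ _ => Or.inr E.p_pos.le
    have h4 : ContinuousOn (fun τ => V τ y) (Ioc 0 t) :=
      (hV.continuousOn_time y).mono fun τ hτ => hτ.1
    exact (by fun_prop : Continuous fun τ : ℝ => Real.exp ((1 - p) * τ)).continuousOn.mul
      (h4.mul h3)
  · refine (abs_source_le hV E h0 le_rfl hM0 hτ.1
      (fun y => (le_abs_self _).trans (hM τ ⟨hτ.1.le, hτ.2⟩ y)) y).trans ?_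
    gcongr
    exact (hrate τ ⟨hτ.1.le, hτ.2⟩).2.1

lemma integrable_source (hV : PotentialBounds σ Λ ϑ₁ ϑ₂ V) (E : Exponents p σ a)
    (h0 : ∀ t, 0 ≤ t → ∀ x, 0 ≤ m t x) (hm : MemZ a m) {τ : ℝ} (hτ : 0 < τ) (x : Sp n) :
    Integrable (fun z => V τ (x - z) * m τ (x - z) ^ p) (bessMeas n) := by
  obtain ⟨M, hM0, hM⟩ := (hm.1 τ hτ.le).exists_bound E.a_nonneg
  have h1 := integrable_comp_sub (φ := fun y => Real.exp ((1 - p) * τ) * (V τ y * m τ y ^ p))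
    le_rfl E.a_nonneg ((measurable_source hV hm hτ).const_mul _)
    (abs_source_le hV E h0 le_rfl hM0 hτ fun y => (le_abs_self _).trans (hM y)) x
  have h2 := h1.const_mul (Real.exp ((1 - p) * τ))⁻¹
  refine h2.congr (ae_of_all _ fun z => ?_)
  have : Real.exp ((1 - p) * τ) ≠ 0 := (Real.exp_pos _).ne'
  field_simp

end Integrability

/-- The integral equation for `m = eᵗ u`. -/
structure IsMild {n : ℕ} (p a : ℝ) (V : ℝ → Sp n → ℝ) (u₀ : Sp n → ℝ) (m : ℝ → Sp n → ℝ) :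
    Prop where
  nonneg : ∀ t, 0 ≤ t → ∀ x, 0 ≤ m t x
  memZ : MemZ a m
  eqn : ∀ t, 0 ≤ t → ∀ x, m t x = u₀ x + (∫ τ in (0 : ℝ)..t, besselOp n (m τ) x)
    + ∫ τ in (0 : ℝ)..t, Real.exp ((1 - p) * τ) * besselOp n (fun y => V τ y * m τ y ^ p) x

lemma IsGlobalSSolution.isMild {n : ℕ} {p a : ℝ} {V u : ℝ → Sp n → ℝ} {u₀ : Sp n → ℝ}
    (h : IsGlobalSSolution p a V u₀ u) : IsMild p a V u₀ fun t x => Real.exp t * u t x :=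
  ⟨fun t ht x => mul_nonneg (Real.exp_pos t).le (h.nonneg t ht x), h.memZ_exp, h.eqn⟩

lemma IsMild.isGlobalSSolution {n : ℕ} {p a : ℝ} (ha : 0 ≤ a) {V m : ℝ → Sp n → ℝ} {u₀ : Sp n → ℝ}
    (h : IsMild p a V u₀ m) : IsGlobalSSolution p a V u₀ fun t x => Real.exp (-t) * m t x := by
  have e : (fun t x => Real.exp t * (Real.exp (-t) * m t x)) = m := by
    funext t x
    rw [← mul_assoc, ← Real.exp_add]
    simp
  have e' : ∀ t x, Real.exp t * (Real.exp (-t) * m t x) = m t x := fun t x => congrFun₂ e t x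
  refine ⟨fun t ht x => mul_nonneg (Real.exp_pos _).le (h.nonneg t ht x),
    h.memZ.mul_left ha (by fun_prop), ?_, fun t ht x => ?_⟩
  · rw [e]; exact h.memZ
  · simp only [e']
    exact h.eqn t ht x

/-! ### Lower bounds for solutions with nontrivial data -/

section Lower

variable {n : ℕ} {p σ a ϑ₁ ϑ₂ : ℝ} {Λ : ℝ → ℝ} {V m : ℝ → Sp n → ℝ} {u₀ : Sp n → ℝ}

lemma IsMild.linear_nonneg (hm : IsMild p a V u₀ m) {t : ℝ} (ht : 0 ≤ t) (x : Sp n) :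
    0 ≤ ∫ τ in (0 : ℝ)..t, besselOp n (m τ) x :=
  intervalIntegral.integral_nonneg ht fun τ hτ => besselOp_nonneg (hm.nonneg τ hτ.1) x

lemma IsMild.source_nonneg (hV : PotentialBounds σ Λ ϑ₁ ϑ₂ V) (hm : IsMild p a V u₀ m) {t : ℝ}
    (ht : 0 ≤ t) (x : Sp n) : 0 ≤ ∫ τ in (0 : ℝ)..t, Real.exp ((1 - p) * τ) *
      besselOp n (fun y => V τ y * m τ y ^ p) x := by
  rw [intervalIntegral.integral_of_le ht]
  refine setIntegral_nonneg measurableSet_Ioc fun τ hτ => mul_nonneg (Real.exp_pos _).le ?_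
  exact besselOp_nonneg (fun y => mul_nonneg (hV.nonneg τ hτ.1 y)
    (Real.rpow_nonneg (hm.nonneg τ hτ.1.le y) _)) x

lemma IsMild.initial_le (hV : PotentialBounds σ Λ ϑ₁ ϑ₂ V) (hm : IsMild p a V u₀ m) {t : ℝ}
    (ht : 0 ≤ t) (x : Sp n) : u₀ x ≤ m t x := by
  rw [hm.eqn t ht x]
  linarith [hm.linear_nonneg ht x, hm.source_nonneg hV ht x]

variable [NeZero n]

lemma IsMild.integral_le (hV : PotentialBounds σ Λ ϑ₁ ϑ₂ V) (E : Exponents p σ a)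
    (hm : IsMild p a V u₀ m) (hu₀ : ∀ x, 0 ≤ u₀ x) {t : ℝ} (ht : 0 ≤ t) (x : Sp n) {g : ℝ → ℝ}
    (hg : IntervalIntegrable g volume 0 t)
    (h : ∀ τ ∈ Ioc 0 t, g τ ≤ Real.exp ((1 - p) * τ) *
      besselOp n (fun y => V τ y * m τ y ^ p) x) :
    ∫ τ in (0 : ℝ)..t, g τ ≤ m t x := by
  rw [hm.eqn t ht x]
  have h1 := intervalIntegral.integral_mono_on_of_le_Ioo ht hg
    (intervalIntegrable_source hV E hm.nonneg hm.memZ ht x) fun τ hτ => h τ ⟨hτ.1, hτ.2.le⟩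
  linarith [hm.linear_nonneg ht x, hu₀ x]

/-- Inserting m ≥ u₀ into the linear term gives a first bound that is positive everywhere, even
where u₀ vanishes. -/
lemma IsMild.mul_besselOp_le (hV : PotentialBounds σ Λ ϑ₁ ϑ₂ V) (E : Exponents p σ a)
    (hm : IsMild p a V u₀ m) (hu₀m : MemBC a u₀) (hu₀ : ∀ x, 0 ≤ u₀ x) {t : ℝ} (ht : 0 ≤ t)
    (x : Sp n) : t * besselOp n u₀ x ≤ m t x := by
  rw [hm.eqn t ht x]
  obtain ⟨C, -, hC⟩ := hu₀m.exists_bound E.a_nonneg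
  have h1 : ∫ _τ in (0 : ℝ)..t, besselOp n u₀ x ≤ ∫ τ in (0 : ℝ)..t, besselOp n (m τ) x := by
    refine intervalIntegral.integral_mono_on ht (by simp)
      (intervalIntegrable_linear E.a_nonneg hm.memZ ht x) fun τ hτ => ?_
    obtain ⟨M, -, hM⟩ := (hm.memZ.1 τ hτ.1).exists_bound E.a_nonneg
    exact besselOp_mono (integrable_comp_sub le_rfl E.a_nonneg hu₀m.1.measurable hC x)
      (integrable_comp_sub le_rfl E.a_nonneg (hm.memZ.1 τ hτ.1).1.measurable hM x)
      (hm.initial_le hV hτ.1)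
  rw [intervalIntegral.integral_const, smul_eq_mul, sub_zero] at h1
  linarith [hm.source_nonneg hV ht x, hu₀ x]

/-- One step of the flattening of an exponentially decaying lower bound. -/
lemma IsMild.flatten_step (hV : PotentialBounds σ Λ ϑ₁ ϑ₂ V) (E : Exponents p σ a)
    (hm : IsMild p a V u₀ m) (hu₀ : ∀ x, 0 ≤ u₀ x) {T A κ κ' : ℝ} (hA : 0 < A) (hκ' : 0 ≤ κ')
    (hκ : κ' ≤ κ) (hAle : A ^ (1 - p) ≤ halfMass n κ * ϑ₁ * (1 - p))
    (h : ∀ t ∈ Icc 0 T, ∀ x, A * cumRate p Λ t ^ (1 - p)⁻¹ * Real.exp (-(κ' * ‖x‖)) ≤ m t x) :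
    ∀ t ∈ Icc 0 T, ∀ x,
      A * cumRate p Λ t ^ (1 - p)⁻¹ * Real.exp (-(p * κ' * ‖x‖)) ≤ m t x := by
  intro t ht x
  have hp := E.p_pos
  have hβ : 0 ≤ (1 - p)⁻¹ := by have := E.one_le_inv; linarith
  have hγ : 0 ≤ (1 - p)⁻¹ * p := by positivity
  have hθ := hV.pos₁
  set H := halfMass n κ with hH
  set X := Real.exp (-(p * κ' * ‖x‖)) with hX
  have hcr := continuous_cumRate_rpow (p := p) hV.cont_rate hγ
  have hint : IntervalIntegrable (fun τ => H * ϑ₁ * A ^ p * X *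
      (rate p Λ τ * cumRate p Λ τ ^ ((1 - p)⁻¹ * p))) volume 0 t :=
    (continuous_const.mul ((continuous_rate hV.cont_rate).mul hcr)).intervalIntegrable _ _
  refine le_trans ?_ (hm.integral_le hV E hu₀ ht.1 x hint fun τ hτ => ?_)
  · rw [intervalIntegral.integral_const_mul, integral_rate_mul_rpow hV.cont_rate hγ,
      E.inv_mul_add_one, div_inv_eq_mul]
    -- The smallness of A makes the constant reproduce itself, so only the decay rate changes in a
    -- step.
    have h1 : A = A ^ (1 - p) * A ^ p := by
      rw [← Real.rpow_add hA]; simp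
    have h2 : 0 ≤ cumRate p Λ t ^ (1 - p)⁻¹ :=
      Real.rpow_nonneg (cumRate_nonneg hV.cont_rate hV.pos_rate ht.1) _
    calc A * cumRate p Λ t ^ (1 - p)⁻¹ * X
        = A ^ (1 - p) * A ^ p * cumRate p Λ t ^ (1 - p)⁻¹ * X := by rw [← h1]
      _ ≤ (H * ϑ₁ * (1 - p)) * A ^ p * cumRate p Λ t ^ (1 - p)⁻¹ * X := by gcongr
      _ = _ := by ring
  · have hτ0 : 0 < τ := hτ.1
    have hE := cumRate_nonneg (p := p) hV.cont_rate hV.pos_rate hτ0.le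
    have hΛ := hV.pos_rate τ hτ0.le
    have key := halfMass_mul_le_besselOp (κ := κ) (x := x) (φ := fun y => V τ y * m τ y ^ p)
      (L := ϑ₁ * Λ τ * (A ^ p * cumRate p Λ τ ^ ((1 - p)⁻¹ * p) * X)) (hκ'.trans hκ)
      (integrable_source hV E hm.nonneg hm.memZ hτ0 x)
      (fun y => mul_nonneg (hV.nonneg τ hτ0 y) (Real.rpow_nonneg (hm.nonneg τ hτ0.le y) _))
      (by positivity) (fun z hz => ?_)
    · rw [rate_of_nonneg p Λ hτ0.le]
      calc _ = Real.exp ((1 - p) * τ) *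
            (H * (ϑ₁ * Λ τ * (A ^ p * cumRate p Λ τ ^ ((1 - p)⁻¹ * p) * X))) := by ring
        _ ≤ _ := by gcongr
    · obtain ⟨-, h1⟩ := norm_le_norm_sub_of_mem_oppositeCap hz
      have hVl : ϑ₁ * Λ τ ≤ V τ (x - z) := by
        refine le_trans ?_ (hV.lower τ hτ0 _ h1)
        exact le_mul_of_one_le_right (by positivity) (Real.one_le_rpow h1 E.σ_nonneg)
      have hm1 := h τ ⟨hτ0.le, hτ.2.trans ht.2⟩ (x - z)
      have hm2 : (A * cumRate p Λ τ ^ (1 - p)⁻¹ * Real.exp (-(κ' * ‖x - z‖))) ^ p ≤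
          m τ (x - z) ^ p := Real.rpow_le_rpow (by positivity) hm1 hp.le
      rw [Real.mul_rpow (by positivity) (by positivity), Real.mul_rpow hA.le (by positivity),
        ← Real.rpow_mul hE, ← Real.exp_mul] at hm2
      -- The triangle inequality splits off a factor in z whose rate pκ' is at most κ; the weight in
      -- `halfMass n κ` absorbs it, with the same κ at every step.
      have hexp : X * Real.exp (-(κ * ‖z‖)) ≤ Real.exp (-(κ' * ‖x - z‖) * p) := by
        rw [hX, ← Real.exp_add, Real.exp_le_exp]
        have h3 : κ' * p * ‖x - z‖ ≤ κ' * p * (‖x‖ + ‖z‖) := by gcongr; exact norm_sub_le x z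
        have h4 : κ' * p ≤ κ := by nlinarith [E.p_lt_one]
        have h5 : κ' * p * ‖z‖ ≤ κ * ‖z‖ := by gcongr
        nlinarith
      calc _ = ϑ₁ * Λ τ * (A ^ p * cumRate p Λ τ ^ ((1 - p)⁻¹ * p) *
            (X * Real.exp (-(κ * ‖z‖)))) := by ring
        _ ≤ V τ (x - z) * (A ^ p * cumRate p Λ τ ^ ((1 - p)⁻¹ * p) *
            Real.exp (-(κ' * ‖x - z‖) * p)) := by
            gcongr
            exact hV.nonneg τ hτ0 _
        _ ≤ _ := by
            gcongr
            exact hV.nonneg τ hτ0 _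

/-- A positive solution dominates a multiple of the spatially constant one. -/
lemma IsMild.exists_const_lower (hV : PotentialBounds σ Λ ϑ₁ ϑ₂ V) (E : Exponents p σ a)
    (hm : IsMild p a V u₀ m) (hu₀m : MemBC a u₀) (hu₀ : ∀ x, 0 ≤ u₀ x) (hne : ∃ x, u₀ x ≠ 0)
    {T : ℝ} (hT : 0 < T) :
    ∃ A, 0 < A ∧ ∀ t ∈ Icc 0 T, ∀ x, A * cumRate p Λ t ^ (1 - p)⁻¹ ≤ m t x := by
  obtain ⟨C₀, -, hC₀⟩ := hu₀m.exists_bound E.a_nonneg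
  obtain ⟨c, κ, hc, hκ, hlow⟩ := exists_exp_le_besselOp le_rfl E.a_nonneg hu₀m.1 hC₀ hu₀ hne
  obtain ⟨δ, D, hδ, hD, hrate⟩ := exists_rate_bounds (p := p) hV.cont_rate hV.pos_rate hT
  have hET := cumRate_pos (p := p) hV.cont_rate hV.pos_rate hT
  have hβ := E.one_le_inv
  have hp := E.p_pos
  have hp1 := E.one_sub_pos
  have hB : 0 < halfMass n κ * ϑ₁ * (1 - p) :=
    mul_pos (mul_pos (halfMass_pos n hκ.le) hV.pos₁) hp1
  -- The first entry starts the induction from t 𝓑u₀, using E(t) ≤ D t; the second is the smallness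
  -- required by `IsMild.flatten_step`.
  set A := min (c / (D * cumRate p Λ T ^ ((1 - p)⁻¹ - 1)))
    ((halfMass n κ * ϑ₁ * (1 - p)) ^ (1 - p)⁻¹) with hA
  have hApos : 0 < A := lt_min (by positivity) (by positivity)
  have hAle : A ^ (1 - p) ≤ halfMass n κ * ϑ₁ * (1 - p) := by
    calc A ^ (1 - p) ≤ ((halfMass n κ * ϑ₁ * (1 - p)) ^ (1 - p)⁻¹) ^ (1 - p) :=
          Real.rpow_le_rpow hApos.le (min_le_right _ _) hp1.le
      _ = _ := by rw [← Real.rpow_mul hB.le, inv_mul_cancel₀ hp1.ne', Real.rpow_one]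
  have hk : ∀ k : ℕ, ∀ t ∈ Icc 0 T, ∀ x,
      A * cumRate p Λ t ^ (1 - p)⁻¹ * Real.exp (-(p ^ k * κ * ‖x‖)) ≤ m t x := by
    intro k
    induction k with
    | zero =>
      intro t ht x
      refine le_trans ?_ (hm.mul_besselOp_le hV E hu₀m hu₀ ht.1 x)
      have hE := cumRate_nonneg (p := p) hV.cont_rate hV.pos_rate ht.1
      have h1 : cumRate p Λ t ^ (1 - p)⁻¹ ≤ D * t * cumRate p Λ T ^ ((1 - p)⁻¹ - 1) := by
        have h2 : cumRate p Λ t ^ (1 - p)⁻¹ =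
            cumRate p Λ t * cumRate p Λ t ^ ((1 - p)⁻¹ - 1) := by
          rcases hE.eq_or_lt with h0 | h0
          · rw [← h0, Real.zero_rpow (by linarith), zero_mul]
          · rw [Real.rpow_sub_one h0.ne']; field_simp
        rw [h2]
        gcongr
        · exact mul_nonneg hD.le ht.1
        · exact (hrate t ht).2.2
        · exact (strictMono_cumRate hV.cont_rate hV.pos_rate).monotone ht.2
      have ht0 := ht.1
      calc _ ≤ c / (D * cumRate p Λ T ^ ((1 - p)⁻¹ - 1)) *
            (D * t * cumRate p Λ T ^ ((1 - p)⁻¹ - 1)) * Real.exp (-(κ * ‖x‖)) := by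
            rw [pow_zero, one_mul]
            gcongr
            exact min_le_left _ _
        _ = t * (c * Real.exp (-(κ * ‖x‖))) := by field_simp
        _ ≤ _ := by gcongr; exact hlow x
    | succ k ih =>
      have h1 := hm.flatten_step hV E hu₀ (κ := κ) (κ' := p ^ k * κ) hApos (by positivity)
        (mul_le_of_le_one_left hκ.le (pow_le_one₀ hp.le E.p_lt_one.le)) hAle ih
      simpa only [pow_succ', mul_assoc] using h1
  refine ⟨A, hApos, fun t ht x => ?_⟩
  have hlim : Tendsto (fun k : ℕ => A * cumRate p Λ t ^ (1 - p)⁻¹ *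
      Real.exp (-(p ^ k * κ * ‖x‖))) atTop
      (𝓝 (A * cumRate p Λ t ^ (1 - p)⁻¹ * Real.exp (-(0 * κ * ‖x‖)))) := by
    have h1 := tendsto_pow_atTop_nhds_zero_of_lt_one hp.le E.p_lt_one
    exact ((Real.continuous_exp.tendsto _).comp ((h1.mul_const κ).mul_const ‖x‖).neg).const_mul _
  have := le_of_tendsto' hlim fun k => hk k t ht x
  simpa using this

/-- The sharp lower bound of a positive solution. -/
lemma IsMild.sharp_lower (hV : PotentialBounds σ Λ ϑ₁ ϑ₂ V) (E : Exponents p σ a)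
    (hm : IsMild p a V u₀ m) (hu₀m : MemBC a u₀) (hu₀ : ∀ x, 0 ≤ u₀ x) (hne : ∃ x, u₀ x ≠ 0)
    {ε₀ : ℝ} (hε : IsBesselLowerConstant σ (p * σ / (1 - p)) Λ ϑ₁ V ε₀) {t : ℝ} (ht : 0 ≤ t)
    (x : Sp n) : (ε₀ * ϑ₁ * (1 - p) * cumRate p Λ t * ‖x‖ ^ σ) ^ (1 - p)⁻¹ ≤ m t x := by
  obtain ⟨hε0, hεl⟩ := hε
  have hp := E.p_pos
  have hp1 := E.one_sub_pos
  have hσ := E.σ_nonneg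
  have hβ : 0 < (1 - p)⁻¹ := by positivity
  have hγ : 0 ≤ (1 - p)⁻¹ * p := by positivity
  have hθ := hV.pos₁
  have hT : 0 < t + 1 := by linarith
  obtain ⟨A, hA, hAl⟩ := hm.exists_const_lower hV E hu₀m hu₀ hne hT
  set P := ε₀ * ϑ₁ * (1 - p) with hP
  have hPpos : 0 < P := by positivity
  -- Each reinsertion maps the constant c to c^p P, whose positive fixed point is Q. Starting from A
  -- = Qq, the k-th constant is Q q^{p^k}, which tends to Q.
  set Q := P ^ (1 - p)⁻¹ with hQ
  have hQpos : 0 < Q := by positivity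
  have hQP : Q ^ (1 - p) = P := by
    rw [hQ, ← Real.rpow_mul hPpos.le, inv_mul_cancel₀ hp1.ne', Real.rpow_one]
  set q := A / Q with hq
  have hqpos : 0 < q := by positivity
  have hk : ∀ k : ℕ, ∀ s ∈ Icc 0 (t + 1), ∀ y : Sp n,
      Q * q ^ (p ^ k) * cumRate p Λ s ^ (1 - p)⁻¹ * ‖y‖ ^ (σ * (1 - p)⁻¹ * (1 - p ^ k)) ≤ m s y := by
    intro k
    induction k with
    | zero =>
      intro s hs y
      have : Q * q = A := by rw [hq]; field_simp
      simpa [this] using hAl s hs y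
    | succ k ih =>
      intro s hs y
      have hpk : p ^ k ≤ 1 := pow_le_one₀ hp.le E.p_lt_one.le
      have hpk0 : 0 < p ^ k := by positivity
      set d := σ * (1 - p)⁻¹ * (1 - p ^ k) with hd
      have hd0 : 0 ≤ d := mul_nonneg (by positivity) (by linarith)
      have hd' : σ * (1 - p)⁻¹ * (1 - p ^ (k + 1)) = σ + d * p := by
        rw [hd, pow_succ]; field_simp; ring
      -- The exponents d p increase to pσ/(1-p), which is why (∗∗) is required exactly up to that
      -- value.
      have hdle : d * p ≤ p * σ / (1 - p) := by
        rw [hd, div_eq_mul_inv]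
        have : 0 ≤ p * σ * (1 - p)⁻¹ * p ^ k := by positivity
        nlinarith
      rw [hd']
      set c := Q * q ^ (p ^ k) with hc
      have hcpos : 0 < c := by positivity
      have hc' : Q * q ^ (p ^ (k + 1)) = c ^ p * P := by
        have h1 : Q = Q ^ p * Q ^ (1 - p) := by rw [← Real.rpow_add hQpos]; simp
        rw [hc, Real.mul_rpow hQpos.le (by positivity), ← Real.rpow_mul hqpos.le, ← pow_succ]
        calc _ = Q ^ p * Q ^ (1 - p) * q ^ (p ^ (k + 1)) := by rw [← h1]
          _ = _ := by rw [hQP]; ring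
      have hint : IntervalIntegrable (fun τ => c ^ p * (ε₀ * ϑ₁) * ‖y‖ ^ (σ + d * p) *
          (rate p Λ τ * cumRate p Λ τ ^ ((1 - p)⁻¹ * p))) volume 0 s :=
        (continuous_const.mul ((continuous_rate hV.cont_rate).mul
          (continuous_cumRate_rpow hV.cont_rate hγ))).intervalIntegrable _ _
      refine le_trans (le_of_eq ?_) (hm.integral_le hV E hu₀ hs.1 y hint fun τ hτ => ?_)
      · rw [intervalIntegral.integral_const_mul, integral_rate_mul_rpow hV.cont_rate hγ,
          E.inv_mul_add_one, div_inv_eq_mul, hc', hP]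
        ring
      · have hτ0 : 0 < τ := hτ.1
        have hE := cumRate_nonneg (p := p) hV.cont_rate hV.pos_rate hτ0.le
        have hpt : ∀ y, c ^ p * cumRate p Λ τ ^ ((1 - p)⁻¹ * p) * (V τ y * ‖y‖ ^ (d * p)) ≤
            V τ y * m τ y ^ p := by
          intro y
          have h1 := Real.rpow_le_rpow (by positivity) (ih τ ⟨hτ0.le, hτ.2.trans hs.2⟩ y) hp.le
          rw [Real.mul_rpow (by positivity) (by positivity), Real.mul_rpow hcpos.le (by positivity),
            ← Real.rpow_mul hE, ← Real.rpow_mul (norm_nonneg y)] at h1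
          have h2 := mul_le_mul_of_nonneg_left h1 (hV.nonneg τ hτ0 y)
          refine le_trans (le_of_eq ?_) h2
          ring
        have hsrc := integrable_source hV E hm.nonneg hm.memZ hτ0 y
        have hVm := (hV.continuous_space hτ0).measurable
        have hlowint : Integrable (fun z => c ^ p * cumRate p Λ τ ^ ((1 - p)⁻¹ * p) *
            (V τ (y - z) * ‖y - z‖ ^ (d * p))) (bessMeas n) := by
          refine hsrc.mono' ?_ (ae_of_all _ fun z => ?_)
          · have h1 : Measurable fun z => V τ (y - z) :=
              hVm.comp (measurable_const.sub measurable_id)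
            exact (by fun_prop : Measurable fun z => c ^ p * cumRate p Λ τ ^ ((1 - p)⁻¹ * p) *
              (V τ (y - z) * ‖y - z‖ ^ (d * p))).aestronglyMeasurable
          · rw [Real.norm_of_nonneg]
            · exact hpt (y - z)
            · have := hV.nonneg τ hτ0 (y - z)
              positivity
        have h1 := besselOp_mono (φ := fun y => c ^ p * cumRate p Λ τ ^ ((1 - p)⁻¹ * p) *
          (V τ y * ‖y‖ ^ (d * p))) (ψ := fun y => V τ y * m τ y ^ p) hlowint hsrc hpt
        rw [besselOp_const_mul] at h1
        have h2 := hεl (d * p) (by positivity) hdle τ hτ0 y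
        rw [rate_of_nonneg p Λ hτ0.le]
        calc _ = Real.exp ((1 - p) * τ) * (c ^ p * cumRate p Λ τ ^ ((1 - p)⁻¹ * p) *
              (ε₀ * (ϑ₁ * Λ τ) * ‖y‖ ^ (σ + d * p))) := by ring
          _ ≤ Real.exp ((1 - p) * τ) * (c ^ p * cumRate p Λ τ ^ ((1 - p)⁻¹ * p) *
              besselOp n (fun y => V τ y * ‖y‖ ^ (d * p)) y) := by gcongr
          _ ≤ _ := by gcongr
  have hE := cumRate_nonneg (p := p) hV.cont_rate hV.pos_rate ht
  have hgoal : (P * cumRate p Λ t * ‖x‖ ^ σ) ^ (1 - p)⁻¹ =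
      Q * cumRate p Λ t ^ (1 - p)⁻¹ * ‖x‖ ^ (σ * (1 - p)⁻¹) := by
    rw [Real.mul_rpow (by positivity) (by positivity), Real.mul_rpow hPpos.le hE,
      ← Real.rpow_mul (norm_nonneg x)]
  rw [hgoal]
  -- At the origin with σ > 0 the claim is just m ≥ 0; otherwise the power of |x| has constant
  -- exponent zero or a positive base, and the limit in the exponent is immediate.
  have hdeg : ‖x‖ = 0 ∧ 0 < σ ∨ σ = 0 ∨ 0 < ‖x‖ := by
    rcases (norm_nonneg x).eq_or_lt with h | h
    · rcases hσ.eq_or_lt with h' | h'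
      · exact Or.inr (Or.inl h'.symm)
      · exact Or.inl ⟨h.symm, h'⟩
    · exact Or.inr (Or.inr h)
  rcases hdeg with ⟨hx, hσ'⟩ | hrest
  · rw [hx, Real.zero_rpow (by positivity), mul_zero]
    exact hm.nonneg t ht x
  have h1 := tendsto_pow_atTop_nhds_zero_of_lt_one hp.le E.p_lt_one
  have hlim2 : Tendsto (fun k : ℕ => ‖x‖ ^ (σ * (1 - p)⁻¹ * (1 - p ^ k))) atTop
      (𝓝 (‖x‖ ^ (σ * (1 - p)⁻¹ * (1 - 0)))) := by
    rcases hrest with h0 | hx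
    · simp [h0]
    · exact tendsto_const_nhds.rpow ((h1.const_sub 1).const_mul _) (Or.inl hx.ne')
  have hlim1 : Tendsto (fun k : ℕ => q ^ (p ^ k)) atTop (𝓝 (q ^ (0 : ℝ))) :=
    tendsto_const_nhds.rpow h1 (Or.inl hqpos.ne')
  have hlim := ((hlim1.const_mul Q).mul_const (cumRate p Λ t ^ (1 - p)⁻¹)).mul hlim2
  have := le_of_tendsto' hlim fun k => hk k t ⟨ht, by linarith⟩ x
  simpa using this

end Lower

/-! ### Uniqueness -/

lemma abs_rpow_sub_rpow_le {p u v : ℝ} (hp₀ : 0 < p) (hp₁ : p < 1) (hu : 0 ≤ u) (hv : 0 ≤ v) :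
    |u ^ p - v ^ p| ≤ |u - v| ^ p := by
  wlog h : v ≤ u generalizing u v
  · rw [abs_sub_comm, abs_sub_comm u]
    exact this hv hu (by linarith)
  have h1 := Real.rpow_add_le_add_rpow (a := u - v) (b := v) (by linarith) hv hp₀.le hp₁.le
  rw [sub_add_cancel] at h1
  rw [abs_of_nonneg (by have := Real.rpow_le_rpow hv h hp₀.le; linarith),
    abs_of_nonneg (by linarith)]
  linarith

/-- Mean value inequality: the derivative p x^{p-1} decreases, so on [L, ∞) it is largest at L. -/
lemma abs_rpow_sub_rpow_le_mul {p L u v : ℝ} (hp₀ : 0 < p) (hp₁ : p < 1) (hL : 0 < L)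
    (hu : L ≤ u) (hv : L ≤ v) : |u ^ p - v ^ p| ≤ p * L ^ (p - 1) * |u - v| := by
  have h := (convex_Ici L).norm_image_sub_le_of_norm_hasDerivWithin_le (f := fun x : ℝ => x ^ p)
    (f' := fun x => p * x ^ (p - 1)) (C := p * L ^ (p - 1)) (x := v) (y := u)
    (fun x hx => (Real.hasDerivAt_rpow_const (Or.inl (lt_of_lt_of_le hL hx).ne')).hasDerivWithinAt)
    (fun x hx => by
      have hx' : L ≤ x := hx
      have hx0 : 0 < x := lt_of_lt_of_le hL hx'
      rw [Real.norm_of_nonneg (by positivity)]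
      exact mul_le_mul_of_nonneg_left (Real.rpow_le_rpow_of_nonpos hL hx' (by linarith)) hp₀.le)
    hv hu
  simpa only [Real.norm_eq_abs] using h

section Unique

variable {n : ℕ} [NeZero n] {p σ a ϑ₁ ϑ₂ : ℝ} {Λ : ℝ → ℝ} {V m₁ m₂ : ℝ → Sp n → ℝ}
  {u₀ : Sp n → ℝ}

/-- Integral comparison for the difference of two solutions. -/
lemma IsMild.abs_sub_le (hV : PotentialBounds σ Λ ϑ₁ ϑ₂ V) (E : Exponents p σ a)
    (h₁ : IsMild p a V u₀ m₁) (h₂ : IsMild p a V u₀ m₂) {R t : ℝ} (hR : 1 ≤ R) (ht : 0 ≤ t)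
    {G : ℝ → ℝ} (hG : IntervalIntegrable G volume 0 t)
    (h : ∀ τ ∈ Ioc 0 t, ∀ y, |m₁ τ y - m₂ τ y| +
      Real.exp ((1 - p) * τ) * V τ y * |m₁ τ y ^ p - m₂ τ y ^ p| ≤ G τ * (R + ‖y‖) ^ a)
    (x : Sp n) :
    |m₁ t x - m₂ t x| ≤ growthConst n a R * (∫ τ in (0 : ℝ)..t, G τ) * (R + ‖x‖) ^ a := by
  have ha := E.a_nonneg
  have hl₁ := intervalIntegrable_linear ha h₁.memZ ht x
  have hl₂ := intervalIntegrable_linear ha h₂.memZ ht x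
  have hs₁ := intervalIntegrable_source hV E h₁.nonneg h₁.memZ ht x
  have hs₂ := intervalIntegrable_source hV E h₂.nonneg h₂.memZ ht x
  have e : m₁ t x - m₂ t x = ∫ τ in (0 : ℝ)..t,
      ((besselOp n (m₁ τ) x + Real.exp ((1 - p) * τ) *
        besselOp n (fun y => V τ y * m₁ τ y ^ p) x) -
      (besselOp n (m₂ τ) x + Real.exp ((1 - p) * τ) *
        besselOp n (fun y => V τ y * m₂ τ y ^ p) x)) := by
    rw [intervalIntegral.integral_sub (hl₁.add hs₁) (hl₂.add hs₂),
      intervalIntegral.integral_add hl₁ hs₁, intervalIntegral.integral_add hl₂ hs₂,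
      h₁.eqn t ht x, h₂.eqn t ht x]
    ring
  have hbound : growthConst n a R * (∫ τ in (0 : ℝ)..t, G τ) * (R + ‖x‖) ^ a =
      ∫ τ in (0 : ℝ)..t, growthConst n a R * G τ * (R + ‖x‖) ^ a := by
    rw [intervalIntegral.integral_mul_const, intervalIntegral.integral_const_mul]
  rw [e, hbound, ← Real.norm_eq_abs]
  refine intervalIntegral.norm_integral_le_of_norm_le ht (ae_of_all _ fun τ hτ => ?_)
    ((hG.const_mul _).mul_const _)
  have hτ0 : 0 < τ := hτ.1
  obtain ⟨C₁, -, hC₁⟩ := (h₁.memZ.1 τ hτ0.le).exists_bound ha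
  obtain ⟨C₂, -, hC₂⟩ := (h₂.memZ.1 τ hτ0.le).exists_bound ha
  have hi₁ := integrable_comp_sub le_rfl ha (h₁.memZ.1 τ hτ0.le).1.measurable hC₁ x
  have hi₂ := integrable_comp_sub le_rfl ha (h₂.memZ.1 τ hτ0.le).1.measurable hC₂ x
  have hj₁ := (integrable_source hV E h₁.nonneg h₁.memZ hτ0 x).const_mul (Real.exp ((1 - p) * τ))
  have hj₂ := (integrable_source hV E h₂.nonneg h₂.memZ hτ0 x).const_mul (Real.exp ((1 - p) * τ))
  have hS₁i := hi₁.add hj₁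
  set S₁ : Sp n → ℝ := fun y => m₁ τ y + Real.exp ((1 - p) * τ) * (V τ y * m₁ τ y ^ p) with hS₁
  have hS₂i := hi₂.add hj₂
  set S₂ : Sp n → ℝ := fun y => m₂ τ y + Real.exp ((1 - p) * τ) * (V τ y * m₂ τ y ^ p) with hS₂
  have hm₁ : Measurable S₁ :=
    (h₁.memZ.1 τ hτ0.le).1.measurable.add ((measurable_source hV h₁.memZ hτ0).const_mul _)
  have hm₂ : Measurable S₂ :=
    (h₂.memZ.1 τ hτ0.le).1.measurable.add ((measurable_source hV h₂.memZ hτ0).const_mul _)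
  have e₁ : besselOp n S₁ x = besselOp n (m₁ τ) x + Real.exp ((1 - p) * τ) *
      besselOp n (fun y => V τ y * m₁ τ y ^ p) x := by
    rw [← besselOp_const_mul]
    exact besselOp_add (φ := m₁ τ)
      (ψ := fun y => Real.exp ((1 - p) * τ) * (V τ y * m₁ τ y ^ p)) hi₁ hj₁
  have e₂ : besselOp n S₂ x = besselOp n (m₂ τ) x + Real.exp ((1 - p) * τ) *
      besselOp n (fun y => V τ y * m₂ τ y ^ p) x := by
    rw [← besselOp_const_mul]
    exact besselOp_add (φ := m₂ τ)
      (ψ := fun y => Real.exp ((1 - p) * τ) * (V τ y * m₂ τ y ^ p)) hi₂ hj₂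
  rw [← e₁, ← e₂, ← besselOp_sub (φ := S₁) (ψ := S₂) hS₁i hS₂i, Real.norm_eq_abs]
  refine abs_besselOp_le (φ := fun y => S₁ y - S₂ y) hR ha (hm₁.sub hm₂) (fun y => ?_) x
  refine le_trans ?_ (h τ hτ y)
  have h3 := hV.nonneg τ hτ0 y
  have e3 : S₁ y - S₂ y = (m₁ τ y - m₂ τ y) +
      Real.exp ((1 - p) * τ) * V τ y * (m₁ τ y ^ p - m₂ τ y ^ p) := by
    simp only [hS₁, hS₂]; ring
  rw [e3]
  refine (abs_add_le _ _).trans (le_of_eq ?_)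
  rw [abs_mul (Real.exp ((1 - p) * τ) * V τ y), abs_of_nonneg (a := Real.exp ((1 - p) * τ) * V τ y)
    (by positivity)]

/-- Two solutions separate at most like `E(t)^{1/(1-p)}`. -/
lemma IsMild.exists_abs_sub_le (hV : PotentialBounds σ Λ ϑ₁ ϑ₂ V) (E : Exponents p σ a)
    (h₁ : IsMild p a V u₀ m₁) (h₂ : IsMild p a V u₀ m₂) {R T : ℝ} (hR : 1 ≤ R) (hT : 0 < T) :
    ∃ N, 0 < N ∧ ∀ t ∈ Ioc 0 T, ∀ x,
      |m₁ t x - m₂ t x| ≤ N * cumRate p Λ t ^ (1 - p)⁻¹ * (R + ‖x‖) ^ a := by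
  have ha := E.a_nonneg
  have hp := E.p_pos
  have hp1 := E.one_sub_pos
  have hβ : 0 < (1 - p)⁻¹ := by positivity
  have hθ := hV.pos₂
  obtain ⟨M₁, hM₁, hb₁⟩ := h₁.memZ.exists_bound ha T
  obtain ⟨M₂, hM₂, hb₂⟩ := h₂.memZ.exists_bound ha T
  obtain ⟨δ, D, hδ, hD, hrate⟩ := exists_rate_bounds (p := p) hV.cont_rate hV.pos_rate hT
  set M := M₁ + M₂ + 1 with hM
  have hMpos : 0 < M := by positivity
  have hbM : ∀ t ∈ Ioc 0 T, ∀ x, |m₁ t x - m₂ t x| ≤ M * (R + ‖x‖) ^ a := by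
    intro t ht x
    have h1 := hb₁ t ⟨ht.1.le, ht.2⟩ x
    have h2 := hb₂ t ⟨ht.1.le, ht.2⟩ x
    calc |m₁ t x - m₂ t x| ≤ |m₁ t x| + |m₂ t x| := abs_sub _ _
      _ ≤ M * (1 + ‖x‖) ^ a := by
        have : 0 ≤ (1 + ‖x‖) ^ a := by positivity
        rw [hM]; linarith
      _ ≤ _ := by gcongr
  have hgc := growthConst_pos n hR ha
  set C := M ^ (1 - p) / δ + ϑ₂ with hC
  have hCpos : 0 < C := by positivity
  set B := growthConst n a R * C with hB
  have hBpos : 0 < B := by positivity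
  -- N dominates the crude bound M and satisfies B N^p ≤ N, so it is preserved while the exponent of
  -- E iterates γ ↦ pγ + 1 from 0.
  set N := max M (B ^ (1 - p)⁻¹) with hN
  have hNpos : 0 < N := lt_max_of_lt_left hMpos
  have hBN : B * N ^ p ≤ N := by
    have h1 : B ≤ N ^ (1 - p) := by
      calc B = (B ^ (1 - p)⁻¹) ^ (1 - p) := by
            rw [← Real.rpow_mul hBpos.le, inv_mul_cancel₀ hp1.ne', Real.rpow_one]
        _ ≤ _ := Real.rpow_le_rpow (by positivity) (le_max_right _ _) hp1.le
    calc B * N ^ p ≤ N ^ (1 - p) * N ^ p := by gcongr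
      _ = N := by rw [← Real.rpow_add hNpos]; simp
  have hk : ∀ k : ℕ, ∀ t ∈ Ioc 0 T, ∀ x, |m₁ t x - m₂ t x| ≤
      N * cumRate p Λ t ^ ((1 - p)⁻¹ * (1 - p ^ k)) * (R + ‖x‖) ^ a := by
    intro k
    induction k with
    | zero =>
      intro t ht x
      refine (hbM t ht x).trans ?_
      simp only [pow_zero, sub_self, mul_zero, Real.rpow_zero, mul_one]
      gcongr
      exact le_max_left _ _
    | succ k ih =>
      intro t ht x
      have hpk : p ^ k ≤ 1 := pow_le_one₀ hp.le E.p_lt_one.le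
      set γ := (1 - p)⁻¹ * (1 - p ^ k) with hγ
      have hγ0 : 0 ≤ γ := mul_nonneg hβ.le (by linarith)
      have hγp : 0 ≤ γ * p := by positivity
      have hγ' : (1 - p)⁻¹ * (1 - p ^ (k + 1)) = γ * p + 1 := by
        rw [hγ, pow_succ]; field_simp; ring
      have hcont : Continuous fun τ => N ^ p * C * (rate p Λ τ * cumRate p Λ τ ^ (γ * p)) :=
        continuous_const.mul ((continuous_rate hV.cont_rate).mul
          (continuous_cumRate_rpow hV.cont_rate hγp))
      refine (h₁.abs_sub_le hV E h₂ hR ht.1.le (hcont.intervalIntegrable 0 t)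
        (fun τ hτ y => ?_) x).trans ?_
      · have hτ0 : 0 < τ := hτ.1
        have hτT : τ ∈ Ioc 0 T := ⟨hτ.1, hτ.2.trans ht.2⟩
        have hE := cumRate_nonneg (p := p) hV.cont_rate hV.pos_rate hτ0.le
        have hr := rate_pos (p := p) hV.pos_rate τ
        set w := |m₁ τ y - m₂ τ y| with hw
        have hw0 : 0 ≤ w := abs_nonneg _
        set W := (R + ‖y‖) ^ a with hW
        have hWpos : 0 < W := by positivity
        have hwp : w ^ p ≤ N ^ p * cumRate p Λ τ ^ (γ * p) * W ^ p := by
          have h1 := Real.rpow_le_rpow hw0 (ih τ hτT y) hp.le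
          rwa [Real.mul_rpow (by positivity) (by positivity), Real.mul_rpow hNpos.le
            (by positivity), ← Real.rpow_mul hE] at h1
        -- Writing w = w^{1-p} w^p and bounding the first factor crudely gives the linear term the
        -- same sublinear form as the source; rate/δ ≥ 1 supplies the missing factor E'.
        have hlin : w ≤ M ^ (1 - p) / δ * rate p Λ τ *
            (N ^ p * cumRate p Λ τ ^ (γ * p)) * W := by
          have h1 : w = w ^ (1 - p) * w ^ p := by
            rcases hw0.eq_or_lt with h0 | h0
            · rw [← h0, Real.zero_rpow hp.ne', mul_zero]
            · rw [← Real.rpow_add h0]; simp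
          have h2 : w ^ (1 - p) ≤ M ^ (1 - p) * W ^ (1 - p) := by
            rw [← Real.mul_rpow hMpos.le hWpos.le]
            exact Real.rpow_le_rpow hw0 (hbM τ hτT y) hp1.le
          have h3 : W ^ (1 - p) * W ^ p = W := by rw [← Real.rpow_add hWpos]; simp
          have h4 : 1 ≤ rate p Λ τ / δ :=
            (one_le_div hδ).mpr (hrate τ ⟨hτT.1.le, hτT.2⟩).1
          calc w = w ^ (1 - p) * w ^ p := h1
            _ ≤ (M ^ (1 - p) * W ^ (1 - p)) * (N ^ p * cumRate p Λ τ ^ (γ * p) * W ^ p) := by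
              gcongr
            _ = M ^ (1 - p) * (N ^ p * cumRate p Λ τ ^ (γ * p)) * (W ^ (1 - p) * W ^ p) * 1 := by
              ring
            _ ≤ M ^ (1 - p) * (N ^ p * cumRate p Λ τ ^ (γ * p)) * (W ^ (1 - p) * W ^ p) *
                (rate p Λ τ / δ) := by gcongr
            _ = _ := by rw [h3]; ring
        have hsrc : Real.exp ((1 - p) * τ) * V τ y * |m₁ τ y ^ p - m₂ τ y ^ p| ≤
            ϑ₂ * rate p Λ τ * (N ^ p * cumRate p Λ τ ^ (γ * p)) * W := by
          have h1 := abs_rpow_sub_rpow_le hp E.p_lt_one (h₁.nonneg τ hτ0.le y)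
            (h₂.nonneg τ hτ0.le y)
          have h2 := E.rpow_mul_weight_le hR (norm_nonneg y)
          have h3 := hV.exp_mul_le p hτ0 y
          have h4 := hV.nonneg τ hτ0 y
          calc _ ≤ ϑ₂ * rate p Λ τ * ‖y‖ ^ σ *
                (N ^ p * cumRate p Λ τ ^ (γ * p) * W ^ p) :=
                mul_le_mul h3 (h1.trans hwp) (abs_nonneg _) (by positivity)
            _ = ϑ₂ * rate p Λ τ * (N ^ p * cumRate p Λ τ ^ (γ * p)) * (‖y‖ ^ σ * W ^ p) := by
                ring
            _ ≤ _ := by gcongr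
        calc _ ≤ M ^ (1 - p) / δ * rate p Λ τ * (N ^ p * cumRate p Λ τ ^ (γ * p)) * W +
              ϑ₂ * rate p Λ τ * (N ^ p * cumRate p Λ τ ^ (γ * p)) * W := add_le_add hlin hsrc
          _ = _ := by rw [hC]; ring
      · rw [intervalIntegral.integral_const_mul, integral_rate_mul_rpow hV.cont_rate hγp, hγ']
        have hE := cumRate_nonneg (p := p) hV.cont_rate hV.pos_rate ht.1.le
        refine mul_le_mul_of_nonneg_right ?_ (by positivity)
        calc growthConst n a R * (N ^ p * C * (cumRate p Λ t ^ (γ * p + 1) / (γ * p + 1)))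
            = B * N ^ p * (cumRate p Λ t ^ (γ * p + 1) / (γ * p + 1)) := by rw [hB]; ring
          _ ≤ N * cumRate p Λ t ^ (γ * p + 1) := by
            gcongr
            exact div_le_self (by positivity) (by linarith)
  refine ⟨N, hNpos, fun t ht x => ?_⟩
  have hE := cumRate_pos (p := p) hV.cont_rate hV.pos_rate ht.1
  have h1 := tendsto_pow_atTop_nhds_zero_of_lt_one hp.le E.p_lt_one
  have hlim : Tendsto (fun k : ℕ => N * cumRate p Λ t ^ ((1 - p)⁻¹ * (1 - p ^ k)) *
      (R + ‖x‖) ^ a) atTop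
      (𝓝 (N * cumRate p Λ t ^ ((1 - p)⁻¹ * (1 - 0)) * (R + ‖x‖) ^ a)) :=
    ((tendsto_const_nhds.rpow ((h1.const_sub 1).const_mul _)
      (Or.inl hE.ne')).const_mul N).mul_const _
  have := ge_of_tendsto' hlim fun k => hk k t ht x
  simpa using this

/-- The linearized source is controlled by `E'/E`. -/
lemma IsMild.source_sub_le (hV : PotentialBounds σ Λ ϑ₁ ϑ₂ V) (E : Exponents p σ a)
    (h₁ : IsMild p a V u₀ m₁) (h₂ : IsMild p a V u₀ m₂) (hu₀m : MemBC a u₀)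
    (hu₀ : ∀ x, 0 ≤ u₀ x) (hne : ∃ x, u₀ x ≠ 0) {ε₀ : ℝ}
    (hε : IsBesselLowerConstant σ (p * σ / (1 - p)) Λ ϑ₁ V ε₀) {τ : ℝ} (hτ : 0 < τ) (y : Sp n) :
    Real.exp ((1 - p) * τ) * V τ y * |m₁ τ y ^ p - m₂ τ y ^ p| ≤
      p * ϑ₂ / (ε₀ * ϑ₁) * (1 - p)⁻¹ * (rate p Λ τ / cumRate p Λ τ) * |m₁ τ y - m₂ τ y| := by
  have hp := E.p_pos
  have hp1 := E.one_sub_pos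
  have hE := cumRate_pos (p := p) hV.cont_rate hV.pos_rate hτ
  have hr := rate_pos (p := p) hV.pos_rate τ
  have hθ₁ := hV.pos₁
  have hθ₂ := hV.pos₂
  have hε0 := hε.1
  have hle := hV.exp_mul_le p hτ y
  have hV0 := hV.nonneg τ hτ y
  have hs0 : 0 ≤ ‖y‖ ^ σ := by positivity
  -- Where |y|^σ vanishes the lower bound is useless, but V vanishes too. Elsewhere |y|^σ cancels
  -- between the bound on V and P⁻¹.
  rcases hs0.eq_or_lt with h0 | h0
  · rw [← h0, mul_zero] at hle
    have : Real.exp ((1 - p) * τ) * V τ y = 0 := le_antisymm hle (by positivity)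
    rw [this, zero_mul]
    positivity
  · set s := ‖y‖ ^ σ with hs
    set P := ε₀ * ϑ₁ * (1 - p) * cumRate p Λ τ * s with hP
    have hPpos : 0 < P := by positivity
    have hl₁ : P ^ (1 - p)⁻¹ ≤ m₁ τ y := h₁.sharp_lower hV E hu₀m hu₀ hne hε hτ.le y
    have hl₂ : P ^ (1 - p)⁻¹ ≤ m₂ τ y := h₂.sharp_lower hV E hu₀m hu₀ hne hε hτ.le y
    have hd := abs_rpow_sub_rpow_le_mul hp E.p_lt_one (by positivity) hl₁ hl₂
    have hPe : (P ^ (1 - p)⁻¹) ^ (p - 1) = P⁻¹ := by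
      rw [← Real.rpow_mul hPpos.le, show (1 - p)⁻¹ * (p - 1) = -1 by field_simp; ring,
        Real.rpow_neg_one]
    rw [hPe] at hd
    calc _ ≤ ϑ₂ * rate p Λ τ * s * (p * P⁻¹ * |m₁ τ y - m₂ τ y|) :=
          mul_le_mul hle hd (abs_nonneg _) (by positivity)
      _ = _ := by rw [hP]; field_simp

/-- Solutions of the integral equation are unique. -/
theorem IsMild.unique (hV : PotentialBounds σ Λ ϑ₁ ϑ₂ V) (E : Exponents p σ a)
    (h₁ : IsMild p a V u₀ m₁) (h₂ : IsMild p a V u₀ m₂) (hu₀m : MemBC a u₀)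
    (hu₀ : ∀ x, 0 ≤ u₀ x) (hne : ∃ x, u₀ x ≠ 0) {ε₀ : ℝ}
    (hε : IsBesselLowerConstant σ (p * σ / (1 - p)) Λ ϑ₁ V ε₀) (hpε : p < ε₀ * (ϑ₁ / ϑ₂))
    {t : ℝ} (ht : 0 ≤ t) (x : Sp n) : m₁ t x = m₂ t x := by
  rcases ht.eq_or_lt with rfl | ht0
  · rw [h₁.eqn 0 le_rfl, h₂.eqn 0 le_rfl]
    simp
  have ha := E.a_nonneg
  have hp := E.p_pos
  have hp1 := E.one_sub_pos
  have hβ1 := E.one_le_inv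
  have hβ : 0 < (1 - p)⁻¹ := by positivity
  have hγ : 0 ≤ (1 - p)⁻¹ * p := by positivity
  have hθ₁ := hV.pos₁
  have hθ₂ := hV.pos₂
  have hε0 := hε.1
  -- The hypothesis on p says exactly that θ < 1; R is then chosen so that bθ < 1 as well.
  set θ := p * ϑ₂ / (ε₀ * ϑ₁) with hθ
  have hθ0 : 0 < θ := by positivity
  have hθ1 : θ < 1 := by
    rw [hθ, div_lt_one (by positivity)]
    rw [← mul_div_assoc, lt_div_iff₀ hθ₂] at hpε
    exact hpε
  obtain ⟨R, hR, hbR⟩ : ∃ R, 1 ≤ R ∧ growthConst n a R * θ < 1 := by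
    have h1 := (tendsto_growthConst n ha).mul_const θ
    rw [one_mul] at h1
    obtain ⟨R, hR⟩ := ((h1.eventually (gt_mem_nhds hθ1)).and (eventually_ge_atTop 1)).exists
    exact ⟨R, hR.2, hR.1⟩
  set b := growthConst n a R with hb
  have hbpos : 0 < b := growthConst_pos n hR ha
  -- This choice gives b/K = (1 - bθ)/2, hence ρ = (1 + bθ)/2 < 1.
  set K := 2 * b / (1 - b * θ) with hK
  have hKpos : 0 < K := div_pos (by positivity) (by linarith)
  set ρ := b * (1 / K + θ) with hρ
  have hρ0 : 0 ≤ ρ := by positivity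
  have hρ1 : ρ < 1 := by
    have h1 : b * (1 / K) = (1 - b * θ) / 2 := by
      rw [hK]; field_simp
    rw [hρ, mul_add, h1]; linarith
  obtain ⟨N, hN, hNb⟩ := h₁.exists_abs_sub_le hV E h₂ hR ht0
  have hk : ∀ k : ℕ, ∀ s ∈ Ioc 0 t, ∀ y, |m₁ s y - m₂ s y| ≤
      N * ρ ^ k * Real.exp (K * s) * cumRate p Λ s ^ (1 - p)⁻¹ * (R + ‖y‖) ^ a := by
    intro k
    induction k with
    | zero =>
      intro s hs y
      have hE := cumRate_pos (p := p) hV.cont_rate hV.pos_rate hs.1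
      have hs0 := hs.1
      refine (hNb s hs y).trans ?_
      rw [pow_zero, mul_one]
      have h1 : 1 ≤ Real.exp (K * s) := Real.one_le_exp (by positivity)
      gcongr
      exact le_mul_of_one_le_right hN.le h1
    | succ k ih =>
      intro s hs y
      set c := N * ρ ^ k with hc
      have hc0 : 0 ≤ c := by positivity
      have hEs := cumRate_pos (p := p) hV.cont_rate hV.pos_rate hs.1
      -- In the linear term E is frozen at time s and e^{Kτ} is integrated, which gains 1/K. In the
      -- source e^{Kτ} is frozen and E'E^{β-1} is integrated, which leaves exactly θ.
      have hcont1 : Continuous fun τ => c * cumRate p Λ s ^ (1 - p)⁻¹ * Real.exp (K * τ) := by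
        fun_prop
      have hcont2 : Continuous fun τ => θ * (1 - p)⁻¹ * c * Real.exp (K * s) *
          (rate p Λ τ * cumRate p Λ τ ^ ((1 - p)⁻¹ * p)) :=
        continuous_const.mul ((continuous_rate hV.cont_rate).mul
          (continuous_cumRate_rpow hV.cont_rate hγ))
      refine (h₁.abs_sub_le hV E h₂ hR hs.1.le ((hcont1.add hcont2).intervalIntegrable 0 s)
        (fun τ hτ z => ?_) y).trans ?_
      · have hτ0 : 0 < τ := hτ.1
        have hE := cumRate_pos (p := p) hV.cont_rate hV.pos_rate hτ0
        have hr := rate_pos (p := p) hV.pos_rate τ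
        have hw := ih τ ⟨hτ0, hτ.2.trans hs.2⟩ z
        have hmono : cumRate p Λ τ ^ (1 - p)⁻¹ ≤ cumRate p Λ s ^ (1 - p)⁻¹ :=
          Real.rpow_le_rpow hE.le ((strictMono_cumRate hV.cont_rate hV.pos_rate).monotone hτ.2)
            hβ.le
        have hlin : |m₁ τ z - m₂ τ z| ≤
            c * cumRate p Λ s ^ (1 - p)⁻¹ * Real.exp (K * τ) * (R + ‖z‖) ^ a := by
          refine hw.trans ?_
          calc _ = c * cumRate p Λ τ ^ (1 - p)⁻¹ * Real.exp (K * τ) * (R + ‖z‖) ^ a := by ring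
            _ ≤ _ := by gcongr
        have hsrc : Real.exp ((1 - p) * τ) * V τ z * |m₁ τ z ^ p - m₂ τ z ^ p| ≤
            θ * (1 - p)⁻¹ * c * Real.exp (K * s) *
              (rate p Λ τ * cumRate p Λ τ ^ ((1 - p)⁻¹ * p)) * (R + ‖z‖) ^ a := by
          refine (h₁.source_sub_le hV E h₂ hu₀m hu₀ hne hε hτ0 z).trans ?_
          have hpow : cumRate p Λ τ ^ (1 - p)⁻¹ =
              cumRate p Λ τ ^ ((1 - p)⁻¹ * p) * cumRate p Λ τ := by
            conv_lhs => rw [← E.inv_mul_add_one]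
            rw [Real.rpow_add_one hE.ne']
          have hexp : Real.exp (K * τ) ≤ Real.exp (K * s) := by
            gcongr; exact hτ.2
          calc _ ≤ θ * (1 - p)⁻¹ * (rate p Λ τ / cumRate p Λ τ) *
                (c * Real.exp (K * τ) * cumRate p Λ τ ^ (1 - p)⁻¹ * (R + ‖z‖) ^ a) := by
                gcongr
            _ ≤ θ * (1 - p)⁻¹ * (rate p Λ τ / cumRate p Λ τ) *
                (c * Real.exp (K * s) * cumRate p Λ τ ^ (1 - p)⁻¹ * (R + ‖z‖) ^ a) := by
                gcongr
            _ = _ := by rw [hpow]; field_simp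
        calc _ ≤ _ := add_le_add hlin hsrc
          _ = _ := by simp only [Pi.add_apply]; ring
      · have hint : ∫ τ in (0 : ℝ)..s, (c * cumRate p Λ s ^ (1 - p)⁻¹ * Real.exp (K * τ) +
            θ * (1 - p)⁻¹ * c * Real.exp (K * s) *
              (rate p Λ τ * cumRate p Λ τ ^ ((1 - p)⁻¹ * p))) ≤
            c * Real.exp (K * s) * cumRate p Λ s ^ (1 - p)⁻¹ * (1 / K + θ) := by
          rw [intervalIntegral.integral_add (hcont1.intervalIntegrable 0 s)
            (hcont2.intervalIntegrable 0 s), intervalIntegral.integral_const_mul,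
            intervalIntegral.integral_const_mul, integral_rate_mul_rpow hV.cont_rate hγ,
            E.inv_mul_add_one, intervalIntegral.integral_comp_mul_left (fun u => Real.exp u)
            hKpos.ne', integral_exp, mul_zero, Real.exp_zero, smul_eq_mul]
          have h1 : c * cumRate p Λ s ^ (1 - p)⁻¹ * (K⁻¹ * (Real.exp (K * s) - 1)) ≤
              c * cumRate p Λ s ^ (1 - p)⁻¹ * (K⁻¹ * Real.exp (K * s)) := by
            gcongr; linarith
          calc _ ≤ c * cumRate p Λ s ^ (1 - p)⁻¹ * (K⁻¹ * Real.exp (K * s)) +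
                θ * (1 - p)⁻¹ * c * Real.exp (K * s) *
                  (cumRate p Λ s ^ (1 - p)⁻¹ / (1 - p)⁻¹) := by gcongr
            _ = _ := by field_simp
        have h2 : b * (∫ τ in (0 : ℝ)..s, (c * cumRate p Λ s ^ (1 - p)⁻¹ * Real.exp (K * τ) +
            θ * (1 - p)⁻¹ * c * Real.exp (K * s) *
              (rate p Λ τ * cumRate p Λ τ ^ ((1 - p)⁻¹ * p)))) ≤
            N * ρ ^ (k + 1) * Real.exp (K * s) * cumRate p Λ s ^ (1 - p)⁻¹ := by
          calc _ ≤ b * (c * Real.exp (K * s) * cumRate p Λ s ^ (1 - p)⁻¹ * (1 / K + θ)) := by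
                gcongr
            _ = _ := by rw [hc, pow_succ, hρ]; ring
        exact mul_le_mul_of_nonneg_right h2 (by positivity)
  have hlim : Tendsto (fun k : ℕ => N * ρ ^ k * Real.exp (K * t) * cumRate p Λ t ^ (1 - p)⁻¹ *
      (R + ‖x‖) ^ a) atTop
      (𝓝 (N * 0 * Real.exp (K * t) * cumRate p Λ t ^ (1 - p)⁻¹ * (R + ‖x‖) ^ a)) :=
    ((((tendsto_pow_atTop_nhds_zero_of_lt_one hρ0 hρ1).const_mul N).mul_const _).mul_const
      _).mul_const _
  have h0 := ge_of_tendsto' hlim fun k => hk k t ⟨ht0, le_rfl⟩ x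
  simp only [mul_zero, zero_mul] at h0
  exact sub_eq_zero.mp (abs_nonpos_iff.mp h0)

end Unique

/-! ### Existence by monotone iteration -/

/-- The coefficient `e^{(1-p)τ} V(y, τ)` of the source, extended by zero to `τ ≤ 0`. -/
def gain {n : ℕ} (p : ℝ) (V : ℝ → Sp n → ℝ) : ℝ × Sp n → ℝ :=
  (Ioi (0 : ℝ) ×ˢ (univ : Set (Sp n))).indicator fun q => Real.exp ((1 - p) * q.1) * V q.1 q.2

/-- The integral operator of the equation, on extended nonnegative functions. -/
def picard {n : ℕ} (p : ℝ) (V : ℝ → Sp n → ℝ) (u₀ : Sp n → ℝ) (f : ℝ × Sp n → ENNReal)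
    (q : ℝ × Sp n) : ENNReal :=
  ENNReal.ofReal (u₀ q.2) + ∫⁻ τ in Ioc 0 q.1, ∫⁻ z, (f (τ, q.2 - z) +
    ENNReal.ofReal (gain p V (τ, q.2 - z)) * f (τ, q.2 - z) ^ p) ∂bessMeas n

/-- The Picard iterates starting at zero. -/
def picardIter {n : ℕ} (p : ℝ) (V : ℝ → Sp n → ℝ) (u₀ : Sp n → ℝ) : ℕ → ℝ × Sp n → ENNReal
  | 0 => 0
  | k + 1 => picard p V u₀ (picardIter p V u₀ k)

/-- The limit of the Picard iterates. -/
def picardLimit {n : ℕ} (p : ℝ) (V : ℝ → Sp n → ℝ) (u₀ : Sp n → ℝ) (q : ℝ × Sp n) : ENNReal :=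
  ⨆ k, picardIter p V u₀ k q

section Existence

variable {n : ℕ} {p σ a ϑ₁ ϑ₂ : ℝ} {Λ : ℝ → ℝ} {V : ℝ → Sp n → ℝ} {u₀ : Sp n → ℝ}

lemma gain_of_pos {τ : ℝ} (hτ : 0 < τ) (y : Sp n) :
    gain p V (τ, y) = Real.exp ((1 - p) * τ) * V τ y :=
  indicator_of_mem (show (τ, y) ∈ Ioi (0 : ℝ) ×ˢ (univ : Set (Sp n)) from ⟨hτ, mem_univ _⟩) _

lemma measurable_gain (hV : PotentialBounds σ Λ ϑ₁ ϑ₂ V) : Measurable (gain p V) := by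
  classical
  rw [gain, ← piecewise_eq_indicator]
  refine ContinuousOn.measurable_piecewise ?_ continuousOn_const
    (measurableSet_Ioi.prod MeasurableSet.univ)
  exact (by fun_prop : Continuous fun q : ℝ × Sp n => Real.exp ((1 - p) * q.1)).continuousOn.mul
    hV.cont

lemma gain_nonneg (hV : PotentialBounds σ Λ ϑ₁ ϑ₂ V) (q : ℝ × Sp n) : 0 ≤ gain p V q := by
  refine indicator_nonneg (fun q hq => ?_) q
  exact mul_nonneg (Real.exp_pos _).le (hV.nonneg q.1 hq.1 q.2)

lemma measurable_integrand (hV : PotentialBounds σ Λ ϑ₁ ϑ₂ V) {f : ℝ × Sp n → ENNReal}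
    (hf : Measurable f) :
    Measurable fun q => f q + ENNReal.ofReal (gain p V q) * f q ^ p :=
  hf.add ((measurable_gain hV).ennreal_ofReal.mul (hf.pow_const p))

lemma picard_mono (hp : 0 ≤ p) {f g : ℝ × Sp n → ENNReal} (h : f ≤ g) :
    picard p V u₀ f ≤ picard p V u₀ g := by
  intro q
  unfold picard
  gcongr with τ z
  · exact h _
  · exact h _

lemma monotone_picardIter (hp : 0 ≤ p) : Monotone (picardIter (n := n) p V u₀) := by
  refine monotone_nat_of_le_succ fun k => ?_
  induction k with
  | zero => exact fun q => zero_le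
  | succ k ih => exact picard_mono hp ih

/-- The growth rate of the supersolution. -/
def superRate (n : ℕ) (p a ϑ₂ : ℝ) (Λ : ℝ → ℝ) (t : ℝ) : ℝ :=
  growthConst n a 1 * (1 + ϑ₂ * rate p Λ t)

/-- The time factor of the supersolution. -/
def superFactor (n : ℕ) (p a ϑ₂ : ℝ) (Λ : ℝ → ℝ) (t : ℝ) : ℝ :=
  Real.exp (∫ τ in (0 : ℝ)..t, superRate n p a ϑ₂ Λ τ)

lemma continuous_superRate (hV : PotentialBounds σ Λ ϑ₁ ϑ₂ V) :
    Continuous (superRate n p a ϑ₂ Λ) :=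
  continuous_const.mul (continuous_const.add (continuous_const.mul (continuous_rate hV.cont_rate)))

lemma hasDerivAt_superFactor (hV : PotentialBounds σ Λ ϑ₁ ϑ₂ V) (t : ℝ) :
    HasDerivAt (superFactor n p a ϑ₂ Λ)
      (superRate n p a ϑ₂ Λ t * superFactor n p a ϑ₂ Λ t) t := by
  have h : HasDerivAt (fun t => ∫ τ in (0 : ℝ)..t, superRate n p a ϑ₂ Λ τ)
      (superRate n p a ϑ₂ Λ t) t :=
    ((continuous_superRate hV).integral_hasStrictDerivAt 0 t).hasDerivAt
  exact h.exp.congr_deriv (mul_comm _ _)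

lemma continuous_superFactor (hV : PotentialBounds σ Λ ϑ₁ ϑ₂ V) :
    Continuous (superFactor n p a ϑ₂ Λ) :=
  continuous_iff_continuousAt.mpr fun t => (hasDerivAt_superFactor hV t).continuousAt

lemma integral_superFactor (hV : PotentialBounds σ Λ ϑ₁ ϑ₂ V) (t : ℝ) :
    ∫ τ in (0 : ℝ)..t, superRate n p a ϑ₂ Λ τ * superFactor n p a ϑ₂ Λ τ =
      superFactor n p a ϑ₂ Λ t - 1 := by
  rw [intervalIntegral.integral_eq_sub_of_hasDerivAt (fun τ _ => hasDerivAt_superFactor hV τ)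
    (((continuous_superRate hV).mul (continuous_superFactor hV)).intervalIntegrable _ _)]
  simp [superFactor]

variable [NeZero n]

lemma measurable_inner (hV : PotentialBounds σ Λ ϑ₁ ϑ₂ V) {f : ℝ × Sp n → ENNReal}
    (hf : Measurable f) : Measurable fun r : Sp n × ℝ => ∫⁻ z, (f (r.2, r.1 - z) +
      ENNReal.ofReal (gain p V (r.2, r.1 - z)) * f (r.2, r.1 - z) ^ p) ∂bessMeas n := by
  have h := (measurable_integrand (p := p) hV hf).comp
    (by fun_prop : Measurable fun w : (Sp n × ℝ) × Sp n => (w.1.2, w.1.1 - w.2))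
  exact h.lintegral_prod_right'

/-- The variable time limit is moved into an indicator, so that measurability of parameter integrals
applies jointly in time and space. -/
lemma measurable_picard (hV : PotentialBounds σ Λ ϑ₁ ϑ₂ V) (hu₀ : Measurable u₀)
    {f : ℝ × Sp n → ENNReal} (hf : Measurable f) : Measurable (picard p V u₀ f) := by
  have h := measurable_inner (p := p) hV hf
  set g : Sp n × ℝ → ENNReal := fun r => ∫⁻ z, (f (r.2, r.1 - z) +
      ENNReal.ofReal (gain p V (r.2, r.1 - z)) * f (r.2, r.1 - z) ^ p) ∂bessMeas n with hg
  have hS : MeasurableSet {w : (ℝ × Sp n) × ℝ | 0 < w.2 ∧ w.2 ≤ w.1.1} :=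
    (measurableSet_lt measurable_const measurable_snd).inter
      (measurableSet_le measurable_snd measurable_fst.fst)
  have hi : Measurable ({w : (ℝ × Sp n) × ℝ | 0 < w.2 ∧ w.2 ≤ w.1.1}.indicator
      fun w => g (w.1.2, w.2)) := by
    refine Measurable.indicator ?_ hS
    exact h.comp (by fun_prop : Measurable fun w : (ℝ × Sp n) × ℝ => (w.1.2, w.2))
  have h2 := hi.lintegral_prod_right' (ν := (volume : Measure ℝ))
  have e : picard p V u₀ f = fun q => ENNReal.ofReal (u₀ q.2) +
      ∫⁻ τ, ({w : (ℝ × Sp n) × ℝ | 0 < w.2 ∧ w.2 ≤ w.1.1}.indicator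
        fun w => g (w.1.2, w.2)) (q, τ) := by
    funext q
    rw [picard, ← lintegral_indicator measurableSet_Ioc]
    rfl
  rw [e]
  exact (hu₀.comp measurable_snd).ennreal_ofReal.add h2

lemma measurable_picardIter (hV : PotentialBounds σ Λ ϑ₁ ϑ₂ V) (hu₀ : Measurable u₀) (k : ℕ) :
    Measurable (picardIter p V u₀ k) := by
  induction k with
  | zero => exact measurable_const
  | succ k ih => exact measurable_picard hV hu₀ ih

lemma measurable_picardLimit (hV : PotentialBounds σ Λ ϑ₁ ϑ₂ V) (hu₀ : Measurable u₀) :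
    Measurable (picardLimit p V u₀) :=
  Measurable.iSup fun k => measurable_picardIter hV hu₀ k

/-- Monotone convergence in space and then in time; the power commutes with suprema because it is an
order isomorphism of [0,∞]. No bound on the iterates is needed. -/
lemma picardLimit_fixed (hV : PotentialBounds σ Λ ϑ₁ ϑ₂ V) (hu₀ : Measurable u₀) (hp : 0 < p) :
    picard p V u₀ (picardLimit p V u₀) = picardLimit p V u₀ := by
  funext q
  have hmono := monotone_picardIter (n := n) (V := V) (u₀ := u₀) hp.le
  have hmeas := measurable_picardIter (p := p) hV hu₀
  set F : ℕ → ℝ × Sp n → ENNReal := fun k r =>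
    picardIter p V u₀ k r + ENNReal.ofReal (gain p V r) * picardIter p V u₀ k r ^ p with hF
  have hFmono : Monotone F := fun i j hij r => by
    have h1 := hmono hij r
    simp only [hF]
    gcongr
  have hint : ∀ r, picardLimit p V u₀ r + ENNReal.ofReal (gain p V r) * picardLimit p V u₀ r ^ p =
      ⨆ k, F k r := by
    intro r
    have hpow : (⨆ k, picardIter p V u₀ k r) ^ p = ⨆ k, picardIter p V u₀ k r ^ p :=
      (ENNReal.orderIsoRpow p hp).map_iSup _
    rw [picardLimit, hpow, ENNReal.mul_iSup, ENNReal.iSup_add_iSup_of_monotone]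
    · exact fun i j hij => hmono hij r
    · exact fun i j hij => by
        have h1 := hmono hij r
        gcongr
  have hz : ∀ τ, ∫⁻ z, (⨆ k, F k (τ, q.2 - z)) ∂bessMeas n =
      ⨆ k, ∫⁻ z, F k (τ, q.2 - z) ∂bessMeas n := by
    intro τ
    refine lintegral_iSup (fun k => ?_) fun i j hij z => hFmono hij _
    exact (measurable_integrand hV (hmeas k)).comp (by fun_prop)
  have ht : ∫⁻ τ in Ioc 0 q.1, (⨆ k, ∫⁻ z, F k (τ, q.2 - z) ∂bessMeas n) =
      ⨆ k, ∫⁻ τ in Ioc 0 q.1, ∫⁻ z, F k (τ, q.2 - z) ∂bessMeas n := by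
    refine lintegral_iSup (fun k => ?_) fun i j hij τ => lintegral_mono fun z => hFmono hij _
    exact (measurable_inner hV (hmeas k)).comp (by fun_prop : Measurable fun τ : ℝ => (q.2, τ))
  rw [picard]
  simp_rw [hint, hz]
  rw [ht, ENNReal.add_iSup]
  change ⨆ k, picardIter p V u₀ (k + 1) q = ⨆ k, picardIter p V u₀ k q
  have hq : Monotone fun k => picardIter p V u₀ k q := fun i j hij => hmono hij q
  exact hq.iSup_nat_add 1

/-! #### The supersolution -/

lemma superRate_nonneg (hV : PotentialBounds σ Λ ϑ₁ ϑ₂ V) (ha : 0 ≤ a) (t : ℝ) :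
    0 ≤ superRate n p a ϑ₂ Λ t := by
  have h1 := growthConst_pos n le_rfl ha
  have h2 := rate_pos (p := p) hV.pos_rate t
  have h3 := hV.pos₂
  unfold superRate
  positivity

lemma one_le_superFactor (hV : PotentialBounds σ Λ ϑ₁ ϑ₂ V) (ha : 0 ≤ a) {t : ℝ} (ht : 0 ≤ t) :
    1 ≤ superFactor n p a ϑ₂ Λ t :=
  Real.one_le_exp (intervalIntegral.integral_nonneg ht fun τ _ => superRate_nonneg hV ha τ)

/-- Since the amplitude is at least one, its p-th power is at most itself: the sublinear source is
dominated by a linear one, which excludes blow-up. -/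
lemma add_source_le (hV : PotentialBounds σ Λ ϑ₁ ϑ₂ V) (E : Exponents p σ a) {A τ v : ℝ}
    (hA : 1 ≤ A) (hτ : 0 < τ) (y : Sp n) (hv : 0 ≤ v)
    (hvA : v ≤ A * superFactor n p a ϑ₂ Λ τ * (1 + ‖y‖) ^ a) :
    v + gain p V (τ, y) * v ^ p ≤
      (1 + ϑ₂ * rate p Λ τ) * (A * superFactor n p a ϑ₂ Λ τ) * (1 + ‖y‖) ^ a := by
  have h1 := one_le_superFactor (n := n) (p := p) hV E.a_nonneg hτ.le
  set N := A * superFactor n p a ϑ₂ Λ τ with hN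
  have hN1 : 1 ≤ N := one_le_mul_of_one_le_of_one_le hA h1
  have h2 := hV.source_le E le_rfl (by linarith) hτ y hv hvA
  have h3 : N ^ p ≤ N := by
    simpa using Real.rpow_le_rpow_of_exponent_le hN1 E.p_lt_one.le
  have h4 := rate_pos (p := p) hV.pos_rate τ
  have h5 := hV.pos₂
  rw [gain_of_pos hτ]
  calc _ ≤ N * (1 + ‖y‖) ^ a + ϑ₂ * rate p Λ τ * N * (1 + ‖y‖) ^ a :=
        add_le_add hvA (h2.trans (by gcongr))
    _ = _ := by ring

lemma lintegral_growth_le (ha : 0 ≤ a) {c : ℝ} (hc : 0 ≤ c) (x : Sp n) :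
    ∫⁻ z, ENNReal.ofReal (c * (1 + ‖x - z‖) ^ a) ∂bessMeas n ≤
      ENNReal.ofReal (growthConst n a 1 * c * (1 + ‖x‖) ^ a) := by
  have hi := (integrable_growth n le_rfl ha).const_mul (c * (1 + ‖x‖) ^ a)
  calc _ ≤ ∫⁻ z, ENNReal.ofReal (c * (1 + ‖x‖) ^ a * (1 + ‖z‖ / 1) ^ a) ∂bessMeas n := by
        refine lintegral_mono fun z => ENNReal.ofReal_le_ofReal ?_
        rw [mul_assoc]
        gcongr
        exact growth_sub_le one_pos ha x z
    _ = ENNReal.ofReal (∫ z, c * (1 + ‖x‖) ^ a * (1 + ‖z‖ / 1) ^ a ∂bessMeas n) :=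
        (ofReal_integral_eq_lintegral_ofReal hi (ae_of_all _ fun z => by positivity)).symm
    _ = _ := by
        rw [integral_const_mul]
        congr 1
        unfold growthConst
        ring

/-- The bound is a supersolution: the time factor G solves G' = `superRate` · G with G(0) = 1, and
`superRate` already contains the bound of 𝓑 on the weight (1+|x|)^a. -/
lemma picardIter_le (hV : PotentialBounds σ Λ ϑ₁ ϑ₂ V) (E : Exponents p σ a) {A : ℝ} (hA : 1 ≤ A)
    (hu₀ : ∀ x, 0 ≤ u₀ x) (hu₀A : ∀ x, u₀ x ≤ A * (1 + ‖x‖) ^ a) (k : ℕ) {t : ℝ} (ht : 0 ≤ t)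
    (x : Sp n) : picardIter p V u₀ k (t, x) ≤
      ENNReal.ofReal (A * superFactor n p a ϑ₂ Λ t * (1 + ‖x‖) ^ a) := by
  induction k generalizing t x with
  | zero => exact zero_le
  | succ k ih =>
    have ha := E.a_nonneg
    have hin : ∀ τ ∈ Ioc 0 t, ∫⁻ z, (picardIter p V u₀ k (τ, x - z) +
        ENNReal.ofReal (gain p V (τ, x - z)) * picardIter p V u₀ k (τ, x - z) ^ p) ∂bessMeas n ≤
        ENNReal.ofReal (A * (1 + ‖x‖) ^ a *
          (superRate n p a ϑ₂ Λ τ * superFactor n p a ϑ₂ Λ τ)) := by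
      intro τ hτ
      have h1 := one_le_superFactor (n := n) (p := p) hV ha hτ.1.le
      have hr := rate_pos (p := p) hV.pos_rate τ
      have hθ := hV.pos₂
      have hpt : ∀ y, picardIter p V u₀ k (τ, y) +
          ENNReal.ofReal (gain p V (τ, y)) * picardIter p V u₀ k (τ, y) ^ p ≤ ENNReal.ofReal
          ((1 + ϑ₂ * rate p Λ τ) * (A * superFactor n p a ϑ₂ Λ τ) * (1 + ‖y‖) ^ a) := by
        intro y
        have hv0 : 0 ≤ A * superFactor n p a ϑ₂ Λ τ * (1 + ‖y‖) ^ a := by positivity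
        have hg := gain_nonneg (p := p) hV (τ, y)
        calc _ ≤ ENNReal.ofReal (A * superFactor n p a ϑ₂ Λ τ * (1 + ‖y‖) ^ a) +
              ENNReal.ofReal (gain p V (τ, y)) *
              ENNReal.ofReal (A * superFactor n p a ϑ₂ Λ τ * (1 + ‖y‖) ^ a) ^ p := by
              have h2 := ih hτ.1.le y
              have h3 := E.p_pos.le
              gcongr
          _ = ENNReal.ofReal (A * superFactor n p a ϑ₂ Λ τ * (1 + ‖y‖) ^ a +
              gain p V (τ, y) * (A * superFactor n p a ϑ₂ Λ τ * (1 + ‖y‖) ^ a) ^ p) := by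
              rw [ENNReal.ofReal_rpow_of_nonneg hv0 E.p_pos.le, ← ENNReal.ofReal_mul hg,
                ← ENNReal.ofReal_add hv0 (by positivity)]
          _ ≤ _ := ENNReal.ofReal_le_ofReal (add_source_le hV E hA hτ.1 y hv0 le_rfl)
      refine (lintegral_mono fun z => hpt (x - z)).trans ?_
      refine (lintegral_growth_le ha (by positivity) x).trans (le_of_eq ?_)
      congr 1
      unfold superRate
      ring
    have hcont : Continuous fun τ => A * (1 + ‖x‖) ^ a *
        (superRate n p a ϑ₂ Λ τ * superFactor n p a ϑ₂ Λ τ) :=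
      continuous_const.mul ((continuous_superRate hV).mul (continuous_superFactor hV))
    have hnn : ∀ τ, 0 ≤ A * (1 + ‖x‖) ^ a *
        (superRate n p a ϑ₂ Λ τ * superFactor n p a ϑ₂ Λ τ) := fun τ => by
      have h1 := superRate_nonneg (n := n) (p := p) hV ha τ
      have h2 : 0 < superFactor n p a ϑ₂ Λ τ := Real.exp_pos _
      positivity
    calc picardIter p V u₀ (k + 1) (t, x) ≤ ENNReal.ofReal (u₀ x) +
          ∫⁻ τ in Ioc 0 t, ENNReal.ofReal (A * (1 + ‖x‖) ^ a *
            (superRate n p a ϑ₂ Λ τ * superFactor n p a ϑ₂ Λ τ)) := by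
          rw [picardIter, picard]
          gcongr 1
          exact setLIntegral_mono' measurableSet_Ioc hin
      _ = ENNReal.ofReal (u₀ x + A * (1 + ‖x‖) ^ a * (superFactor n p a ϑ₂ Λ t - 1)) := by
          rw [← ofReal_integral_eq_lintegral_ofReal
            ((hcont.intervalIntegrable 0 t).1) (ae_of_all _ hnn),
            ← intervalIntegral.integral_of_le ht, intervalIntegral.integral_const_mul,
            integral_superFactor hV, ENNReal.ofReal_add (hu₀ x)]
          have h1 := one_le_superFactor (n := n) (p := p) hV ha ht
          exact mul_nonneg (by positivity) (by linarith)
      _ ≤ _ := by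
          apply ENNReal.ofReal_le_ofReal
          have := hu₀A x
          linarith

/-- The integral equation has a nonnegative solution in `C([0,∞); BC_a)`. -/
theorem exists_isMild (hV : PotentialBounds σ Λ ϑ₁ ϑ₂ V) (E : Exponents p σ a)
    (hu₀m : MemBC a u₀) (hu₀ : ∀ x, 0 ≤ u₀ x) : ∃ m, IsMild p a V u₀ m := by
  have ha := E.a_nonneg
  have hθ := hV.pos₂
  obtain ⟨C₀, -, hC₀⟩ := hu₀m.exists_bound ha
  set A := max C₀ 1 with hAdef
  have hA : 1 ≤ A := le_max_right _ _
  have hu₀A : ∀ x, u₀ x ≤ A * (1 + ‖x‖) ^ a := fun x =>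
    ((le_abs_self _).trans (hC₀ x)).trans (by gcongr; exact le_max_left _ _)
  set F := picardLimit p V u₀ with hF
  have hFm : Measurable F := measurable_picardLimit hV hu₀m.1.measurable
  have hFle : ∀ t, 0 ≤ t → ∀ x, F (t, x) ≤
      ENNReal.ofReal (A * superFactor n p a ϑ₂ Λ t * (1 + ‖x‖) ^ a) := fun t ht x =>
    iSup_le fun k => picardIter_le hV E hA hu₀ hu₀A k ht x
  set m : ℝ → Sp n → ℝ := fun t x => (F (t, x)).toReal with hm
  have hmF : ∀ t, 0 ≤ t → ∀ x, ENNReal.ofReal (m t x) = F (t, x) := fun t ht x =>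
    ENNReal.ofReal_toReal ((hFle t ht x).trans_lt ENNReal.ofReal_lt_top).ne
  have hm0 : ∀ t x, 0 ≤ m t x := fun t x => ENNReal.toReal_nonneg
  have hfac : ∀ t, 0 < superFactor n p a ϑ₂ Λ t := fun t => Real.exp_pos _
  have hmle : ∀ t, 0 ≤ t → ∀ x, m t x ≤ A * superFactor n p a ϑ₂ Λ t * (1 + ‖x‖) ^ a := by
    intro t ht x
    have h1 := hfac t
    exact ENNReal.toReal_le_of_le_ofReal (by positivity) (hFle t ht x)
  have hmm : Measurable fun q : ℝ × Sp n => m q.1 q.2 := hFm.ennreal_toReal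
  set S : ℝ → Sp n → ℝ := fun τ y => m τ y + gain p V (τ, y) * m τ y ^ p with hS
  have hSm : Measurable fun q : ℝ × Sp n => S q.1 q.2 :=
    hmm.add ((measurable_gain hV).mul (hmm.pow_const p))
  have hSτ : ∀ τ, Measurable (S τ) := fun τ => hSm.comp (measurable_prodMk_left (x := τ))
  have hS0 : ∀ τ y, 0 ≤ S τ y := fun τ y =>
    add_nonneg (hm0 τ y) (mul_nonneg (gain_nonneg hV _) (Real.rpow_nonneg (hm0 τ y) _))
  set cS : ℝ → ℝ := fun τ => (1 + ϑ₂ * rate p Λ τ) * (A * superFactor n p a ϑ₂ Λ τ) with hcS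
  have hcSc : Continuous cS := (continuous_const.add (continuous_const.mul
    (continuous_rate hV.cont_rate))).mul (continuous_const.mul (continuous_superFactor hV))
  have hSle : ∀ τ, 0 < τ → ∀ y, |S τ y| ≤ cS τ * (1 + ‖y‖) ^ a := by
    intro τ hτ y
    rw [abs_of_nonneg (hS0 τ y)]
    exact add_source_le hV E hA hτ y (hm0 τ y) (hmle τ hτ.le y)
  have hBm : ∀ x, Measurable fun τ => besselOp n (S τ) x := by
    intro x
    simp only [besselOp_eq_integral]
    have h1 : StronglyMeasurable fun w : ℝ × Sp n => S w.1 (x - w.2) :=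
      (hSm.comp (by fun_prop : Measurable fun w : ℝ × Sp n => (w.1, x - w.2))).stronglyMeasurable
    exact (h1.integral_prod_right' (ν := bessMeas n)).measurable
  have hBle : ∀ τ, 0 < τ → ∀ x, |besselOp n (S τ) x| ≤
      growthConst n a 1 * cS τ * (1 + ‖x‖) ^ a := fun τ hτ x =>
    abs_besselOp_le le_rfl ha (hSτ τ) (hSle τ hτ) x
  have hbint : ∀ (x : Sp n) s t, IntervalIntegrable (fun τ => growthConst n a 1 * cS τ * (1 + ‖x‖) ^ a)
      volume s t := fun x s t =>
    ((continuous_const.mul hcSc).mul continuous_const).intervalIntegrable _ _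
  have hBint : ∀ x s t, 0 ≤ s → 0 ≤ t →
      IntervalIntegrable (fun τ => besselOp n (S τ) x) volume s t := by
    intro x s t hs ht
    refine (hbint x s t).mono_fun' (hBm x).aestronglyMeasurable ?_
    filter_upwards [ae_restrict_mem measurableSet_uIoc] with τ hτ
    exact hBle τ (lt_of_le_of_lt (le_min hs ht) hτ.1) x
  -- The supersolution makes everything finite, so the fixed-point identity passes from [0,∞] to
  -- real integrals.
  have heq : ∀ t, 0 ≤ t → ∀ x, m t x = u₀ x + ∫ τ in (0 : ℝ)..t, besselOp n (S τ) x := by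
    intro t ht x
    have h1 : F (t, x) = picard p V u₀ F (t, x) :=
      (congrFun (picardLimit_fixed hV hu₀m.1.measurable E.p_pos) (t, x)).symm
    have hB0 : ∀ τ, 0 ≤ besselOp n (S τ) x := fun τ => besselOp_nonneg (hS0 τ) x
    have h2 : ∀ τ ∈ Ioc 0 t, ∫⁻ z, (F (τ, x - z) +
        ENNReal.ofReal (gain p V (τ, x - z)) * F (τ, x - z) ^ p) ∂bessMeas n =
        ENNReal.ofReal (besselOp n (S τ) x) := by
      intro τ hτ
      rw [besselOp_eq_integral, ofReal_integral_eq_lintegral_ofReal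
        (integrable_comp_sub le_rfl ha (hSτ τ) (hSle τ hτ.1) x) (ae_of_all _ fun z => hS0 τ _)]
      refine lintegral_congr fun z => ?_
      have h3 := hm0 τ (x - z)
      have h4 := gain_nonneg (p := p) hV (τ, x - z)
      rw [← hmF τ hτ.1.le, ENNReal.ofReal_rpow_of_nonneg h3 E.p_pos.le, ← ENNReal.ofReal_mul h4,
        ← ENNReal.ofReal_add h3 (by positivity)]
    rw [picard, setLIntegral_congr_fun measurableSet_Ioc h2,
      ← ofReal_integral_eq_lintegral_ofReal (hBint x 0 t le_rfl ht).1 (ae_of_all _ hB0),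
      ← intervalIntegral.integral_of_le ht] at h1
    have h5 : 0 ≤ ∫ τ in (0 : ℝ)..t, besselOp n (S τ) x :=
      intervalIntegral.integral_nonneg ht fun τ _ => hB0 τ
    rw [← ENNReal.ofReal_add (hu₀ x) h5] at h1
    simp only [hm, h1]
    exact ENNReal.toReal_ofReal (add_nonneg (hu₀ x) h5)
  have hcont : ∀ t, 0 ≤ t → Continuous (m t) := by
    intro t ht
    have e : m t = fun x => u₀ x + ∫ τ in (0 : ℝ)..t, besselOp n (S τ) x := funext (heq t ht)
    rw [e]
    refine hu₀m.1.add (continuous_iff_continuousAt.mpr fun x₀ => ?_)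
    refine intervalIntegral.continuousAt_of_dominated_interval
      (bound := fun τ => growthConst n a 1 * cS τ * (1 + (‖x₀‖ + 1)) ^ a)
      (Eventually.of_forall fun x => (hBm x).aestronglyMeasurable) ?_
      (((continuous_const.mul hcSc).mul continuous_const).intervalIntegrable _ _) ?_
    · filter_upwards [Metric.ball_mem_nhds x₀ one_pos] with x hx
      refine ae_of_all _ fun τ hτ => ?_
      rw [uIoc_of_le ht] at hτ
      refine (hBle τ hτ.1 x).trans ?_
      have h1 : ‖x‖ ≤ ‖x₀‖ + 1 := by
        have h2 : ‖x - x₀‖ < 1 := by simpa [dist_eq_norm] using hx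
        have h3 := norm_add_le (x - x₀) x₀
        simp only [sub_add_cancel] at h3
        linarith
      have h4 := (growthConst_pos n le_rfl ha).le
      have h5 : 0 ≤ cS τ := by
        have := hSle τ hτ.1 0
        simpa using (abs_nonneg _).trans this
      gcongr
    · refine ae_of_all _ fun τ hτ => ?_
      rw [uIoc_of_le ht] at hτ
      exact (continuous_besselOp ha (hSτ τ) (hSle τ hτ.1)).continuousAt
  -- The time increment is an integral of 𝓑S, bounded by a continuous function of time times
  -- (1+|x|)^a; this gives continuity in the weighted norm.
  have hmZ : MemZ a m := by
    refine memZ_of_bound ha (fun t ht => memBC_of_bound (C := A * superFactor n p a ϑ₂ Λ t) ha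
      (hcont t ht) fun y => ?_)
      (fun t₀ t => |∫ τ in t₀..t, growthConst n a 1 * cS τ|) ?_ ?_
    · rw [abs_of_nonneg (hm0 t y)]; exact hmle t ht y
    · intro t₀ _
      have h1 : Continuous fun t => ∫ τ in t₀..t, growthConst n a 1 * cS τ :=
        continuous_iff_continuousAt.mpr fun t =>
          ((continuous_const.mul hcSc).integral_hasStrictDerivAt t₀ t).hasDerivAt.continuousAt
      have h2 := (h1.abs.tendsto t₀).mono_left (nhdsWithin_le_nhds (s := Ici 0))
      simpa using h2
    · intro t₀ t ht₀ ht x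
      rw [heq t ht x, heq t₀ ht₀ x, add_sub_add_left_eq_sub,
        intervalIntegral.integral_interval_sub_left (hBint x 0 t le_rfl ht)
          (hBint x 0 t₀ le_rfl ht₀)]
      have h1 : ‖∫ τ in t₀..t, besselOp n (S τ) x‖ ≤
          |∫ τ in t₀..t, growthConst n a 1 * cS τ * (1 + ‖x‖) ^ a| := by
        refine intervalIntegral.norm_integral_le_abs_of_norm_le ?_ (hbint x t₀ t)
        filter_upwards [ae_restrict_mem measurableSet_uIoc] with τ hτ
        exact hBle τ (lt_of_le_of_lt (le_min ht₀ ht) hτ.1) x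
      rw [Real.norm_eq_abs, intervalIntegral.integral_mul_const, abs_mul,
        abs_of_nonneg (a := (1 + ‖x‖) ^ a) (by positivity)] at h1
      exact h1
  refine ⟨m, fun t _ x => hm0 t x, hmZ, fun t ht x => ?_⟩
  rw [heq t ht x, add_assoc, ← intervalIntegral.integral_add
    (intervalIntegrable_linear ha hmZ ht x)
    (intervalIntegrable_source hV E (fun t _ x => hm0 t x) hmZ ht x)]
  congr 1
  rw [intervalIntegral.integral_of_le ht, intervalIntegral.integral_of_le ht]
  refine setIntegral_congr_fun measurableSet_Ioc fun τ hτ => ?_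
  obtain ⟨M, -, hM⟩ := (hmZ.1 τ hτ.1.le).exists_bound ha
  have hi := integrable_comp_sub le_rfl ha (hmZ.1 τ hτ.1.le).1.measurable hM x
  have hj := (integrable_source hV E (fun t _ x => hm0 t x) hmZ hτ.1 x).const_mul
    (Real.exp ((1 - p) * τ))
  have h1 := besselOp_add (φ := m τ)
    (ψ := fun y => Real.exp ((1 - p) * τ) * (V τ y * m τ y ^ p)) hi hj
  rw [besselOp_const_mul] at h1
  rw [← h1]
  congr 1
  funext y
  simp only [hS]
  rw [gain_of_pos hτ.1, mul_assoc]

end Existence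

/-! ### Well-posedness and the exact power potential -/

section WellPosed

variable {n : ℕ} {p σ a ϑ₁ ϑ₂ : ℝ} {Λ : ℝ → ℝ} {V : ℝ → Sp n → ℝ} {u₀ : Sp n → ℝ}

lemma potentialBounds_power (hσ : 0 ≤ σ) (hΛ : ContinuousOn Λ (Ici 0)) (hΛ0 : ∀ t, 0 ≤ t → 0 < Λ t)
    (hV : ∀ t, 0 < t → ∀ x, V t x = Λ t * ‖x‖ ^ σ) : PotentialBounds σ Λ 1 1 V where
  cont := by
    have h1 : ContinuousOn (fun q : ℝ × Sp n => Λ q.1) (Ioi 0 ×ˢ univ) :=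
      hΛ.comp (f := Prod.fst) (by fun_prop) fun q hq => (mem_Ioi.1 hq.1).le
    have h2 : Continuous fun q : ℝ × Sp n => ‖q.2‖ ^ σ :=
      (continuous_norm.comp continuous_snd).rpow_const fun _ => Or.inr hσ
    exact (h1.mul h2.continuousOn).congr fun q hq => hV q.1 hq.1 q.2
  nonneg t ht x := by
    rw [hV t ht]
    exact mul_nonneg (hΛ0 t ht.le).le (by positivity)
  cont_rate := hΛ
  pos_rate := hΛ0
  pos₁ := one_pos
  pos₂ := one_pos
  lower t ht x _ := by rw [hV t ht, one_mul]
  upper t ht x := by rw [hV t ht, one_mul]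

variable [NeZero n]

lemma PotentialBounds.isBesselLowerConstant_halfMass (hV : PotentialBounds σ Λ ϑ₁ ϑ₂ V)
    (hσ : 0 ≤ σ) (D : ℝ) : IsBesselLowerConstant σ D Λ ϑ₁ V (halfMass n 0) := by
  refine ⟨halfMass_pos n le_rfl, fun d hd _ t ht x => ?_⟩
  exact bessel_lower_estimate hσ hd (mul_nonneg hV.pos₁.le (hV.pos_rate t ht.le).le)
    (hV.continuous_space ht).measurable (hV.nonneg t ht) (hV.lower t ht) (hV.upper t ht) x

theorem existsUnique_globalSSolution (hV : PotentialBounds σ Λ ϑ₁ ϑ₂ V) (E : Exponents p σ a)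
    (hu₀m : MemBC a u₀) (hu₀ : ∀ x, 0 ≤ u₀ x) (hne : ∃ x, u₀ x ≠ 0) {ε₀ : ℝ}
    (hε : IsBesselLowerConstant σ (p * σ / (1 - p)) Λ ϑ₁ V ε₀) (hpε : p < ε₀ * (ϑ₁ / ϑ₂)) :
    ExistsUniqueGlobalSSolution p a V u₀ := by
  obtain ⟨m, hm⟩ := exists_isMild hV E hu₀m hu₀
  refine ⟨_, hm.isGlobalSSolution E.a_nonneg, fun v hv t ht x => ?_⟩
  rw [← hv.isMild.unique hV E hm hu₀m hu₀ hne hε hpε ht x, ← mul_assoc, ← Real.exp_add]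
  simp

/-- Subharmonicity of |x|^{σ+d} replaces the lossy mass estimate; with ε₀ = 1 the smallness
condition becomes p < 1. -/
lemma isBesselLowerConstant_power (hσ : σ ∈ Jplus n)
    (hV : ∀ t, 0 < t → ∀ x, V t x = Λ t * ‖x‖ ^ σ) (hΛ0 : ∀ t, 0 ≤ t → 0 < Λ t) :
    IsBesselLowerConstant σ (p * σ / (1 - p)) Λ 1 V 1 := by
  refine ⟨one_pos, fun d hd0 hd t ht x => ?_⟩
  have h : (fun y => V t y * ‖y‖ ^ d) = fun y => Λ t * ‖y‖ ^ (σ + d) := by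
    funext y
    rw [hV t ht, mul_assoc, Real.rpow_add_of_nonneg (norm_nonneg y) hσ.1 hd0]
  rw [h, besselOp_const_mul, one_mul, one_mul]
  exact mul_le_mul_of_nonneg_left (norm_rpow_le_besselOp (Jplus_add hσ hd0 hd) x) (hΛ0 t ht.le).le

end WellPosed

end Pseudoparabolic

end

theorem mainTheorem5 (n : ℕ) (hn : 1 ≤ n) (p σ a : ℝ) (hp₀ : 0 < p) (hp₁ : p < 1)
    (hσ : σ ∈ Pseudoparabolic.Jplus n) (ha : max σ 0 / (1 - p) ≤ a)
    (u₀ : Pseudoparabolic.Sp n → ℝ) (hu₀ : Pseudoparabolic.MemBC a u₀)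
    (hu₀_nonneg : ∀ x, 0 ≤ u₀ x) (hu₀_ne : ∃ x, u₀ x ≠ 0) :
    -- a constant `ε₀` exists, and can be chosen depending only on `n`, `σ`, `p`
    (∃ ε₀ : ℝ, 0 < ε₀ ∧
      ∀ (V : ℝ → Pseudoparabolic.Sp n → ℝ) (Λ : ℝ → ℝ) (ϑ₁ ϑ₂ : ℝ),
        Pseudoparabolic.PotentialBounds σ Λ ϑ₁ ϑ₂ V →
        Pseudoparabolic.IsBesselLowerConstant σ (p * σ / (1 - p)) Λ ϑ₁ V ε₀) ∧
    -- well-posedness for `p < ε₀ ϑ₁ / ϑ₂`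
    (∀ (V : ℝ → Pseudoparabolic.Sp n → ℝ) (Λ : ℝ → ℝ) (ϑ₁ ϑ₂ ε₀ : ℝ),
        Pseudoparabolic.PotentialBounds σ Λ ϑ₁ ϑ₂ V →
        Pseudoparabolic.IsBesselLowerConstant σ (p * σ / (1 - p)) Λ ϑ₁ V ε₀ →
        p < ε₀ * (ϑ₁ / ϑ₂) →
        Pseudoparabolic.ExistsUniqueGlobalSSolution p a V u₀) ∧
    -- well-posedness for `V = Λ(t)|x|^σ` and every `0 < p < 1`
    (∀ (V : ℝ → Pseudoparabolic.Sp n → ℝ) (Λ : ℝ → ℝ),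
        ContinuousOn Λ (Set.Ici 0) → (∀ t, 0 ≤ t → 0 < Λ t) →
        (∀ t, 0 < t → ∀ x, V t x = Λ t * ‖x‖ ^ σ) →
        Pseudoparabolic.ExistsUniqueGlobalSSolution p a V u₀) := by
  have : NeZero n := ⟨by omega⟩
  have E : Pseudoparabolic.Exponents p σ a := by
    refine ⟨hp₀, hp₁, hσ.1, (le_max_left σ 0).trans ?_⟩
    rwa [div_le_iff₀ (by linarith)] at ha
  -- The constant is `halfMass n 0`, half of the mass of B outside the unit ball; it depends on n
  -- alone.
  refine ⟨⟨_, Pseudoparabolic.halfMass_pos n le_rfl, fun V Λ ϑ₁ ϑ₂ hV =>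
      hV.isBesselLowerConstant_halfMass hσ.1 _⟩,
    fun V Λ ϑ₁ ϑ₂ ε₀ hV hε hpε =>
      Pseudoparabolic.existsUnique_globalSSolution hV E hu₀ hu₀_nonneg hu₀_ne hε hpε,
    fun V Λ hΛ hΛ0 hV => ?_⟩
  exact Pseudoparabolic.existsUnique_globalSSolution
    (Pseudoparabolic.potentialBounds_power hσ.1 hΛ hΛ0 hV) E hu₀ hu₀_nonneg hu₀_ne
    (Pseudoparabolic.isBesselLowerConstant_power hσ hV hΛ0) (by simpa using hp₁)
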